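/- **Setting.** Let $H$ be a subspace of $\mathbb F_5^n$. For $x=(x_1,x_2,x_3)\in H^3$ put $x\cdot e_i=x_i$ for $i\le 3$ and $x\cdot e_4=x_1+x_2+x_3$. For finite sets write $\mathbb P(A:B)=|A\cap B|/|B|$, and identify a set with its indicator function. A *$T$-system* consists of sets $S_i\subset H$ ($1\le i\le 4$), $R_{j,k}\subset S_j\times S_k$ ($1\le j<k\le 4$), and $T\subset\bigcap_{j<k}\overline R_{j,k}$, where $\overline R_{j,k}=\{x\in H^3:(x\cdot e_j,x\cdot e_k)\in R_{j,k}\}$. A *corner-system* is a $T$-system together with a set $A\subset T$. Put $T_\ell=\bigcap_{j<k,\;j,k\ne\ell}\overline R_{j,k}$ ($1\le\ell\le4$), $\delta_{T:\ell}=\mathbb P(T:T_\ell)$, $\delta_{j,k}=\mathbb P(R_{j,k}:S_j\times S_k)$, $\delta_i=\mathbb P(S_i:H)$ and $\delta_{A:T}=\mathbb P(A:T)$. The box norms are $$\|f\|_{\Box(X\times Y)}^4=\mathbb E_{x,x'\in X,\;y,y'\in Y}f(x,y)f(x,y')f(x',y)f(x',y')$$ and, analogously, $\|f\|^8_{\Box(X\times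 Y\times Z)}$ is the average of the product of $f$ over the eight vertices of a box. For $g:H^3\to\mathbb R$, $\|g\|_{\Box\{i\ne\ell\}}$ is the three-dimensional box norm over $H\times H\times H$ of $g$ written in the three coordinates $x\cdot e_i$, $i\ne\ell$. Finally, $\|f\|_{U(3)}$ is the box norm of $(x,y,z)\mapsto f(x+y+z)$ on $H\times H\times H$. Fix constants $C_{\rm adm}\ge 64$ and $0<\kappa_{\rm adm}<1$. For $0<\varepsilon<1$ a $T$-system is *$\varepsilon$-admissible* if $$\frac{\|T-\delta_{T:\ell}T_\ell\|_{\Box\{i\ne\ell\}}}{\|T_\ell\|_{\Box\{i\neq\ell\}}}\le\kappa_{\rm adm}\,\varepsilon^{C_{\rm adm}}\,\mathbb P(T:T_\ell)^{C_{\rm adm}}\quad(1\le\ell\le4),$$ $$\|R_{j,k}-\delta_{j,k}\|_{\Box(S_j\times S_k)}\le\kappa_{\rm adm}\,\varepsilon^{C_{\rm adm}}\,\mathbb P(T:H^3)^{C_{\rm adm}}\quad(1\le j<k\le4),$$ $$\|S_i-\delta_i\|_{U(3)}\le\kappa_{\rm adm}\,\varepsilon^{C_{\rm adm}}\,\mathbb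 P(T:H^3)^{C_{\rm adm}}\quad(1\le i\le4).$$ A corner-system is $\varepsilon$-admissible if its $T$-system is. **Density Increment Lemma.** The following holds provided $C_{\rm adm}\ge 64$ is sufficiently large and $\kappa_{\rm adm}\in(0,1)$ is sufficiently small in terms of $C_{\rm adm}$. For every $\kappa>0$ there is $\kappa'\in(0,1)$, depending only on $\kappa$, $C_{\rm adm}$ and $\kappa_{\rm adm}$, such that for every $n$, every subspace $H\le\mathbb F_5^n$, and every $\delta_{A:T}$-admissible corner-system in $H$ for which the uniformity condition $$\max_{1\le\ell\le4}\frac{\|A-\delta_{A:T}T\|_{\Box\{i\ne\ell\}}}{\|T\|_{\Box\{i\ne\ell\}}}\le\kappa\,\delta_{A:T}^4$$ does *not* hold, there are an index $\ell$ and a $T$-system $\{H,S_i',R_{j,k}',T'\}$ with $$S_i'\subset S_i,\qquad R_{j,k}'\subset R_{j,k},\qquad T'=T\cap T'_\ell,\qquad T'_\ell=\bigcap_{j<k,\;j,k\ne\ell}\overline{R'}_{j,k},$$ such that $$\mathbb P(T':T)\ge\delta_{A:T}^{1/\kappa'}\qquad\text{and}\qquad\mathbb P(A:T')\ge\delta_{A:T}+\delta_{A:T}^{1/\kappa'}.$$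 -/

import Mathlib

open Finset
open scoped BigOperators

noncomputable section

namespace Corners

/-- The conditional probability `P(A : B) = |A ∩ B| / |B|` with respect to counting measure. -/
def prob {α : Type*} [DecidableEq α] (A B : Finset α) : ℝ :=
  ((A ∩ B).card : ℝ) / (B.card : ℝ)

/-- The indicator function of a finite set. -/
def ind {α : Type*} [DecidableEq α] (A : Finset α) (x : α) : ℝ :=
  if x ∈ A then 1 else 0

/-- The two-dimensional box norm of `f` on `X × Y`. -/
def boxNorm₂ {α β : Type*} (X : Finset α) (Y : Finset β) (f : α → β → ℝ) : ℝ :=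
  (𝔼 x ∈ X, 𝔼 x' ∈ X, 𝔼 y ∈ Y, 𝔼 y' ∈ Y,
    f x y * f x y' * f x' y * f x' y') ^ (1 / 4 : ℝ)

/-- The three-dimensional box norm of `f` on `X × Y × Z`. -/
def boxNorm₃ {α β γ : Type*} (X : Finset α) (Y : Finset β) (Z : Finset γ)
    (f : α → β → γ → ℝ) : ℝ :=
  (𝔼 x ∈ X, 𝔼 x' ∈ X, 𝔼 y ∈ Y, 𝔼 y' ∈ Y, 𝔼 z ∈ Z, 𝔼 z' ∈ Z,
    f x y z * f x y' z * f x' y z * f x' y' z *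
      (f x y z' * f x y' z' * f x' y z' * f x' y' z')) ^ (1 / 8 : ℝ)

section Group

variable {V : Type*} [AddCommGroup V]

/-- The coordinate `x · e_i` of `x ∈ V × V × V`, where `e_4 = e_1 + e_2 + e_3`. The indices
`1, 2, 3, 4` are represented by `0, 1, 2, 3 : Fin 4`. -/
def coord (i : Fin 4) (x : V × V × V) : V :=
  ![x.1, x.2.1, x.2.2, x.1 + x.2.1 + x.2.2] i

/-- The point of `V × V × V` whose three coordinates `x · e_i`, `i ≠ ℓ`, taken in increasing order
of `i`, are `a, b, c`. -/
def ofCoords (l : Fin 4) (a b c : V) : V × V × V :=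
  ![(c - a - b, a, b), (a, c - a - b, b), (a, b, c - a - b), (a, b, c)] l

theorem coord_ofCoords (l : Fin 4) (i : Fin 3) (a b c : V) :
    coord (l.succAbove i) (ofCoords l a b c) = ![a, b, c] i := by
  fin_cases l <;> fin_cases i <;> simp [coord, ofCoords, Fin.succAbove, Fin.lt_def] <;> abel

variable [Fintype V]

/-- The box norm of `g : V × V × V → ℝ` in the three coordinates `x · e_i`, `i ≠ ℓ`. -/
def boxNorm (l : Fin 4) (g : V × V × V → ℝ) : ℝ :=
  boxNorm₃ (univ : Finset V) (univ : Finset V) (univ : Finset V)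
    (fun a b c => g (ofCoords l a b c))

/-- The norm `‖f‖_{U(3)}`: the box norm of `(x, y, z) ↦ f (x + y + z)`. -/
def U3norm (f : V → ℝ) : ℝ :=
  boxNorm₃ (univ : Finset V) (univ : Finset V) (univ : Finset V) (fun x y z => f (x + y + z))

variable [DecidableEq V]

/-- The set of all `x ∈ V × V × V` with `(x · e_j, x · e_k) ∈ R`. -/
def overline (j k : Fin 4) (R : Finset (V × V)) : Finset (V × V × V) :=
  univ.filter (fun x => (coord j x, coord k x) ∈ R)

end Group

/-- A `T`-system in `V × V × V`. Only the sets `R j k` with `j < k` are meaningful. -/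
structure TSystem (V : Type*) [AddCommGroup V] [Fintype V] [DecidableEq V] where
  S : Fin 4 → Finset V
  R : Fin 4 → Fin 4 → Finset (V × V)
  T : Finset (V × V × V)
  R_subset : ∀ j k, j < k → R j k ⊆ S j ×ˢ S k
  T_subset : ∀ j k, j < k → T ⊆ overline j k (R j k)

/-- A corner-system: a `T`-system together with a subset `A` of `T`. -/
structure CornerSystem (V : Type*) [AddCommGroup V] [Fintype V] [DecidableEq V] extends
    TSystem V where
  A : Finset (V × V × V)
  A_subset : A ⊆ T

section Systems

variable {V : Type*} [AddCommGroup V] [Fintype V] [DecidableEq V]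

/-- The set `T_ℓ`, the intersection of the sets `overline j k (R j k)` over all `j < k` that are
both different from `ℓ`. -/
def TSystem.face (t : TSystem V) (l : Fin 4) : Finset (V × V × V) :=
  univ.filter (fun x => ∀ j k, j < k → j ≠ l → k ≠ l → x ∈ overline j k (t.R j k))

/-- `ε`-admissibility of a `T`-system, with respect to the constants `C = C_admiss` and
`κ = κ_admiss`. -/
def TSystem.Admissible (C κ ε : ℝ) (t : TSystem V) : Prop :=
  0 < ε ∧ ε < 1 ∧
  (∀ l : Fin 4,
    boxNorm l (fun x => ind t.T x - prob t.T (t.face l) * ind (t.face l) x) /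
        boxNorm l (ind (t.face l))
      ≤ κ * ε ^ C * prob t.T (t.face l) ^ C) ∧
  (∀ j k : Fin 4, j < k →
    boxNorm₂ (t.S j) (t.S k)
        (fun x y => ind (t.R j k) (x, y) - prob (t.R j k) (t.S j ×ˢ t.S k))
      ≤ κ * ε ^ C * prob t.T univ ^ C) ∧
  (∀ i : Fin 4,
    U3norm (fun x => ind (t.S i) x - prob (t.S i) univ)
      ≤ κ * ε ^ C * prob t.T univ ^ C)

/-- The density `δ_{A : T} = P(A : T)`. -/
def CornerSystem.density (a : CornerSystem V) : ℝ := prob a.A a.T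

/-- The uniformity condition of the von Neumann lemma, with the constant `κ`: the maximum over `ℓ`
of the relative box norms of `A - δ_{A : T} T` is at most `κ δ_{A : T} ^ 4`. -/
def CornerSystem.UniformEnough (κ : ℝ) (a : CornerSystem V) : Prop :=
  ∀ l : Fin 4,
    boxNorm l (fun x => ind a.A x - a.density * ind a.T x) / boxNorm l (ind a.T)
      ≤ κ * a.density ^ 4

end Systems

end Corners

end

/-!
Fix an index `l` for which the relative box norm of `f = A - δ T` is large. In the three
coordinates different from `l`, the set `T` becomes a set of triangles in the tripartite graph
formed by three of the sets `R j k`, the function `f` is supported on `T` and has average zero, and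
the refinement sought is obtained by shrinking these three graphs. So what has to be shown is that
`f` correlates with a product `a (x, y) * b (x, z) * c (y, z)` of bounded functions: the
correlation is multilinear and `f` has average zero, hence one may pass to indicator functions
(`exists_cell`), and the set that they cut out of `T` is the new `T'`, on which `A` is denser than
on `T`.

The correlation has to be at least a power of `δ` times the density of `T`, although `T` may be far
sparser than any power of `δ`. The usual proof, by Cauchy–Schwarz inequalities that bound `f` by
`1`, is therefore not available. What admissibility provides instead is that `T` has almost the
minimal number of octahedra given its density in the set of all triangles, and that the three
graphs are cut-uniform. The structure `Triangles` records this, and `Triangles.exists_correlation`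
is the inverse theorem relative to such a set.

Its proof views `T` in three ways as a family of bipartite graphs with almost the minimal number of
four-cycles, the structure `Fibre`: pairs of triangles of `T` with a common edge in `X × Y`, pairs
with a common edge in `X × Z`, and the links of the vertices in `X`. For such families the basic
inequality is `Fibre.kernel_square_ge`: a Cauchy–Schwarz inequality weighted by `t`, after which
`t` can be replaced by a constant multiple of the product of its vertex sets
(`Fibre.abs_avg_balanced_le`, by near orthogonality of the columns of the balanced function). It
implies the two-dimensional relative inverse theorem `Fibre.exists_correlation`. In three
dimensions the first family gives, for each pair `z, z'`, a weight `b` on `Y` that correlates with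
`f (x, y, z) f (x, y, z')`. The second family shows that the products of these weights over pairs
in `Y` have many four-cycles, so that `b` correlates with a function `P (z, z') F (y, z) G (y, z')`
(`exists_common_kernel`). The factor `P` disappears in a Cauchy–Schwarz inequality, and the third
family finishes the argument. All errors are relative to the main terms, so no density is lost.

Three regimes have to be treated. If `T` has large density in the whole space,
`Triangles.exists_correlation` is applied with all graphs complete. Otherwise the uniformity of the
graphs is much finer than any quantity in question, and it is applied to `T` itself if `T` is
sparse in the set of all triangles, or else to the set of all triangles. The resulting bound is
monomial in `δ`. Since no set has density more than `1`, the gain is also at most `1 - δ`; hence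
`δ` stays away from `1`, and the constant can be absorbed in the exponent (`exists_pow_le`).
-/

set_option linter.unusedSectionVars false

namespace Corners

/-! ### Averages over finite types -/

section Averages

variable {ι κ μ : Type*} [Fintype ι] [Fintype κ] [Fintype μ]

theorem avg_mono {f g : ι → ℝ} (h : ∀ i, f i ≤ g i) : 𝔼 i, f i ≤ 𝔼 i, g i :=
  Finset.expect_le_expect fun i _ => h i

theorem avg_nonneg {f : ι → ℝ} (h : ∀ i, 0 ≤ f i) : 0 ≤ 𝔼 i, f i :=
  Finset.expect_nonneg fun i _ => h i

theorem abs_avg_le (f : ι → ℝ) : |𝔼 i, f i| ≤ 𝔼 i, |f i| :=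
  Finset.abs_expect_le _ _

theorem avg_congr {f g : ι → ℝ} (h : ∀ i, f i = g i) : 𝔼 i, f i = 𝔼 i, g i :=
  Finset.expect_congr rfl fun i _ => h i

theorem avg_swap (f : ι → κ → ℝ) : 𝔼 i, 𝔼 j, f i j = 𝔼 j, 𝔼 i, f i j :=
  Finset.expect_comm _ _ _

theorem avg_prod (f : ι × κ → ℝ) : 𝔼 x, f x = 𝔼 i, 𝔼 j, f (i, j) := by
  rw [← Finset.univ_product_univ, Finset.expect_product]

theorem avg_le_of_le [Nonempty ι] {f : ι → ℝ} {a : ℝ} (h : ∀ i, f i ≤ a) : 𝔼 i, f i ≤ a :=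
  Finset.expect_le univ_nonempty fun i _ => h i

theorem exists_avg_le [Nonempty ι] (f : ι → ℝ) : ∃ i, 𝔼 j, f j ≤ f i := by
  obtain ⟨i, -, h⟩ := Finset.exists_le_of_le_expect (s := (univ : Finset ι)) (f := f)
    univ_nonempty le_rfl
  exact ⟨i, h⟩

theorem avg_sq_eq (f : ι → ℝ) : (𝔼 i, f i) ^ 2 = 𝔼 i, 𝔼 j, f i * f j := by
  rw [sq, Finset.expect_mul_expect]

theorem avg_cauchy (f g : ι → ℝ) :
    (𝔼 i, f i * g i) ^ 2 ≤ (𝔼 i, f i ^ 2) * 𝔼 i, g i ^ 2 :=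
  Finset.expect_mul_sq_le_sq_mul_sq _ _ _

theorem avg_cauchy₂ (f g : ι → κ → ℝ) :
    (𝔼 i, 𝔼 j, f i j * g i j) ^ 2 ≤ (𝔼 i, 𝔼 j, f i j ^ 2) * 𝔼 i, 𝔼 j, g i j ^ 2 := by
  simpa only [avg_prod] using avg_cauchy (fun x : ι × κ => f x.1 x.2) (fun x => g x.1 x.2)

theorem avg_cauchy₃ (f g : ι → κ → μ → ℝ) :
    (𝔼 i, 𝔼 j, 𝔼 k, f i j k * g i j k) ^ 2
      ≤ (𝔼 i, 𝔼 j, 𝔼 k, f i j k ^ 2) * 𝔼 i, 𝔼 j, 𝔼 k, g i j k ^ 2 := by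
  simpa only [avg_prod] using
    avg_cauchy (fun x : ι × κ × μ => f x.1 x.2.1 x.2.2) (fun x => g x.1 x.2.1 x.2.2)

theorem avg_cauchy₄ {ν : Type*} [Fintype ν] (f g : ι → κ → μ → ν → ℝ) :
    (𝔼 i, 𝔼 j, 𝔼 k, 𝔼 l, f i j k l * g i j k l) ^ 2
      ≤ (𝔼 i, 𝔼 j, 𝔼 k, 𝔼 l, f i j k l ^ 2) * 𝔼 i, 𝔼 j, 𝔼 k, 𝔼 l, g i j k l ^ 2 := by
  simpa only [avg_prod] using
    avg_cauchy (fun x : ι × κ × μ × ν => f x.1 x.2.1 x.2.2.1 x.2.2.2)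
      (fun x => g x.1 x.2.1 x.2.2.1 x.2.2.2)

/-- A mixed four-cycle count of two matrices, computed from the columns and from the rows. -/
theorem avg_gram_comm (m : ι → κ → ℝ) (n : μ → κ → ℝ) :
    𝔼 v, 𝔼 w, (𝔼 u, m u v * m u w) * (𝔼 u, n u v * n u w)
      = 𝔼 u, 𝔼 u', (𝔼 v, m u v * n u' v) ^ 2 := by
  calc _ = 𝔼 v, 𝔼 w, 𝔼 u, 𝔼 u', (m u v * m u w) * (n u' v * n u' w) := by
        simp only [Finset.expect_mul_expect]
    _ = 𝔼 v, 𝔼 u, 𝔼 u', 𝔼 w, (m u v * m u w) * (n u' v * n u' w) := by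
        refine avg_congr fun v => ?_
        rw [avg_swap]; exact avg_congr fun u => avg_swap _
    _ = 𝔼 u, 𝔼 u', 𝔼 v, 𝔼 w, (m u v * m u w) * (n u' v * n u' w) := by
        rw [avg_swap]; exact avg_congr fun u => avg_swap _
    _ = _ := by
        refine avg_congr fun u => avg_congr fun u' => ?_
        rw [avg_sq_eq]
        exact avg_congr fun v => avg_congr fun w => by ring

theorem avg_row_sq (m : ι → κ → ℝ) :
    𝔼 u, (𝔼 v, m u v) ^ 2 = 𝔼 v, 𝔼 w, 𝔼 u, m u v * m u w := by
  simp only [avg_sq_eq]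
  rw [avg_swap]
  exact avg_congr fun v => avg_swap _

/-- If `w ≥ 0` has average close to `c` in every row, an average of `w * Q` over pairs is carried
by a choice of one column in each row. -/
theorem exists_choice [Nonempty κ] {w Q : ι → κ → ℝ} {c : ℝ}
    (hw : ∀ i j, 0 ≤ w i j) (hQ : ∀ i j, |Q i j| ≤ 1) :
    ∃ g : ι → κ, 𝔼 i, 𝔼 j, w i j * Q i j
      ≤ c * (𝔼 i, |Q i (g i)|) + 𝔼 i, |(𝔼 j, w i j) - c| := by
  have h : ∀ i, ∃ j, ∀ j', |Q i j'| ≤ |Q i j| := fun i => Finite.exists_max fun j => |Q i j|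
  choose g hg using h
  refine ⟨g, ?_⟩
  rw [Finset.mul_expect, ← Finset.expect_add_distrib]
  refine avg_mono fun i => ?_
  have h1 : 𝔼 j, w i j * Q i j ≤ (𝔼 j, w i j) * |Q i (g i)| := by
    rw [Finset.expect_mul]
    exact avg_mono fun j => mul_le_mul_of_nonneg_left ((le_abs_self _).trans (hg i j)) (hw i j)
  have h2 : ((𝔼 j, w i j) - c) * |Q i (g i)| ≤ |(𝔼 j, w i j) - c| := by
    calc _ ≤ |(𝔼 j, w i j) - c| * |Q i (g i)| :=
          mul_le_mul_of_nonneg_right (le_abs_self _) (abs_nonneg _)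
      _ ≤ _ := mul_le_of_le_one_right (abs_nonneg _) (hQ _ _)
  linarith

theorem abs_avg_le_one [Nonempty ι] {f : ι → ℝ} (h : ∀ i, |f i| ≤ 1) : |𝔼 i, f i| ≤ 1 :=
  (abs_avg_le f).trans (avg_le_of_le h)

theorem abs_mul_le_one {a b : ℝ} (ha : |a| ≤ 1) (hb : |b| ≤ 1) : |a * b| ≤ 1 := by
  rw [abs_mul]; exact mul_le_one₀ ha (abs_nonneg _) hb

/-- Truncation of a real number to `[-1, 1]`. -/
def clip (x : ℝ) : ℝ := max (-1) (min 1 x)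

theorem abs_clip_le (x : ℝ) : |clip x| ≤ 1 :=
  abs_le.2 ⟨le_max_left _ _, max_le (by norm_num) (min_le_left _ _)⟩

@[simp] theorem clip_zero : clip 0 = 0 := by norm_num [clip]

theorem clip_of_abs_le {x : ℝ} (h : |x| ≤ 1) : clip x = x := by
  rw [abs_le] at h
  rw [clip, min_eq_right h.2, max_eq_right h.1]

theorem abs_sub_clip_le {x y c : ℝ} (hxy : |x| ≤ y) (hc : 0 < c) :
    |x - c * clip (x / c)| ≤ |y - c| := by
  have key : c * clip (x / c) = max (-c) (min c x) := by
    rw [clip, mul_max_of_nonneg _ _ hc.le, mul_min_of_nonneg _ _ hc.le, mul_div_cancel₀ _ hc.ne']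
    simp
  rw [key]
  rcases le_or_gt |x| c with h | h
  · rw [abs_le] at h
    rw [min_eq_right h.2, max_eq_right h.1]; simp
  · rw [abs_le] at hxy
    rw [abs_of_nonneg (a := y - c) (by linarith [abs_le.2 hxy])]
    rcases lt_abs.1 h with h | h
    · rw [min_eq_left h.le, max_eq_right (by linarith), abs_of_nonneg (by linarith)]; linarith
    · rw [min_eq_right (by linarith), max_eq_left (by linarith), abs_of_nonpos (by linarith)]
      linarith

/-- `x * clip x` is at least `2 θ |x| - θ ^ 2` for `θ ≤ 1 / 2`. -/
theorem le_mul_clip {x c θ : ℝ} (hc : 0 < c) (hθ : θ ≤ 1 / 2) :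
    2 * θ * |x| - θ ^ 2 * c ≤ x * clip (x / c) := by
  have hx : x = c * (x / c) := by field_simp
  set y := x / c
  rw [hx, abs_mul, abs_of_pos hc]
  have : 2 * θ * |y| - θ ^ 2 ≤ y * clip y := by
    rcases le_or_gt |y| 1 with h | h
    · rw [clip_of_abs_le h, ← abs_mul_abs_self y]; nlinarith [sq_nonneg (|y| - θ)]
    · have : y * clip y = |y| := by
        rcases lt_abs.1 h with h | h
        · rw [clip, min_eq_left h.le, max_eq_right (by norm_num), abs_of_pos (by linarith)]; ring
        · rw [clip, min_eq_right (by linarith), max_eq_left (by linarith),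
            abs_of_neg (by linarith)]; ring
      rw [this]; nlinarith [abs_nonneg y, sq_nonneg θ]
  nlinarith

end Averages

/-! ### Pseudorandom bipartite graphs -/

section Cut

variable {U V I : Type*} [Fintype U] [Fintype V] [Fintype I]

/-- `R` has density `p` with error at most `ρ` when tested against products of bounded functions
of one variable. -/
def CutUniform (R : U → V → ℝ) (p ρ : ℝ) : Prop :=
  ∀ (φ : U → ℝ) (ψ : V → ℝ), (∀ u, |φ u| ≤ 1) → (∀ v, |ψ v| ≤ 1) →
    |𝔼 u, 𝔼 v, (R u v - p) * (φ u * ψ v)| ≤ ρ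

theorem CutUniform.symm {R : U → V → ℝ} {p ρ : ℝ} (h : CutUniform R p ρ) :
    CutUniform (fun v u => R u v) p ρ := by
  intro φ ψ hφ hψ
  rw [avg_swap]
  simpa only [mul_comm] using h ψ φ hψ hφ

theorem CutUniform.mono {R : U → V → ℝ} {p ρ ρ' : ℝ} (h : CutUniform R p ρ) (hρ : ρ ≤ ρ') :
    CutUniform R p ρ' := fun φ ψ hφ hψ => (h φ ψ hφ hψ).trans hρ

/-- A cut-uniform graph may be replaced by its density against any average of products of bounded
functions of one variable. -/
theorem CutUniform.replace [Nonempty I] {R : U → V → ℝ} {p ρ : ℝ} (h : CutUniform R p ρ)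
    {φ : I → U → ℝ} {ψ : I → V → ℝ} (hφ : ∀ i u, |φ i u| ≤ 1) (hψ : ∀ i v, |ψ i v| ≤ 1) :
    |(𝔼 i, 𝔼 u, 𝔼 v, R u v * (φ i u * ψ i v)) - p * 𝔼 i, 𝔼 u, 𝔼 v, φ i u * ψ i v| ≤ ρ := by
  have : (𝔼 i, 𝔼 u, 𝔼 v, R u v * (φ i u * ψ i v)) - p * 𝔼 i, 𝔼 u, 𝔼 v, φ i u * ψ i v
      = 𝔼 i, 𝔼 u, 𝔼 v, (R u v - p) * (φ i u * ψ i v) := by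
    simp only [Finset.mul_expect, ← Finset.expect_sub_distrib, sub_mul]
  rw [this]
  exact (abs_avg_le _).trans (avg_le_of_le fun i => h _ _ (hφ i) (hψ i))

end Cut

/-! ### Sparse pseudorandom fibres -/

/-- A family, indexed by `s : S`, of bipartite graphs `t s` on `U × V`, each contained in the part
of one fixed graph `R` lying over the vertex sets `A s` and `B s`. All sets are given by their
indicator functions. The vertex sets have densities about `α` and `β`, the graph `R` has density
`ϖ` and is cut-uniform, and `t s` has density about `k` in `R ∩ (A s × B s)` with an almost minimal
number of four-cycles, on average over `s`. The error `e ^ 4` is relative to the main terms, the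
error `ζ` is absolute and much smaller than all densities. -/
structure Fibre {S U V : Type*} [Fintype S] [Fintype U] [Fintype V]
    (A : S → U → ℝ) (B : S → V → ℝ) (R : U → V → ℝ) (t : S → U → V → ℝ)
    (α β ϖ k e ζ : ℝ) : Prop where
  A01 : ∀ s u, A s u = 0 ∨ A s u = 1
  B01 : ∀ s v, B s v = 0 ∨ B s v = 1
  R01 : ∀ u v, R u v = 0 ∨ R u v = 1
  t01 : ∀ s u v, t s u v = 0 ∨ t s u v = 1
  t_le_A : ∀ s u v, t s u v ≤ A s u
  t_le_B : ∀ s u v, t s u v ≤ B s v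
  t_le_R : ∀ s u v, t s u v ≤ R u v
  α_pos : 0 < α
  α_le : α ≤ 1
  β_pos : 0 < β
  β_le : β ≤ 1
  ϖ_pos : 0 < ϖ
  ϖ_le : ϖ ≤ 1
  k_pos : 0 < k
  k_le : k ≤ 1
  e_pos : 0 < e
  e_le : e ≤ 1 / 10
  cut : CutUniform R ϖ ζ
  avgA : 𝔼 s, |(𝔼 u, A s u) - α| ≤ ζ
  avgB : 𝔼 s, |(𝔼 v, B s v) - β| ≤ ζ
  small : ζ ≤ e ^ 4 * (k * ϖ * α * β) ^ 4 / 16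
  count4 : 𝔼 s, 𝔼 v, 𝔼 w, (𝔼 u, t s u v * t s u w) ^ 2
    ≤ (1 + e ^ 4) * ((k * ϖ) ^ 4 * α ^ 2 * β ^ 2)
  count : (1 - e ^ 4) * (k * ϖ * α * β) ≤ 𝔼 s, 𝔼 u, 𝔼 v, t s u v

namespace Fibre

variable {S U V : Type*} [Fintype S] [Fintype U] [Fintype V]
  {A : S → U → ℝ} {B : S → V → ℝ} {R : U → V → ℝ} {t : S → U → V → ℝ} {α β ϖ k e ζ : ℝ}

theorem swap (h : Fibre A B R t α β ϖ k e ζ) :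
    Fibre B A (fun v u => R u v) (fun s v u => t s u v) β α ϖ k e ζ where
  A01 := h.B01
  B01 := h.A01
  R01 := fun u v => h.R01 v u
  t01 := fun s u v => h.t01 s v u
  t_le_A := fun s u v => h.t_le_B s v u
  t_le_B := fun s u v => h.t_le_A s v u
  t_le_R := fun s u v => h.t_le_R s v u
  α_pos := h.β_pos
  α_le := h.β_le
  β_pos := h.α_pos
  β_le := h.α_le
  ϖ_pos := h.ϖ_pos
  ϖ_le := h.ϖ_le
  k_pos := h.k_pos
  k_le := h.k_le
  e_pos := h.e_pos
  e_le := h.e_le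
  cut := h.cut.symm
  avgA := h.avgB
  avgB := h.avgA
  small := h.small.trans_eq (by ring)
  count4 := by
    refine le_trans (le_of_eq ?_) (h.count4.trans_eq (by ring))
    refine avg_congr fun s => ?_
    rw [← avg_gram_comm]
    exact avg_congr fun v => avg_congr fun w => by ring
  count := by
    refine (le_of_eq (by ring)).trans (h.count.trans (le_of_eq ?_))
    exact avg_congr fun s => avg_swap _

theorem τ_pos (h : Fibre A B R t α β ϖ k e ζ) : 0 < k * ϖ := mul_pos h.k_pos h.ϖ_pos

theorem t_nonneg (h : Fibre A B R t α β ϖ k e ζ) (s u v) : 0 ≤ t s u v := by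
  rcases h.t01 s u v with h | h <;> simp [h]

theorem t_le_one (h : Fibre A B R t α β ϖ k e ζ) (s u v) : t s u v ≤ 1 := by
  rcases h.t01 s u v with h | h <;> simp [h]

theorem B_nonneg (h : Fibre A B R t α β ϖ k e ζ) (s v) : 0 ≤ B s v := by
  rcases h.B01 s v with h | h <;> simp [h]

theorem B_le_one (h : Fibre A B R t α β ϖ k e ζ) (s v) : B s v ≤ 1 := by
  rcases h.B01 s v with h | h <;> simp [h]

theorem B_mul_t (h : Fibre A B R t α β ϖ k e ζ) (s u v) : B s v * t s u v = t s u v := by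
  rcases h.B01 s v with h' | h'
  · have := h.t_le_B s u v
    have h2 := h.t_nonneg s u v
    rw [h'] at this ⊢; linarith
  · rw [h', one_mul]

theorem A_mul_t (h : Fibre A B R t α β ϖ k e ζ) (s u v) : A s u * t s u v = t s u v :=
  h.swap.B_mul_t s v u

theorem A_nonneg (h : Fibre A B R t α β ϖ k e ζ) (s u) : 0 ≤ A s u := h.swap.B_nonneg s u

theorem A_le_one (h : Fibre A B R t α β ϖ k e ζ) (s u) : A s u ≤ 1 := h.swap.B_le_one s u

theorem e4_le (h : Fibre A B R t α β ϖ k e ζ) : e ^ 4 ≤ 1 / 10000 := by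
  calc e ^ 4 ≤ (1 / 10) ^ 4 := pow_le_pow_left₀ h.e_pos.le h.e_le 4
    _ = _ := by norm_num

/-- The absolute error is negligible against every monomial that occurs. -/
theorem small_monomial (h : Fibre A B R t α β ϖ k e ζ) (a b c : ℕ) (ha : a ≤ 4 := by norm_num)
    (hb : b ≤ 4 := by norm_num) (hc : c ≤ 4 := by norm_num) :
    ζ ≤ e ^ 4 / 16 * ((k * ϖ) ^ a * α ^ b * β ^ c) := by
  have hτ := h.τ_pos
  have hτ1 : k * ϖ ≤ 1 := mul_le_one₀ h.k_le h.ϖ_pos.le h.ϖ_le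
  have h1 : (k * ϖ) ^ 4 ≤ (k * ϖ) ^ a := pow_le_pow_of_le_one hτ.le hτ1 ha
  have h2 : α ^ 4 ≤ α ^ b := pow_le_pow_of_le_one h.α_pos.le h.α_le hb
  have h3 : β ^ 4 ≤ β ^ c := pow_le_pow_of_le_one h.β_pos.le h.β_le hc
  have hα := h.α_pos
  have hβ := h.β_pos
  calc ζ ≤ e ^ 4 / 16 * ((k * ϖ) ^ 4 * α ^ 4 * β ^ 4) := h.small.trans_eq (by ring)
    _ ≤ _ := by gcongr

theorem ζ_nonneg (h : Fibre A B R t α β ϖ k e ζ) : 0 ≤ ζ :=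
  (avg_nonneg fun _ => abs_nonneg _).trans h.avgA

variable [Nonempty S] [Nonempty U] [Nonempty V]

theorem avg_B_nonneg (h : Fibre A B R t α β ϖ k e ζ) (s) : 0 ≤ 𝔼 v, B s v :=
  avg_nonneg fun v => h.B_nonneg s v

theorem avg_B_le_one (h : Fibre A B R t α β ϖ k e ζ) (s) : 𝔼 v, B s v ≤ 1 :=
  avg_le_of_le fun v => h.B_le_one s v

theorem avg_B_mul_le (h : Fibre A B R t α β ϖ k e ζ) {X : S → ℝ} (hX : ∀ s, 0 ≤ X s)
    (hX1 : ∀ s, X s ≤ 1) : 𝔼 s, (𝔼 v, B s v) * X s ≤ β * (𝔼 s, X s) + ζ := by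
  have h1 : 𝔼 s, (𝔼 v, B s v) * X s ≤ 𝔼 s, (β * X s + |(𝔼 v, B s v) - β|) := by
    refine avg_mono fun s => ?_
    have h2 : ((𝔼 v, B s v) - β) * X s ≤ |(𝔼 v, B s v) - β| :=
      (mul_le_mul_of_nonneg_right (le_abs_self _) (hX s)).trans
        (mul_le_of_le_one_right (abs_nonneg _) (hX1 s))
    linarith
  rw [Finset.expect_add_distrib, ← Finset.mul_expect] at h1
  linarith [h.avgB]

theorem avg_B_sq_mul_le (h : Fibre A B R t α β ϖ k e ζ) {X : S → ℝ} (hX : ∀ s, 0 ≤ X s)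
    (hX1 : ∀ s, X s ≤ 1) : 𝔼 s, (𝔼 v, B s v) ^ 2 * X s ≤ β ^ 2 * (𝔼 s, X s) + 2 * ζ := by
  have h1 := h.avg_B_mul_le (X := fun s => (𝔼 v, B s v) * X s)
    (fun s => mul_nonneg (h.avg_B_nonneg s) (hX s))
    (fun s => mul_le_one₀ (h.avg_B_le_one s) (hX s) (hX1 s))
  have h2 := h.avg_B_mul_le hX hX1
  have h3 : β * (𝔼 s, (𝔼 v, B s v) * X s) ≤ β * (β * (𝔼 s, X s) + ζ) :=
    mul_le_mul_of_nonneg_left h2 h.β_pos.le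
  have h4 : β * ζ ≤ ζ := mul_le_of_le_one_left h.ζ_nonneg h.β_le
  have h5 : 𝔼 s, (𝔼 v, B s v) ^ 2 * X s = 𝔼 s, (𝔼 v, B s v) * ((𝔼 v, B s v) * X s) :=
    avg_congr fun s => by ring
  rw [h5]; nlinarith

theorem avg_B_le (h : Fibre A B R t α β ϖ k e ζ) : 𝔼 s, 𝔼 v, B s v ≤ (1 + e ^ 4) * β := by
  have h1 := h.avg_B_mul_le (X := fun _ => 1) (fun _ => zero_le_one) (fun _ => le_rfl)
  simp only [mul_one, Fintype.expect_const] at h1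
  have h2 := h.small_monomial 0 0 1
  have := mul_pos (pow_pos h.e_pos 4) h.β_pos
  linarith

theorem avg_A_le (h : Fibre A B R t α β ϖ k e ζ) : 𝔼 s, 𝔼 u, A s u ≤ (1 + e ^ 4) * α :=
  h.swap.avg_B_le

theorem avg_B_sq_le (h : Fibre A B R t α β ϖ k e ζ) :
    𝔼 s, (𝔼 v, B s v) ^ 2 ≤ (1 + e ^ 4) * β ^ 2 := by
  have h1 := h.avg_B_sq_mul_le (X := fun _ => 1) (fun _ => zero_le_one) (fun _ => le_rfl)
  simp only [mul_one, Fintype.expect_const] at h1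
  have h2 := h.small_monomial 0 0 2
  have := mul_pos (pow_pos h.e_pos 4) (pow_pos h.β_pos 2)
  linarith

theorem avg_BB_le (h : Fibre A B R t α β ϖ k e ζ) :
    𝔼 s, 𝔼 v, 𝔼 w, B s v * B s w ≤ (1 + e ^ 4) * β ^ 2 := by
  simpa only [avg_sq_eq] using h.avg_B_sq_le

theorem le_avg_row_sq (h : Fibre A B R t α β ϖ k e ζ) :
    (1 - 3 * e ^ 4) * ((k * ϖ) ^ 2 * α * β ^ 2) ≤ 𝔼 s, 𝔼 u, (𝔼 v, t s u v) ^ 2 := by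
  have h1 := avg_cauchy₂ A (fun s u => 𝔼 v, t s u v)
  have h2 : 𝔼 s, 𝔼 u, A s u * 𝔼 v, t s u v = 𝔼 s, 𝔼 u, 𝔼 v, t s u v := by
    refine avg_congr fun s => avg_congr fun u => ?_
    rw [Finset.mul_expect]; exact avg_congr fun v => h.A_mul_t s u v
  have h3 : 𝔼 s, 𝔼 u, A s u ^ 2 = 𝔼 s, 𝔼 u, A s u := by
    refine avg_congr fun s => avg_congr fun u => ?_
    rcases h.A01 s u with h | h <;> simp [h]
  rw [h2, h3] at h1
  set Q := 𝔼 s, 𝔼 u, (𝔼 v, t s u v) ^ 2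
  set E := 𝔼 s, 𝔼 u, 𝔼 v, t s u v
  have hQ : 0 ≤ Q := avg_nonneg fun s => avg_nonneg fun u => sq_nonneg _
  have he := h.e4_le
  have he0 := pow_pos h.e_pos 4
  set x := e ^ 4
  have h4 : ((1 - x) * (k * ϖ * α * β)) ^ 2 ≤ E ^ 2 := by
    have := h.τ_pos
    have := h.α_pos
    have := h.β_pos
    have h0 : 0 ≤ 1 - x := by linarith
    exact pow_le_pow_left₀ (by positivity) h.count 2
  have h5 : E ^ 2 ≤ ((1 + x) * α) * Q := h1.trans (mul_le_mul_of_nonneg_right h.avg_A_le hQ)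
  have hα := h.α_pos
  have h6 : (1 - x) ^ 2 * ((k * ϖ) ^ 2 * α * β ^ 2) ≤ (1 + x) * Q := by
    refine le_of_mul_le_mul_left ?_ hα
    nlinarith
  set M := (k * ϖ) ^ 2 * α * β ^ 2
  have hM : 0 < M := by have := h.τ_pos; have := h.β_pos; positivity
  have h7 : (1 + x) * ((1 - 3 * x) * M) ≤ (1 - x) ^ 2 * M := by nlinarith [mul_pos hM he0, sq_nonneg x]
  nlinarith

theorem avg_row_sq_le (h : Fibre A B R t α β ϖ k e ζ) :
    𝔼 s, 𝔼 u, (𝔼 v, t s u v) ^ 2 ≤ (1 + e ^ 4) * ((k * ϖ) ^ 2 * α * β ^ 2) := by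
  simp only [avg_row_sq]
  have h1 := avg_cauchy₃ (fun s v w => B s v * B s w) (fun s v w => 𝔼 u, t s u v * t s u w)
  have h2 : 𝔼 s, 𝔼 v, 𝔼 w, B s v * B s w * 𝔼 u, t s u v * t s u w
      = 𝔼 s, 𝔼 v, 𝔼 w, 𝔼 u, t s u v * t s u w := by
    refine avg_congr fun s => avg_congr fun v => avg_congr fun w => ?_
    rw [Finset.mul_expect]
    refine avg_congr fun u => ?_
    rw [← h.B_mul_t s u v, ← h.B_mul_t s u w]
    rcases h.B01 s v with h₁ | h₁ <;> rcases h.B01 s w with h₂ | h₂ <;> simp [h₁, h₂]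
  have h3 : 𝔼 s, 𝔼 v, 𝔼 w, (B s v * B s w) ^ 2 = 𝔼 s, 𝔼 v, 𝔼 w, B s v * B s w := by
    refine avg_congr fun s => avg_congr fun v => avg_congr fun w => ?_
    rcases h.B01 s v with h₁ | h₁ <;> rcases h.B01 s w with h₂ | h₂ <;> simp [h₁, h₂]
  rw [h2, h3] at h1
  have h4 := h.avg_BB_le
  have h5 := h.count4
  have hτ := h.τ_pos
  have hα := h.α_pos
  have hβ := h.β_pos
  have he := pow_pos h.e_pos 4
  refine abs_le_of_sq_le_sq' (h1.trans ?_) (by positivity) |>.2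
  calc _ ≤ ((1 + e ^ 4) * β ^ 2) * ((1 + e ^ 4) * ((k * ϖ) ^ 4 * α ^ 2 * β ^ 2)) := by
        refine mul_le_mul h4 h5 ?_ (by positivity)
        exact avg_nonneg fun s => avg_nonneg fun v => avg_nonneg fun w => sq_nonneg _
    _ = _ := by ring

/-- The codegrees of `t` are concentrated. -/
theorem variance_codeg (h : Fibre A B R t α β ϖ k e ζ) :
    𝔼 s, 𝔼 v, 𝔼 w, B s v * B s w * ((𝔼 u, t s u v * t s u w) - (k * ϖ) ^ 2 * α) ^ 2
      ≤ 8 * e ^ 4 * (((k * ϖ) ^ 2 * α) ^ 2 * β ^ 2) := by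
  set c := (k * ϖ) ^ 2 * α with hc
  have h1 : 𝔼 s, 𝔼 v, 𝔼 w, B s v * B s w * ((𝔼 u, t s u v * t s u w) - c) ^ 2
      = (𝔼 s, 𝔼 v, 𝔼 w, (𝔼 u, t s u v * t s u w) ^ 2)
        - 2 * c * (𝔼 s, 𝔼 u, (𝔼 v, t s u v) ^ 2)
        + c ^ 2 * (𝔼 s, 𝔼 v, 𝔼 w, B s v * B s w) := by
    rw [show 𝔼 s, 𝔼 u, (𝔼 v, t s u v) ^ 2 = 𝔼 s, 𝔼 v, 𝔼 w, 𝔼 u, t s u v * t s u w from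
      avg_congr fun s => avg_row_sq _]
    simp only [Finset.mul_expect (a := 2 * c), Finset.mul_expect (a := c ^ 2),
      ← Finset.expect_add_distrib, ← Finset.expect_sub_distrib]
    refine avg_congr fun s => avg_congr fun v => avg_congr fun w => ?_
    rw [← Finset.mul_expect]
    have h2 : 𝔼 u, t s u v * t s u w = B s v * B s w * 𝔼 u, t s u v * t s u w := by
      rw [Finset.mul_expect]
      refine avg_congr fun u => ?_
      rw [← h.B_mul_t s u v, ← h.B_mul_t s u w]
      rcases h.B01 s v with h₁ | h₁ <;> rcases h.B01 s w with h₂ | h₂ <;> simp [h₁, h₂]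
    set F := 𝔼 u, t s u v * t s u w
    rcases h.B01 s v with h₁ | h₁ <;> rcases h.B01 s w with h₃ | h₃ <;>
      simp only [h₁, h₃, zero_mul, mul_zero, one_mul] at h2 ⊢ <;> (try rw [h2]) <;> ring
  have h4 := h.avg_BB_le
  have h5 := h.count4
  have h6 := h.le_avg_row_sq
  have hτ := h.τ_pos
  have hα := h.α_pos
  have hβ := h.β_pos
  have hcp : 0 < c := by positivity
  rw [h1]
  have h7 := mul_le_mul_of_nonneg_left h6 (by positivity : 0 ≤ 2 * c)
  have h8 := mul_le_mul_of_nonneg_left h4 (by positivity : 0 ≤ c ^ 2)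
  have e1 : (k * ϖ) ^ 4 * α ^ 2 * β ^ 2 = c ^ 2 * β ^ 2 := by rw [hc]; ring
  have e2 : (k * ϖ) ^ 2 * α * β ^ 2 = c * β ^ 2 := by rw [hc]
  rw [e1] at h5
  rw [e2] at h7
  linarith

/-- The degrees of `t` are concentrated. -/
theorem variance_deg (h : Fibre A B R t α β ϖ k e ζ) :
    𝔼 s, 𝔼 u, A s u * ((𝔼 v, t s u v) - k * ϖ * β) ^ 2
      ≤ 4 * e ^ 4 * ((k * ϖ) ^ 2 * α * β ^ 2) := by
  set c := k * ϖ * β with hc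
  have h1 : 𝔼 s, 𝔼 u, A s u * ((𝔼 v, t s u v) - c) ^ 2
      = (𝔼 s, 𝔼 u, (𝔼 v, t s u v) ^ 2) - 2 * c * (𝔼 s, 𝔼 u, 𝔼 v, t s u v)
        + c ^ 2 * (𝔼 s, 𝔼 u, A s u) := by
    simp only [Finset.mul_expect (a := 2 * c), Finset.mul_expect (a := c ^ 2),
      ← Finset.expect_add_distrib, ← Finset.expect_sub_distrib]
    refine avg_congr fun s => avg_congr fun u => ?_
    rw [← Finset.mul_expect]
    have h2 : 𝔼 v, t s u v = A s u * 𝔼 v, t s u v := by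
      rw [Finset.mul_expect]
      exact avg_congr fun v => (h.A_mul_t s u v).symm
    set F := 𝔼 v, t s u v
    rcases h.A01 s u with h | h <;>
      simp only [h, zero_mul, one_mul] at h2 ⊢ <;> (try rw [h2]) <;> ring
  have h4 := h.avg_A_le
  have h5 := h.avg_row_sq_le
  have h6 := h.count
  have hτ := h.τ_pos
  have hα := h.α_pos
  have hβ := h.β_pos
  have hcp : 0 < c := by positivity
  rw [h1]
  have h7 := mul_le_mul_of_nonneg_left h6 (by positivity : 0 ≤ 2 * c)
  have h8 := mul_le_mul_of_nonneg_left h4 (by positivity : 0 ≤ c ^ 2)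
  have e2 : (k * ϖ) ^ 2 * α * β ^ 2 = c * (k * ϖ * α * β) := by rw [hc]; ring
  have e3 : c ^ 2 * ((1 + e ^ 4) * α) = (1 + e ^ 4) * (c * (k * ϖ * α * β)) := by rw [hc]; ring
  rw [e2] at h5 ⊢
  rw [e3] at h8
  linarith

theorem avg_t_le (h : Fibre A B R t α β ϖ k e ζ) :
    𝔼 s, 𝔼 u, 𝔼 v, t s u v ≤ (1 + e ^ 4) * (k * ϖ * α * β) := by
  have h1 := avg_cauchy₂ A (fun s u => 𝔼 v, t s u v)
  have h2 : 𝔼 s, 𝔼 u, A s u * 𝔼 v, t s u v = 𝔼 s, 𝔼 u, 𝔼 v, t s u v := by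
    refine avg_congr fun s => avg_congr fun u => ?_
    rw [Finset.mul_expect]; exact avg_congr fun v => h.A_mul_t s u v
  have h3 : 𝔼 s, 𝔼 u, A s u ^ 2 = 𝔼 s, 𝔼 u, A s u := by
    refine avg_congr fun s => avg_congr fun u => ?_
    rcases h.A01 s u with h | h <;> simp [h]
  rw [h2, h3] at h1
  have hτ := h.τ_pos
  have hα := h.α_pos
  have hβ := h.β_pos
  have he := pow_pos h.e_pos 4
  refine abs_le_of_sq_le_sq' (h1.trans ?_) (by positivity) |>.2
  calc _ ≤ ((1 + e ^ 4) * α) * ((1 + e ^ 4) * ((k * ϖ) ^ 2 * α * β ^ 2)) := by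
        refine mul_le_mul h.avg_A_le h.avg_row_sq_le ?_ (by positivity)
        exact avg_nonneg fun s => avg_nonneg fun v => sq_nonneg _
    _ = _ := by ring

end Fibre

section Replace

variable {U V : Type*} [Fintype U] [Fintype V] [Nonempty U] [Nonempty V]

/-- The subscripts of this and of similar lemmas are the lengths of the two blocks of variables that
change places. -/
theorem avg_swap₂₃ {ι κ μ ν ξ : Type*} [Fintype ι] [Fintype κ] [Fintype μ] [Fintype ν] [Fintype ξ]
    (F : ι → κ → μ → ν → ξ → ℝ) :
    𝔼 i, 𝔼 j, 𝔼 k, 𝔼 l, 𝔼 n, F i j k l n = 𝔼 k, 𝔼 l, 𝔼 n, 𝔼 i, 𝔼 j, F i j k l n := by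
  simpa only [avg_prod] using
    avg_swap (fun (x : ι × κ) (y : μ × ν × ξ) => F x.1 x.2 y.1 y.2.1 y.2.2)

theorem avg_swap₃₂ {ι κ μ ν ξ : Type*} [Fintype ι] [Fintype κ] [Fintype μ] [Fintype ν] [Fintype ξ]
    (F : ι → κ → μ → ν → ξ → ℝ) :
    𝔼 i, 𝔼 j, 𝔼 k, 𝔼 l, 𝔼 n, F i j k l n = 𝔼 l, 𝔼 n, 𝔼 i, 𝔼 j, 𝔼 k, F i j k l n := by
  simpa only [avg_prod] using
    avg_swap (fun (x : ι × κ × μ) (y : ν × ξ) => F x.1 x.2.1 x.2.2 y.1 y.2)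

/-- Two edges of a cut-uniform graph that meet in `u` may be replaced by the density when the
remaining weight depends on `u` and on the other two end points only separately. -/
theorem CutUniform.replace_two {R : U → V → ℝ} {p ζ : ℝ} (h : CutUniform R p ζ) (hp : 0 ≤ p)
    (hp1 : p ≤ 1) (hR : ∀ u v, |R u v| ≤ 1) {g : U → V → ℝ} (hg : ∀ u v, |g u v| ≤ 1)
    {θ : V → V → ℝ} (hθ : ∀ v w, |θ v w| ≤ 1) :
    𝔼 u, 𝔼 a, 𝔼 b, R u a * R u b * (𝔼 v, g u v * (θ v a * θ v b)) ^ 2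
      ≤ p ^ 2 * (𝔼 u, 𝔼 a, 𝔼 b, (𝔼 v, g u v * (θ v a * θ v b)) ^ 2) + 2 * ζ := by
  have hζ : 0 ≤ ζ := (abs_nonneg _).trans (h (fun _ => 0) (fun _ => 0) (by simp) (by simp))
  have h1 := h.replace (I := V × V × V)
    (φ := fun i u => R u i.1 * (g u i.2.1 * g u i.2.2))
    (ψ := fun i a => θ i.2.1 a * θ i.2.2 a * (θ i.2.1 i.1 * θ i.2.2 i.1))
    (fun i u => abs_mul_le_one (hR _ _) (abs_mul_le_one (hg _ _) (hg _ _)))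
    (fun i a => abs_mul_le_one (abs_mul_le_one (hθ _ _) (hθ _ _))
      (abs_mul_le_one (hθ _ _) (hθ _ _)))
  have h2 := h.replace (I := V × V × V)
    (φ := fun i u => g u i.2.1 * g u i.2.2)
    (ψ := fun i a => θ i.2.1 a * θ i.2.2 a * (θ i.2.1 i.1 * θ i.2.2 i.1))
    (fun i u => abs_mul_le_one (hg _ _) (hg _ _))
    (fun i a => abs_mul_le_one (abs_mul_le_one (hθ _ _) (hθ _ _))
      (abs_mul_le_one (hθ _ _) (hθ _ _)))
  have hperm : ∀ F : U → V → V → V → V → ℝ, 𝔼 i : V × V × V, 𝔼 u, 𝔼 a, F u a i.1 i.2.1 i.2.2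
      = 𝔼 u, 𝔼 a, 𝔼 b, 𝔼 v, 𝔼 w, F u a b v w := by
    intro F; simp only [avg_prod]; exact (avg_swap₂₃ F).symm
  rw [hperm fun u a b v w => R u a * (R u b * (g u v * g u w)
      * (θ v a * θ w a * (θ v b * θ w b))),
    hperm fun u a b v w => R u b * (g u v * g u w) * (θ v a * θ w a * (θ v b * θ w b))] at h1
  rw [hperm fun u a b v w => R u a * (g u v * g u w * (θ v a * θ w a * (θ v b * θ w b))),
    hperm fun u a b v w => g u v * g u w * (θ v a * θ w a * (θ v b * θ w b))] at h2
  have e1 : 𝔼 u, 𝔼 a, 𝔼 b, R u a * R u b * (𝔼 v, g u v * (θ v a * θ v b)) ^ 2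
      = 𝔼 u, 𝔼 a, 𝔼 b, 𝔼 v, 𝔼 w, R u a * (R u b * (g u v * g u w)
        * (θ v a * θ w a * (θ v b * θ w b))) := by
    refine avg_congr fun u => avg_congr fun a => avg_congr fun b => ?_
    rw [avg_sq_eq]
    simp only [Finset.mul_expect]
    exact avg_congr fun v => avg_congr fun w => by ring
  have e2 : 𝔼 u, 𝔼 a, 𝔼 b, 𝔼 v, 𝔼 w, (R u b * (g u v * g u w)
        * (θ v a * θ w a * (θ v b * θ w b)))
      = 𝔼 u, 𝔼 a, 𝔼 b, 𝔼 v, 𝔼 w, R u a * ((g u v * g u w)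
        * (θ v a * θ w a * (θ v b * θ w b))) := by
    refine avg_congr fun u => ?_
    rw [avg_swap]
    exact avg_congr fun a => avg_congr fun b => avg_congr fun v => avg_congr fun w => by ring
  have e3 : 𝔼 u, 𝔼 a, 𝔼 b, (𝔼 v, g u v * (θ v a * θ v b)) ^ 2
      = 𝔼 u, 𝔼 a, 𝔼 b, 𝔼 v, 𝔼 w, ((g u v * g u w)
        * (θ v a * θ w a * (θ v b * θ w b))) := by
    refine avg_congr fun u => avg_congr fun a => avg_congr fun b => ?_
    rw [avg_sq_eq]
    exact avg_congr fun v => avg_congr fun w => by ring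
  rw [e1, e3]
  rw [e2] at h1
  have h3 := (abs_le.1 h1).2
  have h4 := (abs_le.1 h2).2
  nlinarith

theorem avg_sq_eq_gram (g : U → V → ℝ) (θ : V → V → ℝ) :
    𝔼 u, 𝔼 a, 𝔼 b, (𝔼 v, g u v * (θ v a * θ v b)) ^ 2
      = 𝔼 v, 𝔼 w, (𝔼 u, g u v * g u w) * (𝔼 a, θ v a * θ w a) ^ 2 := by
  simp only [avg_sq_eq]
  rw [avg_swap₃₂]
  refine avg_congr fun v => avg_congr fun w => ?_
  rw [Finset.expect_mul]
  refine avg_congr fun u => ?_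
  simp only [Finset.mul_expect]
  exact avg_congr fun a => avg_congr fun b => by ring

end Replace

namespace Fibre

variable {S U V : Type*} [Fintype S] [Fintype U] [Fintype V]
  [Nonempty S] [Nonempty U] [Nonempty V]
  {A : S → U → ℝ} {B : S → V → ℝ} {R : U → V → ℝ} {t : S → U → V → ℝ} {α β ϖ k e ζ : ℝ}

theorem τ_le_one (h : Fibre A B R t α β ϖ k e ζ) : k * ϖ ≤ 1 :=
  mul_le_one₀ h.k_le h.ϖ_pos.le h.ϖ_le

/-- The columns of the balanced function `t - τ (A × B)` are nearly orthogonal on average. -/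
theorem avg_gram_balanced_le (h : Fibre A B R t α β ϖ k e ζ) :
    𝔼 s, 𝔼 v, 𝔼 w, B s v * B s w *
        |𝔼 u, (t s u v - k * ϖ * (A s u * B s v)) * (t s u w - k * ϖ * (A s u * B s w))|
      ≤ 9 * e ^ 2 * ((k * ϖ) ^ 2 * α * β ^ 2) := by
  set τ := k * ϖ with hτdef
  have hτ : 0 < τ := h.τ_pos
  have hτ1 : τ ≤ 1 := h.τ_le_one
  have hα := h.α_pos
  have hβ := h.β_pos
  have hα1 := h.α_le
  have he := pow_pos h.e_pos 4
  have he4 := h.e4_le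
  set Γ : S → V → V → ℝ := fun s v w =>
    𝔼 u, (t s u v - τ * (A s u * B s v)) * (t s u w - τ * (A s u * B s w)) with hΓ
  set M : S → V → ℝ := fun s v => 𝔼 u, t s u v with hM
  set F : S → V → V → ℝ := fun s v w => 𝔼 u, t s u v * t s u w with hF
  set c := τ ^ 2 * α with hc
  -- `Γ` expands into codegrees, degrees and the size of `A s`, whose main terms cancel.
  have hform : ∀ s v w, B s v * B s w * Γ s v w ^ 2
      ≤ 4 * (B s v * B s w * (F s v w - c) ^ 2
        + τ ^ 2 * (B s w * (B s v * (M s v - τ * α) ^ 2))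
        + τ ^ 2 * (B s v * (B s w * (M s w - τ * α) ^ 2))
        + |(𝔼 u, A s u) - α|) := by
    intro s v w
    rcases h.B01 s v with h1 | h1
    · simp only [h1, zero_mul, mul_zero, add_zero, zero_add]; positivity
    rcases h.B01 s w with h2 | h2
    · simp only [h2, zero_mul, mul_zero, add_zero, zero_add]; positivity
    have hΓ1 : Γ s v w = F s v w - τ * M s v - τ * M s w + τ ^ 2 * 𝔼 u, A s u := by
      simp only [hΓ, hF, hM, Finset.mul_expect, ← Finset.expect_sub_distrib,
        ← Finset.expect_add_distrib]
      refine avg_congr fun u => ?_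
      rw [h1, h2]
      have e1 := h.A_mul_t s u v
      have e2 := h.A_mul_t s u w
      have e3 : A s u * A s u = A s u := by rcases h.A01 s u with h | h <;> simp [h]
      linear_combination (-τ) * e2 - τ * e1 + τ ^ 2 * e3
    have hΓ2 : Γ s v w = (F s v w - c) + (-(τ * (M s v - τ * α))) + (-(τ * (M s w - τ * α)))
        + τ ^ 2 * ((𝔼 u, A s u) - α) := by rw [hΓ1, hc]; ring
    have ha : |(𝔼 u, A s u) - α| ≤ 1 := by
      rw [abs_le]
      have := h.swap.avg_B_nonneg s
      have := h.swap.avg_B_le_one s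
      constructor <;> linarith
    have ha2 : (τ ^ 2 * ((𝔼 u, A s u) - α)) ^ 2 ≤ |(𝔼 u, A s u) - α| := by
      rw [mul_pow, ← sq_abs ((𝔼 u, A s u) - α)]
      have : (τ ^ 2) ^ 2 ≤ 1 := pow_le_one₀ (by positivity) (pow_le_one₀ hτ.le hτ1)
      have h0 := abs_nonneg ((𝔼 u, A s u) - α)
      nlinarith [mul_nonneg h0 h0]
    rw [h1, h2, hΓ2]
    generalize (τ ^ 2 * ((𝔼 u, A s u) - α)) = X₁ at *
    generalize |(𝔼 u, A s u) - α| = X₂ at *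
    nlinarith [sq_nonneg (F s v w - c + τ * (M s v - τ * α)),
      sq_nonneg (F s v w - c + τ * (M s w - τ * α)), sq_nonneg (F s v w - c - X₁),
      sq_nonneg (τ * (M s v - τ * α) - τ * (M s w - τ * α)),
      sq_nonneg (τ * (M s v - τ * α) + X₁), sq_nonneg (τ * (M s w - τ * α) + X₁)]
  have hV1 := h.variance_codeg
  have hV3 := h.swap.variance_deg
  have hMV : 𝔼 s, 𝔼 v, 𝔼 w, B s w * (B s v * (M s v - τ * α) ^ 2)
      ≤ β * (4 * e ^ 4 * (τ ^ 2 * β * α ^ 2)) + ζ := by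
    have h1 := h.avg_B_mul_le (X := fun s => 𝔼 v, B s v * (M s v - τ * α) ^ 2)
      (fun s => avg_nonneg fun v => mul_nonneg (h.B_nonneg s v) (sq_nonneg _))
      (fun s => avg_le_of_le fun v => by
        refine mul_le_one₀ (h.B_le_one s v) (sq_nonneg _) ?_
        have h0 : 0 ≤ M s v := avg_nonneg fun u => h.t_nonneg s u v
        have h1 : M s v ≤ 1 := avg_le_of_le fun u => h.t_le_one s u v
        have h2 : 0 ≤ τ * α := by positivity
        have h3 : τ * α ≤ 1 := mul_le_one₀ hτ1 hα.le hα1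
        rw [← sq_abs]
        exact pow_le_one₀ (abs_nonneg _) (abs_le.2 ⟨by linarith, by linarith⟩))
    have h2 : 𝔼 s, 𝔼 v, 𝔼 w, B s w * (B s v * (M s v - τ * α) ^ 2)
        = 𝔼 s, (𝔼 v, B s v) * 𝔼 v, B s v * (M s v - τ * α) ^ 2 := by
      refine avg_congr fun s => ?_
      rw [Finset.expect_mul_expect, avg_swap]
    rw [h2]
    refine h1.trans ?_
    have := mul_le_mul_of_nonneg_left hV3 hβ.le
    linarith
  have hMV' : 𝔼 s, 𝔼 v, 𝔼 w, B s v * (B s w * (M s w - τ * α) ^ 2)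
      ≤ β * (4 * e ^ 4 * (τ ^ 2 * β * α ^ 2)) + ζ := by
    refine le_trans (le_of_eq ?_) hMV
    exact avg_congr fun s => avg_swap _
  have hsq : 𝔼 s, 𝔼 v, 𝔼 w, B s v * B s w * Γ s v w ^ 2
      ≤ 65 * e ^ 4 * ((τ ^ 2 * α) ^ 2 * β ^ 2) := by
    have h1 : 𝔼 s, 𝔼 v, 𝔼 w, B s v * B s w * Γ s v w ^ 2 ≤ _ :=
      avg_mono fun s => avg_mono fun v => avg_mono fun w => hform s v w
    simp only [← Finset.mul_expect, Finset.expect_add_distrib, Fintype.expect_const] at h1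
    have hz := h.small_monomial 4 2 2
    have hA := h.avgA
    have hz0 := h.ζ_nonneg
    have hτ2 : τ ^ 2 ≤ 1 := pow_le_one₀ hτ.le hτ1
    have h2 := mul_le_mul_of_nonneg_left hMV (sq_nonneg τ)
    have h3 := mul_le_mul_of_nonneg_left hMV' (sq_nonneg τ)
    have h4 : τ ^ 2 * ζ ≤ ζ := mul_le_of_le_one_left hz0 hτ2
    simp only [Finset.mul_expect] at h1 h2 h3 hV1 ⊢
    nlinarith
  have hcs := avg_cauchy₃ (fun s v w => B s v * B s w)
    (fun s v w => B s v * B s w * |Γ s v w|)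
  have hBB : ∀ s v w, (B s v * B s w) ^ 2 = B s v * B s w := by
    intro s v w
    rcases h.B01 s v with h₁ | h₁ <;> rcases h.B01 s w with h₂ | h₂ <;> simp [h₁, h₂]
  have e1 : ∀ s v w, B s v * B s w * (B s v * B s w * |Γ s v w|)
      = B s v * B s w * |Γ s v w| := by
    intro s v w; rw [← mul_assoc, ← sq, hBB]
  simp only [e1, mul_pow _ |Γ _ _ _|, hBB, sq_abs] at hcs
  refine abs_le_of_sq_le_sq' (hcs.trans ?_) (by positivity) |>.2
  calc _ ≤ ((1 + e ^ 4) * β ^ 2) * (65 * e ^ 4 * ((τ ^ 2 * α) ^ 2 * β ^ 2)) := by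
        refine mul_le_mul h.avg_BB_le hsq ?_ (by positivity)
        exact avg_nonneg fun s => avg_nonneg fun v => avg_nonneg fun w =>
          mul_nonneg (mul_nonneg (h.B_nonneg _ _) (h.B_nonneg _ _)) (sq_nonneg _)
    _ = (65 * (1 + e ^ 4)) * (e ^ 4 * ((τ ^ 2 * α) ^ 2 * β ^ 4)) := by ring
    _ ≤ 81 * (e ^ 4 * ((τ ^ 2 * α) ^ 2 * β ^ 4)) := by
        gcongr; linarith
    _ = _ := by ring

theorem abs_R_le (h : Fibre A B R t α β ϖ k e ζ) (u v) : |R u v| ≤ 1 := by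
  rcases h.R01 u v with h | h <;> simp [h]

theorem abs_le_one_of_le (h : Fibre A B R t α β ϖ k e ζ) {θ : S → V → V → ℝ}
    (hθ : ∀ s v w, |θ s v w| ≤ B s v * B s w) (s v w) : |θ s v w| ≤ 1 :=
  (hθ s v w).trans (mul_le_one₀ (h.B_le_one _ _) (h.B_nonneg _ _) (h.B_le_one _ _))

theorem eq_mul_of_le (h : Fibre A B R t α β ϖ k e ζ) {θ : S → V → V → ℝ}
    (hθ : ∀ s v w, |θ s v w| ≤ B s v * B s w) (s v w) : B s v * θ s v w = θ s v w := by
  rcases h.B01 s v with h₁ | h₁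
  · have := hθ s v w
    rw [h₁, zero_mul, abs_nonpos_iff] at this
    rw [this, mul_zero]
  · rw [h₁, one_mul]

theorem mul_eq_of_abs_le (h : Fibre A B R t α β ϖ k e ζ) {m : S → U → V → ℝ}
    (hm : ∀ s u v, |m s u v| ≤ t s u v) (s u v) : t s u v * m s u v = m s u v := by
  rcases h.t01 s u v with h₁ | h₁
  · have := hm s u v
    rw [h₁, abs_nonpos_iff] at this
    rw [this, mul_zero]
  · rw [h₁, one_mul]

/-- Against the square of an average of `m`, the graph `t` may be replaced by its density relative
to the vertex sets. -/
theorem abs_avg_balanced_le (h : Fibre A B R t α β ϖ k e ζ) {m : S → U → V → ℝ}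
    (hm : ∀ s u v, |m s u v| ≤ t s u v) {θ : S → V → V → ℝ}
    (hθ : ∀ s v w, |θ s v w| ≤ B s v * B s w) :
    |𝔼 s, 𝔼 u, 𝔼 v, (t s u v - k * ϖ * (A s u * B s v)) * (𝔼 w, m s u w * θ s v w) ^ 2|
      ≤ 4 * e * ϖ * ((k * ϖ) ^ 2 * α * β ^ 3) := by
  set τ := k * ϖ with hτdef
  have hτ : 0 < τ := h.τ_pos
  have hτ1 : τ ≤ 1 := h.τ_le_one
  have hα := h.α_pos
  have hβ := h.β_pos
  have hϖ := h.ϖ_pos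
  have he := h.e_pos
  have he4 := h.e4_le
  set g : S → U → V → ℝ := fun s u v => t s u v - τ * (A s u * B s v) with hg
  have hg1 : ∀ s u v, |g s u v| ≤ 1 := by
    intro s u v
    have h1 := h.t_nonneg s u v
    have h2 := h.t_le_one s u v
    have h3 : 0 ≤ τ * (A s u * B s v) :=
      mul_nonneg hτ.le (mul_nonneg (h.A_nonneg _ _) (h.B_nonneg _ _))
    have h4 : τ * (A s u * B s v) ≤ 1 := mul_le_one₀ hτ1
      (mul_nonneg (h.A_nonneg _ _) (h.B_nonneg _ _))
      (mul_le_one₀ (h.A_le_one _ _) (h.B_nonneg _ _) (h.B_le_one _ _))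
    rw [abs_le]; constructor <;> simp only [hg] <;> linarith
  -- Expanding the square puts `m s u a * m s u b` in front of an average `X` of the balanced
  -- function; the weight `m` is then removed by the Cauchy–Schwarz inequality, keeping `t`.
  set X : S → U → V → V → ℝ := fun s u a b => 𝔼 v, g s u v * (θ s v a * θ s v b) with hX
  have e1 : 𝔼 s, 𝔼 u, 𝔼 v, g s u v * (𝔼 w, m s u w * θ s v w) ^ 2
      = 𝔼 s, 𝔼 u, 𝔼 a, 𝔼 b, (m s u a * m s u b) * (t s u a * t s u b * X s u a b) := by
    refine avg_congr fun s => avg_congr fun u => ?_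
    calc _ = 𝔼 v, 𝔼 a, 𝔼 b, (m s u a * m s u b) * (g s u v * (θ s v a * θ s v b)) := by
          refine avg_congr fun v => ?_
          rw [avg_sq_eq]
          simp only [Finset.mul_expect]
          exact avg_congr fun a => avg_congr fun b => by ring
      _ = 𝔼 a, 𝔼 b, 𝔼 v, (m s u a * m s u b) * (g s u v * (θ s v a * θ s v b)) := by
          rw [avg_swap]; exact avg_congr fun a => avg_swap _
      _ = _ := by
          refine avg_congr fun a => avg_congr fun b => ?_
          rw [← Finset.mul_expect, ← h.mul_eq_of_abs_le hm s u a, ← h.mul_eq_of_abs_le hm s u b]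
          rcases h.t01 s u a with h₁ | h₁ <;> rcases h.t01 s u b with h₂ | h₂ <;> simp [h₁, h₂, hX]
  have hcs := avg_cauchy₄ (fun s u a b => m s u a * m s u b)
    (fun s u a b => t s u a * t s u b * X s u a b)
  rw [← e1] at hcs
  have hfirst : 𝔼 s, 𝔼 u, 𝔼 a, 𝔼 b, (m s u a * m s u b) ^ 2
      ≤ (1 + e ^ 4) * (τ ^ 2 * α * β ^ 2) := by
    refine le_trans ?_ h.avg_row_sq_le
    refine avg_mono fun s => avg_mono fun u => ?_
    rw [avg_sq_eq]
    refine avg_mono fun a => avg_mono fun b => ?_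
    have hsq : ∀ v, m s u v ^ 2 ≤ t s u v := by
      intro v
      rw [← sq_abs]
      have h1 := hm s u v
      have h2 := h.t_le_one s u v
      have h3 := abs_nonneg (m s u v)
      nlinarith
    rw [mul_pow]
    exact mul_le_mul (hsq a) (hsq b) (sq_nonneg _) (h.t_nonneg _ _ _)
  -- The mean square of `X` is controlled by inner products of columns of the balanced function.
  have hXsq : ∀ s, 𝔼 u, 𝔼 a, 𝔼 b, X s u a b ^ 2
      ≤ (𝔼 v, B s v) ^ 2 * 𝔼 v, 𝔼 w, B s v * B s w * |𝔼 u, g s u v * g s u w| := by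
    intro s
    simp only [hX]
    rw [avg_sq_eq_gram, Finset.mul_expect]
    refine avg_mono fun v => ?_
    rw [Finset.mul_expect]
    refine avg_mono fun w => ?_
    have h1 : |𝔼 a, θ s v a * θ s w a| ≤ B s v * B s w * 𝔼 a, B s a := by
      rw [Finset.mul_expect]
      refine (abs_avg_le _).trans (avg_mono fun a => ?_)
      rw [abs_mul]
      calc _ ≤ (B s v * B s a) * (B s w * B s a) :=
            mul_le_mul (hθ _ _ _) (hθ _ _ _) (abs_nonneg _)
              (mul_nonneg (h.B_nonneg _ _) (h.B_nonneg _ _))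
        _ = _ := by rcases h.B01 s a with h₁ | h₁ <;> simp [h₁]
    have h2 : (𝔼 a, θ s v a * θ s w a) ^ 2 ≤ B s v * B s w * (𝔼 a, B s a) ^ 2 := by
      rw [← sq_abs]
      refine (pow_le_pow_left₀ (abs_nonneg _) h1 2).trans (le_of_eq ?_)
      rcases h.B01 s v with h₁ | h₁ <;> rcases h.B01 s w with h₂ | h₂ <;> simp [h₁, h₂]
    calc _ ≤ |𝔼 u, g s u v * g s u w| * (𝔼 a, θ s v a * θ s w a) ^ 2 :=
          mul_le_mul_of_nonneg_right (le_abs_self _) (sq_nonneg _)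
      _ ≤ |𝔼 u, g s u v * g s u w| * (B s v * B s w * (𝔼 a, B s a) ^ 2) :=
          mul_le_mul_of_nonneg_left h2 (abs_nonneg _)
      _ = _ := by ring
  have hgram := h.avg_gram_balanced_le
  have hXall : 𝔼 s, 𝔼 u, 𝔼 a, 𝔼 b, X s u a b ^ 2
      ≤ β ^ 2 * (9 * e ^ 2 * (τ ^ 2 * α * β ^ 2)) + 2 * ζ := by
    refine (avg_mono hXsq).trans ?_
    refine (h.avg_B_sq_mul_le (fun s => ?_) (fun s => ?_)).trans ?_
    · exact avg_nonneg fun v => avg_nonneg fun w =>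
        mul_nonneg (mul_nonneg (h.B_nonneg _ _) (h.B_nonneg _ _)) (abs_nonneg _)
    · refine avg_le_of_le fun v => avg_le_of_le fun w => ?_
      refine mul_le_one₀ (mul_le_one₀ (h.B_le_one _ _) (h.B_nonneg _ _) (h.B_le_one _ _))
        (abs_nonneg _) ?_
      exact abs_avg_le_one fun u => abs_mul_le_one (hg1 _ _ _) (hg1 _ _ _)
    · have := mul_le_mul_of_nonneg_left hgram (sq_nonneg β)
      linarith
  -- Here `t ≤ R`, and the two edges of `R` contribute their full density `ϖ ^ 2`.
  have hsecond : 𝔼 s, 𝔼 u, 𝔼 a, 𝔼 b, (t s u a * t s u b * X s u a b) ^ 2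
      ≤ 10 * e ^ 2 * (ϖ ^ 2 * (τ ^ 2 * α * β ^ 4)) := by
    have h1 : 𝔼 s, 𝔼 u, 𝔼 a, 𝔼 b, (t s u a * t s u b * X s u a b) ^ 2
        ≤ 𝔼 s, (ϖ ^ 2 * (𝔼 u, 𝔼 a, 𝔼 b, X s u a b ^ 2) + 2 * ζ) := by
      refine avg_mono fun s => ?_
      refine le_trans ?_ (h.cut.replace_two hϖ.le h.ϖ_le h.abs_R_le (hg1 s)
        (h.abs_le_one_of_le hθ s))
      refine avg_mono fun u => avg_mono fun a => avg_mono fun b => ?_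
      rw [mul_pow]
      refine mul_le_mul_of_nonneg_right ?_ (sq_nonneg _)
      have hRn : ∀ v, 0 ≤ R u v := fun v => (h.t_nonneg s u v).trans (h.t_le_R s u v)
      have : (t s u a * t s u b) ^ 2 = t s u a * t s u b := by
        rcases h.t01 s u a with h₁ | h₁ <;> rcases h.t01 s u b with h₂ | h₂ <;> simp [h₁, h₂]
      rw [this]
      exact mul_le_mul (h.t_le_R _ _ _) (h.t_le_R _ _ _) (h.t_nonneg _ _ _) (hRn _)
    rw [Finset.expect_add_distrib, Fintype.expect_const, ← Finset.mul_expect] at h1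
    have h2 := mul_le_mul_of_nonneg_left hXall (sq_nonneg ϖ)
    have hz0 := h.ζ_nonneg
    have hϖ2 : ϖ ^ 2 ≤ 1 := pow_le_one₀ hϖ.le h.ϖ_le
    have h3 : ϖ ^ 2 * (2 * ζ) ≤ 2 * ζ := mul_le_of_le_one_left (by linarith) hϖ2
    have h4 := h.small_monomial 4 1 4
    have h5 : 4 * ζ ≤ e ^ 2 * (ϖ ^ 2 * (τ ^ 2 * α * β ^ 4)) := by
      have h6 : τ ^ 2 ≤ ϖ ^ 2 :=
        pow_le_pow_left₀ hτ.le (mul_le_of_le_one_left hϖ.le h.k_le) 2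
      have h7 : e ^ 2 ≤ 1 := pow_le_one₀ he.le (by linarith [h.e_le])
      have h8 : e ^ 4 * (τ ^ 4 * α ^ 1 * β ^ 4) ≤ e ^ 2 * (ϖ ^ 2 * (τ ^ 2 * α * β ^ 4)) := by
        calc _ = e ^ 2 * e ^ 2 * (τ ^ 2 * (τ ^ 2 * α * β ^ 4)) := by ring
          _ ≤ 1 * e ^ 2 * (ϖ ^ 2 * (τ ^ 2 * α * β ^ 4)) := by gcongr
          _ = _ := by ring
      have h9 : 0 ≤ e ^ 4 * (τ ^ 4 * α ^ 1 * β ^ 4) := by positivity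
      linarith
    nlinarith
  refine abs_le_of_sq_le_sq (hcs.trans ?_) (by positivity)
  calc _ ≤ ((1 + e ^ 4) * (τ ^ 2 * α * β ^ 2)) * (10 * e ^ 2 * (ϖ ^ 2 * (τ ^ 2 * α * β ^ 4))) := by
        refine mul_le_mul hfirst hsecond ?_ (by positivity)
        exact avg_nonneg fun s => avg_nonneg fun u => avg_nonneg fun a => avg_nonneg fun b =>
          sq_nonneg _
    _ = (10 * (1 + e ^ 4)) * (e ^ 2 * ϖ ^ 2 * (τ ^ 2 * α * β ^ 3) ^ 2) := by ring
    _ ≤ 16 * (e ^ 2 * ϖ ^ 2 * (τ ^ 2 * α * β ^ 3) ^ 2) := by gcongr; linarith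
    _ = _ := by ring

/-- If the Gram kernel of `m` correlates with a bounded kernel `θ`, then the averages of `m`
against the rows of `θ` are large. Compared with the Cauchy–Schwarz inequality for arbitrary `m`,
nothing is lost to the sparsity of `t`. -/
theorem kernel_square_ge (h : Fibre A B R t α β ϖ k e ζ) {m : S → U → V → ℝ}
    (hm : ∀ s u v, |m s u v| ≤ t s u v) {θ : S → V → V → ℝ}
    (hθ : ∀ s v w, |θ s v w| ≤ B s v * B s w) {l : ℝ} (hl : 0 ≤ l)
    (hel : 16 * e ≤ k * l ^ 2)
    (hL : l * ((k * ϖ) ^ 2 * α * β ^ 2)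
      ≤ 𝔼 s, 𝔼 v, 𝔼 w, θ s v w * 𝔼 u, m s u v * m s u w) :
    l ^ 2 / 2 * ((k * ϖ) ^ 2 * α * β ^ 3)
      ≤ 𝔼 s, 𝔼 u, 𝔼 v, (𝔼 w, m s u w * θ s v w) ^ 2 := by
  have herr := h.abs_avg_balanced_le hm hθ
  set τ := k * ϖ with hτdef
  have hτ : 0 < τ := h.τ_pos
  have hα := h.α_pos
  have hβ := h.β_pos
  have hϖ := h.ϖ_pos
  have he := h.e_pos
  have he4 := h.e4_le
  set G : S → U → V → ℝ := fun s u v => 𝔼 w, m s u w * θ s v w with hG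
  set Y := 𝔼 s, 𝔼 u, 𝔼 v, G s u v ^ 2 with hY
  have hAG : ∀ s u v, A s u * G s u v = G s u v := by
    intro s u v
    simp only [hG, Finset.mul_expect]
    refine avg_congr fun w => ?_
    rw [← h.mul_eq_of_abs_le hm s u w, ← mul_assoc, ← mul_assoc, h.A_mul_t]
  have hBG : ∀ s u v, B s v * G s u v = G s u v := by
    intro s u v
    simp only [hG, Finset.mul_expect]
    refine avg_congr fun w => ?_
    rw [mul_left_comm, h.eq_mul_of_le hθ]
  have e1 : 𝔼 s, 𝔼 v, 𝔼 w, θ s v w * 𝔼 u, m s u v * m s u w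
      = 𝔼 s, 𝔼 u, 𝔼 v, t s u v * (t s u v * (m s u v * G s u v)) := by
    refine avg_congr fun s => ?_
    calc _ = 𝔼 v, 𝔼 u, 𝔼 w, m s u v * (m s u w * θ s v w) := by
          refine avg_congr fun v => ?_
          simp only [Finset.mul_expect]
          rw [avg_swap]
          exact avg_congr fun u => avg_congr fun w => by ring
      _ = _ := by
          rw [avg_swap]
          refine avg_congr fun u => avg_congr fun v => ?_
          rw [← Finset.mul_expect, ← mul_assoc (t s u v) (m s u v), h.mul_eq_of_abs_le hm,
            ← mul_assoc (t s u v) (m s u v), h.mul_eq_of_abs_le hm]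
  have hcs := avg_cauchy₃ (fun s u v => t s u v)
    (fun s u v => t s u v * (m s u v * G s u v))
  rw [← e1] at hcs
  have e2 : 𝔼 s, 𝔼 u, 𝔼 v, (t s u v) ^ 2 = 𝔼 s, 𝔼 u, 𝔼 v, t s u v := by
    refine avg_congr fun s => avg_congr fun u => avg_congr fun v => ?_
    rcases h.t01 s u v with h | h <;> simp [h]
  have e3 : 𝔼 s, 𝔼 u, 𝔼 v, (t s u v * (m s u v * G s u v)) ^ 2
      ≤ 𝔼 s, 𝔼 u, 𝔼 v, t s u v * G s u v ^ 2 := by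
    refine avg_mono fun s => avg_mono fun u => avg_mono fun v => ?_
    have h1 : m s u v ^ 2 ≤ 1 := by
      rw [← sq_abs]; exact pow_le_one₀ (abs_nonneg _) ((hm s u v).trans (h.t_le_one s u v))
    rcases h.t01 s u v with h | h
    · simp [h]
    · rw [h, one_mul, one_mul, mul_pow]
      exact mul_le_of_le_one_left (sq_nonneg _) h1
  -- After the Cauchy–Schwarz inequality with weight `t`, the graph `t` is replaced by `τ (A × B)`.
  have e4 : 𝔼 s, 𝔼 u, 𝔼 v, t s u v * G s u v ^ 2
      = τ * Y + 𝔼 s, 𝔼 u, 𝔼 v, (t s u v - τ * (A s u * B s v)) * G s u v ^ 2 := by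
    rw [hY]
    simp only [Finset.mul_expect, ← Finset.expect_add_distrib]
    refine avg_congr fun s => avg_congr fun u => avg_congr fun v => ?_
    have h1 : A s u * B s v * G s u v ^ 2 = G s u v ^ 2 := by
      calc _ = (A s u * G s u v) * (B s v * G s u v) := by ring
        _ = _ := by rw [hAG, hBG, sq]
    linear_combination τ * h1
  set L := 𝔼 s, 𝔼 v, 𝔼 w, θ s v w * 𝔼 u, m s u v * m s u w
  have h5 : 𝔼 s, 𝔼 u, 𝔼 v, t s u v * G s u v ^ 2 ≤ τ * Y + 4 * e * ϖ * (τ ^ 2 * α * β ^ 3) := by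
    rw [e4]; linarith [(abs_le.1 herr).2]
  have h6 : L ^ 2 ≤ ((1 + e ^ 4) * (τ * α * β)) * (τ * Y + 4 * e * ϖ * (τ ^ 2 * α * β ^ 3)) := by
    rw [e2] at hcs
    refine hcs.trans (mul_le_mul h.avg_t_le (e3.trans h5) ?_ (by positivity))
    exact avg_nonneg fun s => avg_nonneg fun u => avg_nonneg fun v => sq_nonneg _
  have h7 : (l * (τ ^ 2 * α * β ^ 2)) ^ 2 ≤ L ^ 2 := pow_le_pow_left₀ (by positivity) hL 2
  have h8 : 4 * e * ϖ * (τ ^ 2 * α * β ^ 3) ≤ l ^ 2 / 4 * (τ * (τ ^ 2 * α * β ^ 3)) := by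
    have : 4 * e * ϖ ≤ l ^ 2 / 4 * τ := by rw [hτdef]; nlinarith
    calc _ ≤ (l ^ 2 / 4 * τ) * (τ ^ 2 * α * β ^ 3) := by gcongr
      _ = _ := by ring
  set N := τ ^ 2 * α * β ^ 3 with hN
  have hNpos : 0 < N := by positivity
  have h9 : l ^ 2 * N ≤ (1 + e ^ 4) * (Y + l ^ 2 / 4 * N) := by
    have h10 : (l * (τ ^ 2 * α * β ^ 2)) ^ 2
        ≤ ((1 + e ^ 4) * (τ * α * β)) * (τ * Y + l ^ 2 / 4 * (τ * N)) :=
      h7.trans (h6.trans (mul_le_mul_of_nonneg_left (by linarith) (by positivity)))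
    refine le_of_mul_le_mul_left ?_ (by positivity : 0 < τ ^ 2 * α * β)
    calc _ = (l * (τ ^ 2 * α * β ^ 2)) ^ 2 := by rw [hN]; ring
      _ ≤ _ := h10
      _ = _ := by ring
  have hlN : 0 ≤ l ^ 2 * N := by positivity
  by_contra hcon
  push Not at hcon
  have h10 := mul_lt_mul_of_pos_left hcon (by positivity : 0 < 1 + e ^ 4)
  have h11 := mul_le_mul_of_nonneg_right he4 hlN
  linarith

theorem abs_gram_le (h : Fibre A B R t α β ϖ k e ζ) {m : S → U → V → ℝ}
    (hm : ∀ s u v, |m s u v| ≤ t s u v) (s v w) :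
    |𝔼 u, m s u v * m s u w| ≤ 𝔼 u, t s u v * t s u w := by
  refine (abs_avg_le _).trans (avg_mono fun u => ?_)
  rw [abs_mul]
  exact mul_le_mul (hm _ _ _) (hm _ _ _) (abs_nonneg _) (h.t_nonneg _ _ _)

theorem gram_mul (h : Fibre A B R t α β ϖ k e ζ) {m : S → U → V → ℝ}
    (hm : ∀ s u v, |m s u v| ≤ t s u v) (s v w) :
    B s v * B s w * 𝔼 u, m s u v * m s u w = 𝔼 u, m s u v * m s u w := by
  rw [Finset.mul_expect]
  refine avg_congr fun u => ?_
  have h1 : ∀ v, B s v * m s u v = m s u v := fun v => by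
    rw [← h.mul_eq_of_abs_le hm, ← mul_assoc, h.B_mul_t]
  calc _ = (B s v * m s u v) * (B s w * m s u w) := by ring
    _ = _ := by rw [h1, h1]

theorem abs_clip_gram_le (h : Fibre A B R t α β ϖ k e ζ) {m : S → U → V → ℝ}
    (hm : ∀ s u v, |m s u v| ≤ t s u v) (c : ℝ) (s v w) :
    |clip ((𝔼 u, m s u v * m s u w) / c)| ≤ B s v * B s w := by
  rw [← h.gram_mul hm]
  rcases h.B01 s v with h₁ | h₁ <;> rcases h.B01 s w with h₂ | h₂ <;>
    simp [h₁, h₂, abs_clip_le]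

/-- A Gram kernel of a function supported on `t` may be truncated at the expected codegree. -/
theorem avg_gram_clip_ge (h : Fibre A B R t α β ϖ k e ζ) {m n : S → U → V → ℝ}
    (hm : ∀ s u v, |m s u v| ≤ t s u v) (hn : ∀ s u v, |n s u v| ≤ t s u v) :
    (𝔼 s, 𝔼 v, 𝔼 w, (𝔼 u, m s u v * m s u w) * 𝔼 u, n s u v * n s u w)
        - 3 * e ^ 2 * (((k * ϖ) ^ 2 * α) ^ 2 * β ^ 2)
      ≤ (k * ϖ) ^ 2 * α * 𝔼 s, 𝔼 v, 𝔼 w,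
        clip ((𝔼 u, n s u v * n s u w) / ((k * ϖ) ^ 2 * α)) * 𝔼 u, m s u v * m s u w := by
  have hV := h.variance_codeg
  have h4 := h.count4
  set τ := k * ϖ with hτdef
  have hτ : 0 < τ := h.τ_pos
  have hα := h.α_pos
  have hβ := h.β_pos
  have he := h.e_pos
  have he4 := h.e4_le
  set c := τ ^ 2 * α with hc
  have hcp : 0 < c := by positivity
  set F : S → V → V → ℝ := fun s v w => 𝔼 u, t s u v * t s u w with hF
  have hcs := avg_cauchy₃ F (fun s v w => B s v * B s w * |F s v w - c|)
  have hBB : ∀ s v w, (B s v * B s w) ^ 2 = B s v * B s w := by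
    intro s v w
    rcases h.B01 s v with h₁ | h₁ <;> rcases h.B01 s w with h₂ | h₂ <;> simp [h₁, h₂]
  simp only [mul_pow _ |F _ _ _ - c|, hBB, sq_abs] at hcs
  have hE : 𝔼 s, 𝔼 v, 𝔼 w, F s v w * (B s v * B s w * |F s v w - c|)
      ≤ 3 * e ^ 2 * (c ^ 2 * β ^ 2) := by
    refine abs_le_of_sq_le_sq' (hcs.trans ?_) (by positivity) |>.2
    calc _ ≤ ((1 + e ^ 4) * (τ ^ 4 * α ^ 2 * β ^ 2)) * (8 * e ^ 4 * (c ^ 2 * β ^ 2)) := by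
          refine mul_le_mul h4 hV ?_ (by positivity)
          exact avg_nonneg fun s => avg_nonneg fun v => avg_nonneg fun w =>
            mul_nonneg (mul_nonneg (h.B_nonneg _ _) (h.B_nonneg _ _)) (sq_nonneg _)
      _ = (8 * (1 + e ^ 4)) * (e ^ 4 * (c ^ 2 * β ^ 2) ^ 2) := by rw [hc]; ring
      _ ≤ 9 * (e ^ 4 * (c ^ 2 * β ^ 2) ^ 2) := by gcongr; linarith
      _ = _ := by ring
  have hpt : 𝔼 s, 𝔼 v, 𝔼 w, ((𝔼 u, m s u v * m s u w) * (𝔼 u, n s u v * n s u w)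
      - c * (clip ((𝔼 u, n s u v * n s u w) / c) * 𝔼 u, m s u v * m s u w))
      ≤ 𝔼 s, 𝔼 v, 𝔼 w, F s v w * (B s v * B s w * |F s v w - c|) := by
    refine avg_mono fun s => avg_mono fun v => avg_mono fun w => ?_
    have h1 := h.abs_gram_le hm s v w
    have h2 := abs_sub_clip_le (h.abs_gram_le hn s v w) hcp
    have h3 := h.gram_mul hm s v w
    have hF0 : 0 ≤ F s v w := (abs_nonneg _).trans h1
    set Fm := 𝔼 u, m s u v * m s u w
    set Fn := 𝔼 u, n s u v * n s u w
    have hB0 : 0 ≤ B s v * B s w := mul_nonneg (h.B_nonneg _ _) (h.B_nonneg _ _)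
    calc Fm * Fn - c * (clip (Fn / c) * Fm) = B s v * B s w * (Fm * (Fn - c * clip (Fn / c))) := by
          linear_combination (-(Fn - c * clip (Fn / c))) * h3
      _ ≤ B s v * B s w * (F s v w * |F s v w - c|) := by
          refine mul_le_mul_of_nonneg_left ((le_abs_self _).trans ?_) hB0
          rw [abs_mul]
          exact mul_le_mul h1 h2 (abs_nonneg _) hF0
      _ = _ := by ring
  simp only [Finset.expect_sub_distrib, ← Finset.mul_expect] at hpt
  simp only [Finset.mul_expect] at hpt hE ⊢
  linarith

/-- A function supported on a sparse pseudorandom family of graphs whose four-cycle count is large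
correlates with products of bounded functions of one variable, with no loss from the sparsity. -/
theorem exists_correlation (h : Fibre A B R t α β ϖ k e ζ) {m n : S → U → V → ℝ}
    (hm : ∀ s u v, |m s u v| ≤ t s u v) (hn : ∀ s u v, |n s u v| ≤ t s u v) {l : ℝ} (hl : 0 < l)
    (hl1 : l ≤ 1) (hel : 64 * e ≤ k * l ^ 2)
    (hL : l * (((k * ϖ) ^ 2 * α) ^ 2 * β ^ 2)
      ≤ 𝔼 s, 𝔼 v, 𝔼 w, (𝔼 u, m s u v * m s u w) * 𝔼 u, n s u v * n s u w) :
    ∃ (a : S → U → ℝ) (b : S → V → ℝ), (∀ s u, |a s u| ≤ A s u) ∧ (∀ s v, |b s v| ≤ B s v) ∧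
      l ^ 2 / 32 * (k * ϖ * α * β) ≤ 𝔼 s, 𝔼 u, 𝔼 v, m s u v * (a s u * b s v) := by
  have hclip := h.avg_gram_clip_ge hm hn
  have hθ := h.abs_clip_gram_le hn ((k * ϖ) ^ 2 * α)
  set θ : S → V → V → ℝ := fun s v w => clip ((𝔼 u, n s u v * n s u w) / ((k * ϖ) ^ 2 * α))
    with hθdef
  have hsq := fun hh => h.kernel_square_ge hm hθ (l := l / 2) (by linarith) (by linarith) hh
  have hVdeg := h.variance_deg
  have hrow := h.avg_row_sq_le
  set τ := k * ϖ with hτdef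
  have hτ : 0 < τ := h.τ_pos
  have hτ1 : τ ≤ 1 := h.τ_le_one
  have hα := h.α_pos
  have hβ := h.β_pos
  have hβ1 := h.β_le
  have he := h.e_pos
  have he4 := h.e4_le
  set c := τ ^ 2 * α with hc
  have hcp : 0 < c := by positivity
  have hl2 : l ^ 2 ≤ 1 := pow_le_one₀ hl.le hl1
  have hll : l ^ 2 ≤ l := by nlinarith
  have hel' : 64 * e ≤ l ^ 2 := hel.trans (mul_le_of_le_one_left (by positivity) h.k_le)
  have hee : 64 * e ^ 2 ≤ l ^ 2 / 10 := by nlinarith [h.e_le]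
  have hY := hsq (by
    have h1 : 3 * e ^ 2 * (c ^ 2 * β ^ 2) ≤ l / 2 * (c ^ 2 * β ^ 2) := by gcongr; linarith
    refine le_of_mul_le_mul_left ?_ hcp
    calc c * (l / 2 * (c * β ^ 2)) = l * (c ^ 2 * β ^ 2) - l / 2 * (c ^ 2 * β ^ 2) := by ring
      _ ≤ _ := by linarith)
  set G : S → U → V → ℝ := fun s u v => 𝔼 w, m s u w * θ s v w with hG
  set N : S → U → ℝ := fun s u => 𝔼 v, t s u v with hN
  have hN0 : ∀ s u, 0 ≤ N s u := fun s u => avg_nonneg fun v => h.t_nonneg s u v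
  have hN1 : ∀ s u, N s u ≤ 1 := fun s u => avg_le_of_le fun v => h.t_le_one s u v
  have hAG : ∀ s u v, A s u * G s u v = G s u v := by
    intro s u v
    simp only [hG, Finset.mul_expect]
    refine avg_congr fun w => ?_
    rw [← h.mul_eq_of_abs_le hm s u w, ← mul_assoc, ← mul_assoc, h.A_mul_t]
  have hBG : ∀ s u v, B s v * G s u v = G s u v := by
    intro s u v
    simp only [hG, Finset.mul_expect]
    refine avg_congr fun w => ?_
    rw [mul_left_comm, h.eq_mul_of_le hθ]
  have hGN : ∀ s u v, |G s u v| ≤ N s u := by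
    intro s u v
    refine (abs_avg_le _).trans (avg_mono fun w => ?_)
    rw [abs_mul]
    exact (mul_le_of_le_one_right (abs_nonneg _) (h.abs_le_one_of_le hθ _ _ _)).trans (hm _ _ _)
  have hd : 0 < τ * β := by positivity
  -- The averages `G` are truncated at the expected degree `τ β`; the cost is a variance of degrees.
  set Gc : S → U → V → ℝ := fun s u v => clip (G s u v / (τ * β)) with hGc
  have hX : 𝔼 s, 𝔼 u, A s u * (N s u * |N s u - τ * β|) ≤ 3 * e ^ 2 * (τ ^ 2 * α * β ^ 2) := by
    have hcs := avg_cauchy₂ N (fun s u => A s u * |N s u - τ * β|)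
    have hA2 : ∀ s u, A s u ^ 2 = A s u := fun s u => by
      rcases h.A01 s u with h | h <;> simp [h]
    simp only [mul_pow, hA2, sq_abs, mul_left_comm (N _ _)] at hcs
    refine abs_le_of_sq_le_sq' (hcs.trans ?_) (by positivity) |>.2
    calc _ ≤ ((1 + e ^ 4) * (τ ^ 2 * α * β ^ 2)) * (4 * e ^ 4 * (τ ^ 2 * α * β ^ 2)) := by
          refine mul_le_mul hrow hVdeg ?_ (by positivity)
          exact avg_nonneg fun s => avg_nonneg fun u => mul_nonneg (h.A_nonneg _ _) (sq_nonneg _)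
      _ = (4 * (1 + e ^ 4)) * (e ^ 4 * (τ ^ 2 * α * β ^ 2) ^ 2) := by ring
      _ ≤ 9 * (e ^ 4 * (τ ^ 2 * α * β ^ 2) ^ 2) := by gcongr; linarith
      _ = _ := by ring
  have herr : 𝔼 s, 𝔼 u, 𝔼 v, B s v * (A s u * (N s u * |N s u - τ * β|))
      ≤ β * (3 * e ^ 2 * (τ ^ 2 * α * β ^ 2)) + ζ := by
    have h1 : 𝔼 s, 𝔼 u, 𝔼 v, B s v * (A s u * (N s u * |N s u - τ * β|))
        = 𝔼 s, (𝔼 v, B s v) * 𝔼 u, A s u * (N s u * |N s u - τ * β|) := by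
      refine avg_congr fun s => ?_
      rw [avg_swap, Finset.expect_mul_expect]
    rw [h1]
    refine (h.avg_B_mul_le (fun s => ?_) (fun s => ?_)).trans ?_
    · exact avg_nonneg fun u => mul_nonneg (h.A_nonneg _ _) (mul_nonneg (hN0 _ _) (abs_nonneg _))
    · refine avg_le_of_le fun u => mul_le_one₀ (h.A_le_one _ _)
        (mul_nonneg (hN0 _ _) (abs_nonneg _)) (mul_le_one₀ (hN1 _ _) (abs_nonneg _) ?_)
      have h2 : τ * β ≤ 1 := mul_le_one₀ hτ1 hβ.le hβ1
      rw [abs_le]; constructor <;> linarith [hN0 s u, hN1 s u]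
    · have := mul_le_mul_of_nonneg_left hX hβ.le
      linarith
  have hGG : 𝔼 s, 𝔼 u, 𝔼 v, (G s u v ^ 2 - τ * β * (G s u v * Gc s u v))
      ≤ 𝔼 s, 𝔼 u, 𝔼 v, B s v * (A s u * (N s u * |N s u - τ * β|)) := by
    refine avg_mono fun s => avg_mono fun u => avg_mono fun v => ?_
    have h1 := abs_sub_clip_le (hGN s u v) hd
    have hA0 := h.A_nonneg s u
    have hB0 := h.B_nonneg s v
    calc _ = B s v * (A s u * (G s u v * (G s u v - τ * β * Gc s u v))) := by
          rw [← mul_assoc (A s u), hAG, ← mul_assoc (B s v), hBG]; ring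
      _ ≤ _ := by
          refine mul_le_mul_of_nonneg_left (mul_le_mul_of_nonneg_left ?_ hA0) hB0
          refine (le_abs_self _).trans ?_
          rw [abs_mul]
          exact mul_le_mul (hGN _ _ _) h1 (abs_nonneg _) (hN0 _ _)
  set Q : S → V → ℝ := fun s v => 𝔼 u, G s u v * Gc s u v with hQ
  have hQeq : 𝔼 s, 𝔼 u, 𝔼 v, G s u v * Gc s u v = 𝔼 s, 𝔼 v, B s v * Q s v := by
    refine avg_congr fun s => ?_
    rw [avg_swap]
    refine avg_congr fun v => ?_
    simp only [hQ, Finset.mul_expect]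
    exact avg_congr fun u => by rw [← mul_assoc, hBG]
  have hQ1 : ∀ s v, |Q s v| ≤ 1 := fun s v => abs_avg_le_one fun u =>
    abs_mul_le_one ((hGN _ _ _).trans (hN1 _ _)) (abs_clip_le _)
  -- For each `s`, one vertex `g s` is fixed; it is averaged over `B s`, which costs a factor `β`.
  obtain ⟨g, hg⟩ := exists_choice (c := β) h.B_nonneg hQ1
  have hfin : l ^ 2 / 32 * (τ * α * β) ≤ 𝔼 s, |Q s (g s)| := by
    simp only [Finset.expect_sub_distrib, ← Finset.mul_expect] at hGG
    rw [hQeq] at hGG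
    have hz1 := h.small_monomial 2 1 3
    have hz2 := h.small_monomial 1 1 2
    have hee4 : e ^ 4 ≤ e ^ 2 := pow_le_pow_of_le_one he.le (by linarith [h.e_le]) (by norm_num)
    have hC : 0 < τ ^ 2 * α * β ^ 3 := by positivity
    have hC' : 0 < τ * α * β ^ 2 := by positivity
    have hz1' : ζ ≤ l ^ 2 / 640 * (τ ^ 2 * α * β ^ 3) := by
      refine hz1.trans (mul_le_mul (by linarith) (le_of_eq (by ring)) (by positivity)
        (by positivity))
    have hz2' : ζ ≤ l ^ 2 / 640 * (τ * α * β ^ 2) := by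
      refine hz2.trans (mul_le_mul (by linarith) (le_of_eq (by ring)) (by positivity)
        (by positivity))
    have h3 : 3 * e ^ 2 * (τ ^ 2 * α * β ^ 3) ≤ l ^ 2 / 200 * (τ ^ 2 * α * β ^ 3) := by
      gcongr; linarith
    have h4 : (τ * β) * (l ^ 2 / 16 * (τ * α * β ^ 2)) ≤ (τ * β) * 𝔼 s, 𝔼 v, B s v * Q s v := by
      have h5 : (l / 2) ^ 2 / 2 * (c * β ^ 3) = l ^ 2 / 8 * (τ ^ 2 * α * β ^ 3) := by
        rw [hc]; ring
      have h6 : (τ * β) * (l ^ 2 / 16 * (τ * α * β ^ 2)) = l ^ 2 / 16 * (τ ^ 2 * α * β ^ 3) := by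
        ring
      have h7 : β * (3 * e ^ 2 * (τ ^ 2 * α * β ^ 2)) = 3 * e ^ 2 * (τ ^ 2 * α * β ^ 3) := by ring
      have h8 : 0 < l ^ 2 * (τ ^ 2 * α * β ^ 3) := by positivity
      rw [h5] at hY
      rw [h6]
      rw [h7] at herr
      linarith
    have h5 := le_of_mul_le_mul_left h4 hd
    have h6 := h.avgB
    refine le_of_mul_le_mul_left ?_ hβ
    have h8 : 0 < l ^ 2 * (τ * α * β ^ 2) := by positivity
    have h9 : β * (l ^ 2 / 32 * (τ * α * β)) = l ^ 2 / 32 * (τ * α * β ^ 2) := by ring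
    rw [h9]
    linarith
  refine ⟨fun s u => SignType.sign (Q s (g s)) * Gc s u (g s), fun s v => θ s (g s) v,
    fun s u => ?_, fun s v => ?_, hfin.trans (le_of_eq (avg_congr fun s => ?_))⟩
  · have h1 : |((SignType.sign (Q s (g s)) : SignType) : ℝ)| ≤ 1 := by
      rcases lt_trichotomy (Q s (g s)) 0 with h | h | h <;> simp [h]
    rw [abs_mul]
    refine (mul_le_of_le_one_left (abs_nonneg _) h1).trans ?_
    rcases h.A01 s u with h₁ | h₁
    · have := hAG s u (g s)
      rw [h₁, zero_mul] at this
      simp [hGc, ← this, h₁]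
    · rw [h₁]; exact abs_clip_le _
  · exact (hθ _ _ _).trans (mul_le_of_le_one_left (h.B_nonneg _ _) (h.B_le_one _ _))
  · rw [← sign_mul_self (Q s (g s))]
    simp only [hQ, Finset.mul_expect]
    refine avg_congr fun u => ?_
    simp only [hG, Finset.expect_mul, Finset.mul_expect]
    refine avg_congr fun v => ?_
    ring

end Fibre

/-! ### Codegrees in pseudorandom bipartite graphs -/

theorem exists_unit_sign {ι : Type*} (f : ι → ℝ) :
    ∃ σ : ι → ℝ, (∀ i, σ i = 1 ∨ σ i = -1) ∧ ∀ i, |f i| = σ i * f i := by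
  refine ⟨fun i => if 0 ≤ f i then 1 else -1, fun i => ?_, fun i => ?_⟩ <;> dsimp only <;>
    split_ifs with h
  · exact Or.inl rfl
  · exact Or.inr rfl
  · rw [one_mul, abs_of_nonneg h]
  · rw [abs_of_neg (not_le.1 h)]; ring

theorem exists_sign {ι : Type*} (f : ι → ℝ) :
    ∃ σ : ι → ℝ, (∀ i, |σ i| ≤ 1) ∧ ∀ i, |f i| = σ i * f i := by
  obtain ⟨σ, h1, h2⟩ := exists_unit_sign f
  exact ⟨σ, fun i => by rcases h1 i with h | h <;> simp [h], h2⟩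

section Codegree

variable {Y Z J : Type*} [Fintype Y] [Fintype Z] [Fintype J] [Nonempty Y] [Nonempty Z] [Nonempty J]

theorem CutUniform.avg_abs_le {R : Y → Z → ℝ} {r ρ : ℝ} (h : CutUniform R r ρ) {Ψ : J → Y → ℝ}
    (hΨ : ∀ j y, |Ψ j y| ≤ 1) :
    𝔼 j, 𝔼 z, |(𝔼 y, R y z * Ψ j y) - r * 𝔼 y, Ψ j y| ≤ ρ := by
  refine avg_le_of_le fun j => ?_
  obtain ⟨σ, hσ, hσ'⟩ := exists_sign fun z => (𝔼 y, R y z * Ψ j y) - r * 𝔼 y, Ψ j y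
  have h1 := h (Ψ j) σ (hΨ j) hσ
  refine (le_of_eq ?_).trans ((le_abs_self _).trans h1)
  rw [avg_swap]
  refine avg_congr fun z => ?_
  rw [hσ', Finset.mul_expect, ← Finset.expect_sub_distrib, Finset.mul_expect]
  exact avg_congr fun y => by ring

theorem CutUniform.avg_abs_deg {R : Y → Z → ℝ} {r ρ : ℝ} (h : CutUniform R r ρ) :
    𝔼 z, |(𝔼 y, R y z) - r| ≤ ρ := by
  have := h.avg_abs_le (J := Unit) (Ψ := fun _ _ => 1) (by simp)
  simpa using this

theorem CutUniform.avg_abs_codeg {R : Y → Z → ℝ} {r ρ : ℝ} (h : CutUniform R r ρ) (hr : 0 ≤ r)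
    (hr1 : r ≤ 1) (hR : ∀ y z, |R y z| ≤ 1) :
    𝔼 z, 𝔼 w, |(𝔼 y, R y w * R y z) - r ^ 2| ≤ 2 * ρ := by
  have h1 := h.avg_abs_le (J := Z) (Ψ := fun z y => R y z) (fun z y => hR y z)
  have h2 := h.avg_abs_deg
  have hρ : 0 ≤ ρ := (avg_nonneg fun _ => abs_nonneg _).trans h2
  have h3 : 𝔼 z, 𝔼 w, |(𝔼 y, R y w * R y z) - r ^ 2|
      ≤ 𝔼 z, 𝔼 w, (|(𝔼 y, R y w * R y z) - r * 𝔼 y, R y z| + r * |(𝔼 y, R y z) - r|) := by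
    refine avg_mono fun z => avg_mono fun w => ?_
    rw [← abs_of_nonneg hr, ← abs_mul, abs_of_nonneg hr]
    refine le_trans (le_of_eq ?_) (abs_add_le _ _)
    congr 1; ring
  simp only [Finset.expect_add_distrib, ← Finset.mul_expect, Fintype.expect_const] at h3
  nlinarith

theorem CutUniform.avg_abs_codeg₃ {R : Y → Z → ℝ} {r ρ : ℝ} (h : CutUniform R r ρ) (hr : 0 ≤ r)
    (hr1 : r ≤ 1) (hR : ∀ y z, |R y z| ≤ 1) :
    𝔼 x, 𝔼 z, 𝔼 w, |(𝔼 y, R y w * (R y z * R y x)) - r ^ 3| ≤ 3 * ρ := by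
  have h1 := h.avg_abs_le (J := Z × Z) (Ψ := fun j y => R y j.2 * R y j.1)
    (fun j y => abs_mul_le_one (hR _ _) (hR _ _))
  simp only [avg_prod] at h1
  have h2 := h.avg_abs_codeg hr hr1 hR
  have hρ : 0 ≤ ρ := (avg_nonneg fun _ => abs_nonneg _).trans h.avg_abs_deg
  have h3 : 𝔼 x, 𝔼 z, 𝔼 w, |(𝔼 y, R y w * (R y z * R y x)) - r ^ 3|
      ≤ 𝔼 x, 𝔼 z, 𝔼 w, (|(𝔼 y, R y w * (R y z * R y x)) - r * 𝔼 y, R y z * R y x|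
        + r * |(𝔼 y, R y z * R y x) - r ^ 2|) := by
    refine avg_mono fun x => avg_mono fun z => avg_mono fun w => ?_
    rw [← abs_of_nonneg hr, ← abs_mul, abs_of_nonneg hr]
    refine le_trans (le_of_eq ?_) (abs_add_le _ _)
    congr 1; ring
  simp only [Finset.expect_add_distrib, ← Finset.mul_expect, Fintype.expect_const] at h3
  nlinarith

theorem CutUniform.avg_abs_codeg₄ {R : Y → Z → ℝ} {r ρ : ℝ} (h : CutUniform R r ρ) (hr : 0 ≤ r)
    (hr1 : r ≤ 1) (hR : ∀ y z, |R y z| ≤ 1) :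
    𝔼 v, 𝔼 x, 𝔼 z, 𝔼 w, |(𝔼 y, R y w * (R y z * (R y x * R y v))) - r ^ 4| ≤ 4 * ρ := by
  have h1 := h.avg_abs_le (J := Z × Z × Z) (Ψ := fun j y => R y j.2.2 * (R y j.2.1 * R y j.1))
    (fun j y => abs_mul_le_one (hR _ _) (abs_mul_le_one (hR _ _) (hR _ _)))
  simp only [avg_prod] at h1
  have h2 := h.avg_abs_codeg₃ hr hr1 hR
  have hρ : 0 ≤ ρ := (avg_nonneg fun _ => abs_nonneg _).trans h.avg_abs_deg
  have h3 : 𝔼 v, 𝔼 x, 𝔼 z, 𝔼 w, |(𝔼 y, R y w * (R y z * (R y x * R y v))) - r ^ 4|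
      ≤ 𝔼 v, 𝔼 x, 𝔼 z, 𝔼 w, (|(𝔼 y, R y w * (R y z * (R y x * R y v)))
        - r * 𝔼 y, R y z * (R y x * R y v)|
        + r * |(𝔼 y, R y z * (R y x * R y v)) - r ^ 3|) := by
    refine avg_mono fun v => avg_mono fun x => avg_mono fun z => avg_mono fun w => ?_
    rw [← abs_of_nonneg hr, ← abs_mul, abs_of_nonneg hr]
    refine le_trans (le_of_eq ?_) (abs_add_le _ _)
    congr 1; ring
  simp only [Finset.expect_add_distrib, ← Finset.mul_expect, Fintype.expect_const] at h3
  nlinarith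

theorem CutUniform.avg_abs_deg_sq {R : Y → Z → ℝ} {r ρ : ℝ} (h : CutUniform R r ρ) (hr : 0 ≤ r)
    (hr1 : r ≤ 1) (hR0 : ∀ y z, 0 ≤ R y z) (hR : ∀ y z, R y z ≤ 1) :
    𝔼 z, |(𝔼 y, 𝔼 y', R y z * R y' z) - r ^ 2| ≤ 2 * ρ := by
  have h2 := h.avg_abs_deg
  have h3 : 𝔼 z, |(𝔼 y, 𝔼 y', R y z * R y' z) - r ^ 2| ≤ 𝔼 z, 2 * |(𝔼 y, R y z) - r| := by
    refine avg_mono fun z => ?_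
    rw [← avg_sq_eq]
    have h0 : 0 ≤ 𝔼 y, R y z := avg_nonneg fun y => hR0 y z
    have h1 : 𝔼 y, R y z ≤ 1 := avg_le_of_le fun y => hR y z
    have : (𝔼 y, R y z) ^ 2 - r ^ 2 = ((𝔼 y, R y z) + r) * ((𝔼 y, R y z) - r) := by ring
    rw [this, abs_mul, abs_of_nonneg (by linarith)]
    exact mul_le_mul_of_nonneg_right (by linarith) (abs_nonneg _)
  rw [← Finset.mul_expect] at h3
  linarith

theorem avg_le_of_avg_abs_sub_le {ι : Type*} [Fintype ι] [Nonempty ι] {f : ι → ℝ} {c d : ℝ}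
    (h : 𝔼 i, |f i - c| ≤ d) : 𝔼 i, f i ≤ c + d := by
  have h1 : 𝔼 i, (f i - c) ≤ 𝔼 i, |f i - c| := avg_mono fun i => le_abs_self _
  rw [Finset.expect_sub_distrib, Fintype.expect_const] at h1
  linarith

end Codegree

/-! ### Kernels over a two-sided star -/

section Star

variable {Y Z : Type*} [Fintype Y] [Fintype Z] [Nonempty Y] [Nonempty Z]

theorem avg_swap₁₂ {ι κ μ : Type*} [Fintype ι] [Fintype κ] [Fintype μ] (F : ι → κ → μ → ℝ) :
    𝔼 i, 𝔼 j, 𝔼 k, F i j k = 𝔼 j, 𝔼 k, 𝔼 i, F i j k := by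
  rw [avg_swap]; exact avg_congr fun j => avg_swap _

theorem avg_swap₂₂ {ι κ μ ν : Type*} [Fintype ι] [Fintype κ] [Fintype μ] [Fintype ν]
    (F : ι → κ → μ → ν → ℝ) :
    𝔼 i, 𝔼 j, 𝔼 k, 𝔼 l, F i j k l = 𝔼 k, 𝔼 l, 𝔼 i, 𝔼 j, F i j k l := by
  simpa only [avg_prod] using avg_swap (fun (x : ι × κ) (y : μ × ν) => F x.1 x.2 y.1 y.2)

/-- Two edges of a cut-uniform graph at a common vertex may be replaced by the density, when the
remaining weight separates that vertex from the other two end points. -/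
theorem CutUniform.replace_star {J : Type*} [Fintype J] [Nonempty J] {R : Y → Z → ℝ} {p ρ : ℝ}
    (h : CutUniform R p ρ) (hp : 0 ≤ p) (hp1 : p ≤ 1) (hR : ∀ y z, |R y z| ≤ 1)
    {φ : J → Y → ℝ} {ψ : J → Z → Z → ℝ} (hφ : ∀ j y, |φ j y| ≤ 1) (hψ : ∀ j a b, |ψ j a b| ≤ 1) :
    𝔼 y, 𝔼 a, 𝔼 b, 𝔼 j, R y a * R y b * (φ j y * ψ j a b)
      ≤ p ^ 2 * (𝔼 a, 𝔼 b, 𝔼 y, 𝔼 j, φ j y * ψ j a b) + 2 * ρ := by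
  have hρ : 0 ≤ ρ := (abs_nonneg _).trans (h (fun _ => 0) (fun _ => 0) (by simp) (by simp))
  have h1 := h.replace (I := Z × J) (φ := fun i y => R y i.1 * φ i.2 y)
    (ψ := fun i a => ψ i.2 a i.1) (fun i y => abs_mul_le_one (hR _ _) (hφ _ _))
    (fun i a => hψ _ _ _)
  have h2 := h.replace (I := Z × J) (φ := fun i y => φ i.2 y)
    (ψ := fun i b => ψ i.2 i.1 b) (fun i y => hφ _ _) (fun i a => hψ _ _ _)
  simp only [avg_prod] at h1 h2
  have e1 : 𝔼 y, 𝔼 a, 𝔼 b, 𝔼 j, R y a * R y b * (φ j y * ψ j a b)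
      = 𝔼 b, 𝔼 j, 𝔼 y, 𝔼 a, R y a * (R y b * φ j y * ψ j a b) := by
    rw [← avg_swap₂₂ fun y a b j => R y a * (R y b * φ j y * ψ j a b)]
    exact avg_congr fun y => avg_congr fun a => avg_congr fun b => avg_congr fun j => by ring
  have e2 : 𝔼 b, 𝔼 j, 𝔼 y, 𝔼 a, R y b * φ j y * ψ j a b
      = 𝔼 a, 𝔼 j, 𝔼 y, 𝔼 b, R y b * (φ j y * ψ j a b) := by
    rw [← avg_swap₂₂ fun y a b j => R y b * φ j y * ψ j a b,
      ← avg_swap₂₂ fun y b a j => R y b * (φ j y * ψ j a b)]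
    refine avg_congr fun y => ?_
    rw [avg_swap]
    exact avg_congr fun b => avg_congr fun a => avg_congr fun j => by ring
  have e3 : 𝔼 a, 𝔼 b, 𝔼 y, 𝔼 j, φ j y * ψ j a b = 𝔼 a, 𝔼 j, 𝔼 y, 𝔼 b, φ j y * ψ j a b := by
    refine avg_congr fun a => ?_
    rw [avg_swap₁₂ fun b y j => φ j y * ψ j a b, avg_swap]
  rw [e1, e3]
  rw [e2] at h1
  have h3 := (abs_le.1 h1).2
  have h4 := (abs_le.1 h2).2
  nlinarith

/-- If the pairwise products of the kernels `b y`, each supported on the square of a random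
neighbourhood, have large four-cycle counts on average, then the `b y` correlate with a single
kernel `P`, up to factors of one variable. The kernel is obtained by fixing two of the four
variables of `Φ`; positivity of the four-cycle count is what allows this without a loss in the
density `r`, because the fixed variables need not be neighbours of `y`. -/
theorem exists_common_kernel {R : Y → Z → ℝ} {r ρ l : ℝ} (h : CutUniform R r ρ) (hr : 0 < r)
    (hr1 : r ≤ 1) (hR01 : ∀ y z, R y z = 0 ∨ R y z = 1) (hl : 0 < l) (hl1 : l ≤ 1)
    (hρ : ρ ≤ l ^ 4 * r ^ 8 / 1024) {b : Y → Z → Z → ℝ}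
    (hb : ∀ y z w, |b y z w| ≤ R y z * R y w)
    (hL : l * r ^ 8 ≤ 𝔼 z, 𝔼 z', 𝔼 w, 𝔼 w',
      (𝔼 y, (b y z w * b y z w') * (b y z' w * b y z' w')) ^ 2) :
    ∃ (P : Z → Z → ℝ) (f g : Y → Z → ℝ), (∀ z w, |P z w| ≤ 1) ∧ (∀ y z, |f y z| ≤ 1) ∧
      (∀ y z, |g y z| ≤ 1) ∧
      l ^ 4 / 512 * r ^ 2 ≤ 𝔼 y, 𝔼 z, 𝔼 w, b y z w * (P z w * (f y z * g y w)) := by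
  have hR0 : ∀ y z, 0 ≤ R y z := fun y z => by rcases hR01 y z with h | h <;> simp [h]
  have hRle : ∀ y z, R y z ≤ 1 := fun y z => by rcases hR01 y z with h | h <;> simp [h]
  have hR1 : ∀ y z, |R y z| ≤ 1 := fun y z => by rcases hR01 y z with h | h <;> simp [h]
  have hb1 : ∀ y z w, |b y z w| ≤ 1 := fun y z w =>
    (hb y z w).trans (mul_le_one₀ (hRle _ _) (hR0 _ _) (hRle _ _))
  have hRb : ∀ y z w, R y z * b y z w = b y z w := by
    intro y z w
    rcases hR01 y z with h | h
    · have := hb y z w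
      rw [h, zero_mul, abs_nonpos_iff] at this
      rw [this, mul_zero]
    · rw [h, one_mul]
  have hRb' : ∀ y z w, R y w * b y z w = b y z w := by
    intro y z w
    rcases hR01 y w with h | h
    · have := hb y z w
      rw [h, mul_zero, abs_nonpos_iff] at this
      rw [this, mul_zero]
    · rw [h, one_mul]
  have hρ0 : 0 ≤ ρ := (avg_nonneg fun _ => abs_nonneg _).trans h.avg_abs_deg
  have hl4 : l ^ 4 ≤ l := by
    calc l ^ 4 ≤ l ^ 1 := pow_le_pow_of_le_one hl.le hl1 (by norm_num)
      _ = l := pow_one l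
  have hl41 : l ^ 4 ≤ 1 := hl4.trans hl1
  have hρk : ∀ k ≤ 8, ρ ≤ l ^ 4 * r ^ k / 1024 := fun k hk =>
    hρ.trans (by
      have := pow_le_pow_of_le_one hr.le hr1 hk
      gcongr)
  have hρk' : ∀ k ≤ 8, ρ ≤ r ^ k / 1024 := fun k hk => (hρk k hk).trans (by
    have : l ^ 4 * r ^ k ≤ 1 * r ^ k := by gcongr
    linarith)
  set Φ : Z → Z → Z → Z → ℝ := fun z z' w w' =>
    𝔼 y, (b y z w * b y z w') * (b y z' w * b y z' w') with hΦ
  set D : Z → Z → Z → Z → ℝ := fun z z' w w' =>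
    𝔼 y, R y w' * (R y w * (R y z' * R y z)) with hD
  have hr4 : 0 < r ^ 4 := by positivity
  set Ψ : Z → Z → Z → Z → ℝ := fun z z' w w' => clip (Φ z z' w w' / r ^ 4) with hΨ
  have hΨ1 : ∀ z z' w w', |Ψ z z' w w'| ≤ 1 := fun _ _ _ _ => abs_clip_le _
  have hΦD : ∀ z z' w w', |Φ z z' w w'| ≤ D z z' w w' := by
    intro z z' w w'
    refine (abs_avg_le _).trans (avg_mono fun y => ?_)
    have e1 : (b y z w * b y z w') * (b y z' w * b y z' w')
        = R y w' * (R y w * (R y z' * R y z)) *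
          ((b y z w * b y z w') * (b y z' w * b y z' w')) := by
      calc _ = (R y z * b y z w) * (R y w' * b y z w') * ((R y w * b y z' w)
            * (R y z' * b y z' w')) := by rw [hRb, hRb', hRb', hRb]
        _ = _ := by ring
    rw [e1, abs_mul, abs_of_nonneg
      (mul_nonneg (hR0 _ _) (mul_nonneg (hR0 _ _) (mul_nonneg (hR0 _ _) (hR0 _ _))))]
    refine mul_le_of_le_one_right
      (mul_nonneg (hR0 _ _) (mul_nonneg (hR0 _ _) (mul_nonneg (hR0 _ _) (hR0 _ _)))) ?_
    exact abs_mul_le_one (abs_mul_le_one (hb1 _ _ _) (hb1 _ _ _))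
      (abs_mul_le_one (hb1 _ _ _) (hb1 _ _ _))
  have hcod := h.avg_abs_codeg₄ hr.le hr1 hR1
  -- Truncating `Φ` at the expected codegree `r ^ 4`.
  have hN1 : l / 2 * r ^ 4 ≤ 𝔼 z, 𝔼 z', 𝔼 w, 𝔼 w', Φ z z' w w' * Ψ z z' w w' := by
    have h1 : 𝔼 z, 𝔼 z', 𝔼 w, 𝔼 w', (Φ z z' w w' ^ 2 - r ^ 4 * (Φ z z' w w' * Ψ z z' w w'))
        ≤ 𝔼 z, 𝔼 z', 𝔼 w, 𝔼 w', |D z z' w w' - r ^ 4| := by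
      refine avg_mono fun z => avg_mono fun z' => avg_mono fun w => avg_mono fun w' => ?_
      have h2 := abs_sub_clip_le (hΦD z z' w w') hr4
      have h3 : |Φ z z' w w'| ≤ 1 := abs_avg_le_one fun y => abs_mul_le_one
        (abs_mul_le_one (hb1 _ _ _) (hb1 _ _ _)) (abs_mul_le_one (hb1 _ _ _) (hb1 _ _ _))
      calc _ = Φ z z' w w' * (Φ z z' w w' - r ^ 4 * Ψ z z' w w') := by ring
        _ ≤ |Φ z z' w w'| * |Φ z z' w w' - r ^ 4 * Ψ z z' w w'| := by
            rw [← abs_mul]; exact le_abs_self _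
        _ ≤ 1 * |D z z' w w' - r ^ 4| := mul_le_mul h3 h2 (abs_nonneg _) zero_le_one
        _ = _ := one_mul _
    simp only [Finset.expect_sub_distrib, ← Finset.mul_expect] at h1
    have h2 := hρk 8 le_rfl
    have h3 : l ^ 4 * r ^ 8 ≤ l * r ^ 8 := by gcongr
    refine le_of_mul_le_mul_left ?_ hr4
    have h4 : r ^ 4 * (l / 2 * r ^ 4) = l / 2 * r ^ 8 := by ring
    rw [h4]
    linarith
  -- The two steps below remove `b y z w' * b y z' w'` and then `b y z' w`.
  set c : Z × Z → Y → Z → Z → ℝ := fun j y z w => b y z w * Ψ z j.1 w j.2 with hc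
  have hc1 : ∀ j y z w, |c j y z w| ≤ 1 := fun j y z w => abs_mul_le_one (hb1 _ _ _) (hΨ1 _ _ _ _)
  set X : Y → Z × Z → Z → ℝ := fun y j z => 𝔼 w, b y j.1 w * c j y z w with hX
  set W : Y → Z × Z → ℝ := fun y j => R y j.1 * R y j.2 with hW
  have hW2 : ∀ y j, W y j ^ 2 = W y j := fun y j => by
    simp only [hW]; rcases hR01 y j.1 with h | h <;> rcases hR01 y j.2 with h' | h' <;> simp [h, h']
  have hb2 : ∀ y z w, b y z w ^ 2 ≤ 1 := fun y z w => (sq_le_one_iff_abs_le_one _).2 (hb1 _ _ _)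
  have eN1 : 𝔼 z, 𝔼 z', 𝔼 w, 𝔼 w', Φ z z' w w' * Ψ z z' w w'
      = 𝔼 y, 𝔼 j : Z × Z, 𝔼 z, (b y z j.2 * b y j.1 j.2) * (W y j * X y j z) := by
    have e1 : ∀ z z' w w', Φ z z' w w' * Ψ z z' w w'
        = 𝔼 y, (b y z w' * b y z' w') * (W y (z', w') * (b y z' w * c (z', w') y z w)) := by
      intro z z' w w'
      simp only [hΦ, Finset.expect_mul]
      refine avg_congr fun y => ?_
      calc _ = b y z w * b y z' w * Ψ z z' w w' * (R y w' * b y z w') * (R y z' * b y z' w') := by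
            rw [hRb, hRb']; ring
        _ = _ := by simp only [hW, hc]; ring
    simp only [e1, hX, Finset.mul_expect, avg_prod]
    have e2 : ∀ F : Z → Z → Z → Z → Y → ℝ, 𝔼 z, 𝔼 z', 𝔼 w, 𝔼 w', 𝔼 y, F z z' w w' y
        = 𝔼 y, 𝔼 z', 𝔼 w', 𝔼 z, 𝔼 w, F z z' w w' y := by
      intro F
      rw [avg_swap₁₂ fun y z' w' => 𝔼 z, 𝔼 w, F z z' w w' y, avg_swap]
      exact avg_congr fun z' => avg_swap₂₂ fun z w w' y => F z z' w w' y
    exact e2 fun z z' w w' y =>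
      (b y z w' * b y z' w') * (W y (z', w') * (b y z' w * c (z', w') y z w))
  have hcod3 := h.avg_abs_codeg₃ hr.le hr1 hR1
  have hN2 : l ^ 2 / 8 * r ^ 5 ≤ 𝔼 y, 𝔼 j, 𝔼 z, W y j * X y j z ^ 2 := by
    have h1 := avg_cauchy₃ (fun (y : Y) (j : Z × Z) z => b y z j.2 * b y j.1 j.2)
      (fun y j z => W y j * X y j z)
    rw [← eN1] at h1
    have h2 : 𝔼 y, 𝔼 j : Z × Z, 𝔼 z, (b y z j.2 * b y j.1 j.2) ^ 2 ≤ 2 * r ^ 3 := by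
      have h3 : 𝔼 y, 𝔼 j : Z × Z, 𝔼 z, (b y z j.2 * b y j.1 j.2) ^ 2
          ≤ 𝔼 y, 𝔼 j : Z × Z, 𝔼 z, R y z * (R y j.2 * R y j.1) := by
        refine avg_mono fun y => avg_mono fun j => avg_mono fun z => ?_
        rw [← hRb y z, ← hRb' y j.1, ← hRb y j.1]
        have h4 : (R y z * b y z j.2 * (R y j.2 * (R y j.1 * b y j.1 j.2))) ^ 2
            = (R y z * (R y j.2 * R y j.1)) ^ 2 * (b y z j.2 ^ 2 * b y j.1 j.2 ^ 2) := by ring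
        have h5 : (R y z * (R y j.2 * R y j.1)) ^ 2 = R y z * (R y j.2 * R y j.1) := by
          rcases hR01 y z with h | h <;> rcases hR01 y j.1 with h' | h' <;>
            rcases hR01 y j.2 with h'' | h'' <;> simp [h, h', h'']
        rw [h4, h5]
        exact mul_le_of_le_one_right (mul_nonneg (hR0 _ _) (mul_nonneg (hR0 _ _) (hR0 _ _)))
          (mul_le_one₀ (hb2 _ _ _) (sq_nonneg _) (hb2 _ _ _))
      have h4 : 𝔼 y, 𝔼 j : Z × Z, 𝔼 z, R y z * (R y j.2 * R y j.1)
          = 𝔼 x : Z × Z × Z, 𝔼 y, R y x.2.2 * (R y x.2.1 * R y x.1) := by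
        simp only [avg_prod]
        rw [avg_swap₁₂ fun y z' w' => 𝔼 z, R y z * (R y w' * R y z')]
        exact avg_congr fun z' => avg_congr fun w' => avg_swap _
      have h5 := avg_le_of_avg_abs_sub_le (f := fun x : Z × Z × Z =>
        𝔼 y, R y x.2.2 * (R y x.2.1 * R y x.1)) (c := r ^ 3) (d := 3 * ρ)
        (by simpa only [avg_prod] using hcod3)
      have h6 := hρk' 3 (by norm_num)
      have : 0 < r ^ 3 := by positivity
      linarith
    simp only [mul_pow, hW2] at h1 h2 ⊢
    have h3 : (l / 2 * r ^ 4) ^ 2 ≤ (𝔼 z, 𝔼 z', 𝔼 w, 𝔼 w', Φ z z' w w' * Ψ z z' w w') ^ 2 :=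
      pow_le_pow_left₀ (by positivity) hN1 2
    have h4 : 0 ≤ 𝔼 y, 𝔼 j, 𝔼 z, W y j * X y j z ^ 2 :=
      avg_nonneg fun y => avg_nonneg fun j => avg_nonneg fun z =>
        mul_nonneg (mul_nonneg (hR0 _ _) (hR0 _ _)) (sq_nonneg _)
    have h5 := mul_le_mul_of_nonneg_right h2 h4
    have h6 : 2 * r ^ 3 * (l ^ 2 / 8 * r ^ 5) = (l / 2 * r ^ 4) ^ 2 := by ring
    refine le_of_mul_le_mul_left (a := 2 * r ^ 3) ?_ (by positivity)
    linarith
  set V : Y → Z × Z → Z → Z → ℝ := fun y j w₁ w₂ => 𝔼 z, c j y z w₁ * c j y z w₂ with hV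
  have eN2 : 𝔼 y, 𝔼 j, 𝔼 z, W y j * X y j z ^ 2
      = 𝔼 y, 𝔼 j : Z × Z, 𝔼 w₁, 𝔼 w₂, (b y j.1 w₁ * b y j.1 w₂) * (W y j * V y j w₁ w₂) := by
    refine avg_congr fun y => avg_congr fun j => ?_
    rw [← Finset.mul_expect]
    simp only [hX]
    rw [avg_row_sq]
    simp only [hV, Finset.mul_expect]
    exact avg_congr fun w₁ => avg_congr fun w₂ => avg_congr fun z => by ring
  have hN3 : l ^ 4 / 128 * r ^ 6 ≤ 𝔼 y, 𝔼 j, 𝔼 w₁, 𝔼 w₂, W y j * V y j w₁ w₂ ^ 2 := by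
    have h1 := avg_cauchy₄ (fun (y : Y) (j : Z × Z) w₁ w₂ => W y j * (b y j.1 w₁ * b y j.1 w₂))
      (fun y j w₁ w₂ => W y j * V y j w₁ w₂)
    have e : ∀ y j w₁ w₂, W y j * (b y j.1 w₁ * b y j.1 w₂) * (W y j * V y j w₁ w₂)
        = (b y j.1 w₁ * b y j.1 w₂) * (W y j * V y j w₁ w₂) := by
      intro y j w₁ w₂
      calc _ = W y j ^ 2 * ((b y j.1 w₁ * b y j.1 w₂) * V y j w₁ w₂) := by ring
        _ = _ := by rw [hW2]; ring
    simp only [e] at h1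
    rw [← eN2] at h1
    have h2 : 𝔼 y, 𝔼 j, 𝔼 w₁, 𝔼 w₂, (W y j * (b y j.1 w₁ * b y j.1 w₂)) ^ 2 ≤ 2 * r ^ 4 := by
      have h3 : 𝔼 y, 𝔼 j, 𝔼 w₁, 𝔼 w₂, (W y j * (b y j.1 w₁ * b y j.1 w₂)) ^ 2
          ≤ 𝔼 y, 𝔼 j : Z × Z, 𝔼 w₁, 𝔼 w₂, R y w₂ * (R y w₁ * (R y j.2 * R y j.1)) := by
        refine avg_mono fun y => avg_mono fun j => avg_mono fun w₁ => avg_mono fun w₂ => ?_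
        rw [← hRb' y j.1 w₁, ← hRb' y j.1 w₂]
        have h4 : (W y j * (R y w₁ * b y j.1 w₁ * (R y w₂ * b y j.1 w₂))) ^ 2
            = (R y w₂ * (R y w₁ * (R y j.2 * R y j.1))) ^ 2
              * (b y j.1 w₁ ^ 2 * b y j.1 w₂ ^ 2) := by simp only [hW]; ring
        have h5 : (R y w₂ * (R y w₁ * (R y j.2 * R y j.1))) ^ 2
            = R y w₂ * (R y w₁ * (R y j.2 * R y j.1)) := by
          rcases hR01 y w₁ with h | h <;> rcases hR01 y j.1 with h' | h' <;>
            rcases hR01 y j.2 with h'' | h'' <;> rcases hR01 y w₂ with h3 | h3 <;>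
            simp [h, h', h'', h3]
        rw [h4, h5]
        exact mul_le_of_le_one_right
          (mul_nonneg (hR0 _ _) (mul_nonneg (hR0 _ _) (mul_nonneg (hR0 _ _) (hR0 _ _))))
          (mul_le_one₀ (hb2 _ _ _) (sq_nonneg _) (hb2 _ _ _))
      have h4 : 𝔼 y, 𝔼 j : Z × Z, 𝔼 w₁, 𝔼 w₂, R y w₂ * (R y w₁ * (R y j.2 * R y j.1))
          = 𝔼 x : Z × Z × Z × Z, 𝔼 y,
            R y x.2.2.2 * (R y x.2.2.1 * (R y x.2.1 * R y x.1)) := by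
        simp only [avg_prod]
        rw [avg_swap₁₂ fun y z' w' => 𝔼 w₁, 𝔼 w₂, R y w₂ * (R y w₁ * (R y w' * R y z'))]
        exact avg_congr fun z' => avg_congr fun w' => avg_swap₁₂ _
      have h5 := avg_le_of_avg_abs_sub_le (f := fun x : Z × Z × Z × Z =>
        𝔼 y, R y x.2.2.2 * (R y x.2.2.1 * (R y x.2.1 * R y x.1))) (c := r ^ 4) (d := 4 * ρ)
        (by simpa only [avg_prod] using hcod)
      have h6 := hρk' 4 (by norm_num)
      linarith
    have e3 : ∀ y j w₁ w₂, (W y j * V y j w₁ w₂) ^ 2 = W y j * V y j w₁ w₂ ^ 2 := by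
      intro y j w₁ w₂; rw [mul_pow, hW2]
    simp only [e3] at h1
    have h3 : (l ^ 2 / 8 * r ^ 5) ^ 2 ≤ (𝔼 y, 𝔼 j, 𝔼 z, W y j * X y j z ^ 2) ^ 2 :=
      pow_le_pow_left₀ (by positivity) hN2 2
    have h4 : 0 ≤ 𝔼 y, 𝔼 j, 𝔼 w₁, 𝔼 w₂, W y j * V y j w₁ w₂ ^ 2 :=
      avg_nonneg fun y => avg_nonneg fun j => avg_nonneg fun z => avg_nonneg fun w =>
        mul_nonneg (mul_nonneg (hR0 _ _) (hR0 _ _)) (sq_nonneg _)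
    have h5 := mul_le_mul_of_nonneg_right h2 h4
    have h6 : 2 * r ^ 4 * (l ^ 4 / 128 * r ^ 6) = (l ^ 2 / 8 * r ^ 5) ^ 2 := by ring
    refine le_of_mul_le_mul_left (a := 2 * r ^ 4) ?_ (by positivity)
    linarith
  -- The vertices `z', w'` no longer meet `b`, so their adjacency to `y` may be dropped.
  have hN4 : l ^ 4 / 256 * r ^ 4 ≤ 𝔼 z', 𝔼 w', 𝔼 y, 𝔼 w₁, 𝔼 w₂, V y (z', w') w₁ w₂ ^ 2 := by
    have h1 := h.replace_star (J := Z × Z × Z × Z) hr.le hr1 hR1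
      (φ := fun i y => (b y i.2.2.1 i.1 * b y i.2.2.1 i.2.1)
        * (b y i.2.2.2 i.1 * b y i.2.2.2 i.2.1))
      (ψ := fun i z' w' => (Ψ i.2.2.1 z' i.1 w' * Ψ i.2.2.1 z' i.2.1 w')
        * (Ψ i.2.2.2 z' i.1 w' * Ψ i.2.2.2 z' i.2.1 w'))
      (fun i y => abs_mul_le_one (abs_mul_le_one (hb1 _ _ _) (hb1 _ _ _))
        (abs_mul_le_one (hb1 _ _ _) (hb1 _ _ _)))
      (fun i a b => abs_mul_le_one (abs_mul_le_one (hΨ1 _ _ _ _) (hΨ1 _ _ _ _))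
        (abs_mul_le_one (hΨ1 _ _ _ _) (hΨ1 _ _ _ _)))
    have e1 : ∀ y z' w', 𝔼 w₁, 𝔼 w₂, V y (z', w') w₁ w₂ ^ 2
        = 𝔼 i : Z × Z × Z × Z, (b y i.2.2.1 i.1 * b y i.2.2.1 i.2.1)
        * (b y i.2.2.2 i.1 * b y i.2.2.2 i.2.1)
        * ((Ψ i.2.2.1 z' i.1 w' * Ψ i.2.2.1 z' i.2.1 w')
        * (Ψ i.2.2.2 z' i.1 w' * Ψ i.2.2.2 z' i.2.1 w')) := by
      intro y z' w'
      simp only [avg_prod, hV]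
      refine avg_congr fun w₁ => avg_congr fun w₂ => ?_
      rw [avg_sq_eq]
      exact avg_congr fun z₁ => avg_congr fun z₂ => by simp only [hc]; ring
    simp only [← Finset.mul_expect, ← e1] at h1
    have e2 : 𝔼 y, 𝔼 j, 𝔼 w₁, 𝔼 w₂, W y j * V y j w₁ w₂ ^ 2
        = 𝔼 y, 𝔼 z', 𝔼 w', R y z' * R y w' * 𝔼 w₁, 𝔼 w₂, V y (z', w') w₁ w₂ ^ 2 := by
      refine avg_congr fun y => ?_
      rw [avg_prod]
      simp only [Finset.mul_expect, hW]
    rw [e2] at hN3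
    have h2 := hρk 6 (by norm_num)
    have h3 : r ^ 2 * (l ^ 4 / 256 * r ^ 4) = l ^ 4 / 256 * r ^ 6 := by ring
    refine le_of_mul_le_mul_left (a := r ^ 2) ?_ (by positivity)
    have : 0 ≤ l ^ 4 * r ^ 6 := by positivity
    linarith
  obtain ⟨z', h1⟩ := exists_avg_le fun z' => 𝔼 w', 𝔼 y, 𝔼 w₁, 𝔼 w₂, V y (z', w') w₁ w₂ ^ 2
  obtain ⟨w', h2⟩ := exists_avg_le fun w' => 𝔼 y, 𝔼 w₁, 𝔼 w₂, V y (z', w') w₁ w₂ ^ 2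
  replace hN4 := (hN4.trans h1).trans h2
  clear h1 h2
  set c' : Y → Z → Z → ℝ := c (z', w') with hc'
  have hc'1 : ∀ y z w, |c' y z w| ≤ 1 := hc1 _
  have hcR : ∀ y z w, R y z * R y w * c' y z w = c' y z w := by
    intro y z w
    simp only [hc', hc]
    calc _ = R y z * (R y w * b y z w) * Ψ z z' w w' := by ring
      _ = _ := by rw [hRb', hRb]
  -- Two more vertices are chosen separately for each `y`, at the correct cost `r ^ 2`.
  set Q : Y → Z × Z → ℝ := fun y j => 𝔼 z, 𝔼 w, c' y z w * (c' y z j.2 * (c' y j.1 j.2 * c' y j.1 w))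
    with hQ
  have hQ1 : ∀ y j, |Q y j| ≤ 1 := fun y j => abs_avg_le_one fun z => abs_avg_le_one fun w =>
    abs_mul_le_one (hc'1 _ _ _) (abs_mul_le_one (hc'1 _ _ _)
      (abs_mul_le_one (hc'1 _ _ _) (hc'1 _ _ _)))
  have eN4 : 𝔼 y, 𝔼 w₁, 𝔼 w₂, V y (z', w') w₁ w₂ ^ 2
      = 𝔼 y, 𝔼 j : Z × Z, R y j.1 * R y j.2 * Q y j := by
    refine avg_congr fun y => ?_
    have e : ∀ F : Z → Z → Z → Z → ℝ,
        𝔼 w, 𝔼 w₂, 𝔼 z, 𝔼 z₂, F w w₂ z z₂ = 𝔼 z₂, 𝔼 w₂, 𝔼 z, 𝔼 w, F w w₂ z z₂ := by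
      intro F
      rw [avg_swap, avg_swap (fun z₂ w₂ => 𝔼 z, 𝔼 w, F w w₂ z z₂)]
      refine avg_congr fun w₂ => ?_
      rw [avg_swap₁₂, avg_swap]
    simp only [hV, avg_sq_eq, avg_prod, hQ, Finset.mul_expect]
    rw [e]
    refine avg_congr fun z₂ => avg_congr fun w₂ => avg_congr fun z => avg_congr fun w => ?_
    calc _ = c' y z w * (c' y z w₂ * (c' y z₂ w₂ * c' y z₂ w)) := by simp only [hc']; ring
      _ = c' y z w * (c' y z w₂ * (R y z₂ * R y w₂ * c' y z₂ w₂ * c' y z₂ w)) := by rw [hcR]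
      _ = _ := by ring
  obtain ⟨g, hg⟩ := exists_choice (w := fun y (j : Z × Z) => R y j.1 * R y j.2) (c := r ^ 2)
    (fun y j => mul_nonneg (hR0 _ _) (hR0 _ _)) hQ1
  have hdeg := h.symm.avg_abs_deg_sq hr.le hr1 (fun z y => hR0 y z) (fun z y => hRle y z)
  simp only [avg_prod (ι := Z) (κ := Z)] at hg
  have hfin : l ^ 4 / 512 * r ^ 2 ≤ 𝔼 y, |Q y (g y)| := by
    simp only [eN4, avg_prod] at hN4
    have h2 := hρk 4 (by norm_num)
    refine le_of_mul_le_mul_left (a := r ^ 2) ?_ (by positivity)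
    have : r ^ 2 * (l ^ 4 / 512 * r ^ 2) = l ^ 4 / 512 * r ^ 4 := by ring
    linarith
  obtain ⟨σ, hσ, hσ'⟩ := exists_sign fun y => Q y (g y)
  refine ⟨fun z w => Ψ z z' w w', fun y z => σ y * (c' y z (g y).2 *
    c' y (g y).1 (g y).2), fun y w => c' y (g y).1 w, fun _ _ => hΨ1 _ _ _ _, fun y z =>
    abs_mul_le_one (hσ _) (abs_mul_le_one (hc'1 _ _ _) (hc'1 _ _ _)),
    fun y w => hc'1 _ _ _, hfin.trans (le_of_eq ?_)⟩
  refine avg_congr fun y => ?_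
  rw [hσ']
  simp only [hQ, Finset.mul_expect]
  exact avg_congr fun z => avg_congr fun w => by simp only [hc', hc]; ring

end Star

/-! ### Truncated weighted degrees -/

namespace Fibre

variable {S U V : Type*} [Fintype S] [Fintype U] [Fintype V] [Nonempty S] [Nonempty U] [Nonempty V]
  {A : S → U → ℝ} {B : S → V → ℝ} {R : U → V → ℝ} {t : S → U → V → ℝ} {α β ϖ k e ζ : ℝ}

theorem avg_sq_le_of_abs_le (h : Fibre A B R t α β ϖ k e ζ) {a : S → U → ℝ}
    (ha : ∀ s u, |a s u| ≤ A s u) : 𝔼 s, 𝔼 u, a s u ^ 2 ≤ 2 * α := by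
  have h1 : 𝔼 s, 𝔼 u, a s u ^ 2 ≤ 𝔼 s, 𝔼 u, A s u := by
    refine avg_mono fun s => avg_mono fun u => ?_
    rw [← sq_abs]
    rcases h.A01 s u with h' | h'
    · have := ha s u
      rw [h'] at this ⊢
      rw [le_antisymm this (abs_nonneg _)]; norm_num
    · rw [h']
      exact pow_le_one₀ (abs_nonneg _) ((ha s u).trans h'.le)
  have h2 := h.avg_A_le
  have h3 : e ^ 4 * α ≤ 1 * α :=
    mul_le_mul_of_nonneg_right (pow_le_one₀ h.e_pos.le (by linarith [h.e_le])) h.α_pos.le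
  linarith

/-- Removing a weight `a` of one variable by the Cauchy–Schwarz inequality. -/
theorem avg_sq_ge_of_correlation (h : Fibre A B R t α β ϖ k e ζ) {a N : S → U → ℝ}
    (ha : ∀ s u, |a s u| ≤ A s u) {l : ℝ} (hl : 0 ≤ l)
    (hL : l * (k * ϖ * α * β) ≤ 𝔼 s, 𝔼 u, a s u * N s u) :
    l ^ 2 / 2 * ((k * ϖ) ^ 2 * α * β ^ 2) ≤ 𝔼 s, 𝔼 u, N s u ^ 2 := by
  have h1 := avg_cauchy₂ a N
  have h2 := h.avg_sq_le_of_abs_le ha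
  have h4 : 0 ≤ 𝔼 s, 𝔼 u, N s u ^ 2 := avg_nonneg fun _ => avg_nonneg fun _ => sq_nonneg _
  have hα := h.α_pos
  have hτ := h.τ_pos
  have hβ := h.β_pos
  have h0 : 0 ≤ l * (k * ϖ * α * β) := by positivity
  have h5 := pow_le_pow_left₀ h0 hL 2
  have h6 := mul_le_mul_of_nonneg_right h2 h4
  refine le_of_mul_le_mul_left (a := 2 * α) ?_ (by positivity)
  have h7 : 2 * α * (l ^ 2 / 2 * ((k * ϖ) ^ 2 * α * β ^ 2)) = (l * (k * ϖ * α * β)) ^ 2 := by ring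
  linarith

theorem eq_zero_of_B (h : Fibre A B R t α β ϖ k e ζ) {m : S → U → V → ℝ}
    (hm : ∀ s u v, |m s u v| ≤ t s u v) (a : S → U → ℝ) {s v} (hB : B s v = 0) :
    𝔼 u, m s u v * a s u = 0 := by
  have : ∀ u, m s u v * a s u = 0 := by
    intro u
    have h1 := (hm s u v).trans (h.t_le_B s u v)
    rw [hB] at h1
    rw [abs_nonpos_iff.1 h1, zero_mul]
  simp only [this, Finset.expect_const_zero]

theorem abs_side_le (h : Fibre A B R t α β ϖ k e ζ) {m : S → U → V → ℝ}
    (hm : ∀ s u v, |m s u v| ≤ t s u v) (a : S → U → ℝ) (s v) :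
    |clip ((𝔼 u, m s u v * a s u) / (k * ϖ * α))| ≤ B s v := by
  rcases h.B01 s v with h' | h'
  · rw [h', h.eq_zero_of_B hm a h', zero_div, clip_zero, abs_zero]
  · rw [h']; exact abs_clip_le _

/-- A large four-cycle count yields a weight `b` on `V`, given explicitly by truncated weighted
degrees into `U`, for which the Gram kernel correlates with `b s v * b s w`. -/
theorem exists_side (h : Fibre A B R t α β ϖ k e ζ) {m : S → U → V → ℝ}
    (hm : ∀ s u v, |m s u v| ≤ t s u v) {l : ℝ} (hl : 0 < l)
    (hl1 : l ≤ 1) (hel : 64 * e ≤ k * l ^ 2)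
    (hL : l * (((k * ϖ) ^ 2 * α) ^ 2 * β ^ 2)
      ≤ 𝔼 s, 𝔼 v, 𝔼 w, (𝔼 u, m s u v * m s u w) ^ 2) :
    ∃ a : S → U → ℝ, (∀ s u, |a s u| ≤ A s u) ∧
      l ^ 8 / 2 ^ 23 * ((k * ϖ) ^ 2 * α * β ^ 2) ≤ 𝔼 s, 𝔼 v, 𝔼 w,
        (clip ((𝔼 u, m s u v * a s u) / (k * ϖ * α)) *
          clip ((𝔼 u, m s u w * a s u) / (k * ϖ * α))) * 𝔼 u, m s u v * m s u w := by
  obtain ⟨a, b₀, ha, hb₀, hc⟩ := h.exists_correlation hm hm hl hl1 hel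
    (by simpa only [sq (𝔼 u, m _ u _ * m _ u _)] using hL)
  refine ⟨a, ha, ?_⟩
  have hB := h.avg_B_le
  have hα := h.α_pos
  have hβ := h.β_pos
  have hτ := h.τ_pos
  set c := k * ϖ * α with hcdef
  have hcp : 0 < c := by positivity
  set D : S → V → ℝ := fun s v => 𝔼 u, m s u v * a s u with hD
  set θ := l ^ 2 / 64 with hθ
  have hl2 : l ^ 2 ≤ 1 := pow_le_one₀ hl.le hl1
  have h1 : l ^ 2 / 32 * (c * β) ≤ 𝔼 s, 𝔼 v, |D s v| := by
    refine hc.trans (avg_mono fun s => ?_)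
    rw [avg_swap]
    refine avg_mono fun v => ?_
    have : 𝔼 u, m s u v * (a s u * b₀ s v) = D s v * b₀ s v := by
      simp only [hD, Finset.expect_mul]; exact avg_congr fun u => by ring
    rw [this]
    refine (le_abs_self _).trans ?_
    rw [abs_mul]
    exact mul_le_of_le_one_right (abs_nonneg _) ((hb₀ s v).trans (h.B_le_one s v))
  have h2 : 𝔼 s, 𝔼 v, (2 * θ * |D s v| - θ ^ 2 * c * B s v)
      ≤ 𝔼 s, 𝔼 v, D s v * clip (D s v / c) := by
    refine avg_mono fun s => avg_mono fun v => ?_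
    rcases h.B01 s v with h' | h'
    · have : D s v = 0 := h.eq_zero_of_B hm a h'
      rw [h', this]; simp
    · rw [h', mul_one]; exact le_mul_clip hcp (by rw [hθ]; linarith)
  simp only [Finset.expect_sub_distrib, ← Finset.mul_expect] at h2
  have h3 : l ^ 4 / 2 ^ 11 * (k * ϖ * α * β)
      ≤ 𝔼 s, 𝔼 u, a s u * 𝔼 v, m s u v * clip (D s v / c) := by
    have e1 : 𝔼 s, 𝔼 u, a s u * 𝔼 v, m s u v * clip (D s v / c)
        = 𝔼 s, 𝔼 v, D s v * clip (D s v / c) := by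
      refine avg_congr fun s => ?_
      simp only [Finset.mul_expect]
      rw [avg_swap]
      refine avg_congr fun v => ?_
      generalize clip (D s v / c) = x
      simp only [hD, Finset.expect_mul]
      exact avg_congr fun u => by ring
    rw [e1]
    have h4 := mul_le_mul_of_nonneg_left h1 (show 0 ≤ 2 * θ by positivity)
    have h5 := mul_le_mul_of_nonneg_left hB (show 0 ≤ θ ^ 2 * c by positivity)
    have h6 : e ^ 4 ≤ 1 := pow_le_one₀ h.e_pos.le (by linarith [h.e_le])
    have h7 : e ^ 4 * (θ ^ 2 * c * β) ≤ 1 * (θ ^ 2 * c * β) := by gcongr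
    have h8 : 2 * θ * (l ^ 2 / 32 * (c * β)) - 2 * (θ ^ 2 * c * β)
      = l ^ 4 / 2 ^ 11 * (c * β) := by rw [hθ]; ring
    rw [← hcdef]
    linarith
  have h4 := h.avg_sq_ge_of_correlation ha (by positivity) h3
  simp only [avg_row_sq] at h4
  have e2 : l ^ 8 / 2 ^ 23 = (l ^ 4 / 2 ^ 11) ^ 2 / 2 := by ring
  rw [e2]
  refine h4.trans (le_of_eq ?_)
  refine avg_congr fun s => avg_congr fun v => avg_congr fun w => ?_
  rw [Finset.mul_expect]
  exact avg_congr fun u => by ring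

/-- The truncation of the weighted degrees costs little, since the degrees of `t` are concentrated. -/
theorem avg_abs_side_sub_le (h : Fibre A B R t α β ϖ k e ζ) {m : S → U → V → ℝ}
    (hm : ∀ s u v, |m s u v| ≤ t s u v) {a : S → U → ℝ} (ha : ∀ s u, |a s u| ≤ A s u) :
    𝔼 s, 𝔼 v, |(𝔼 u, m s u v * a s u)
        - k * ϖ * α * clip ((𝔼 u, m s u v * a s u) / (k * ϖ * α))|
      ≤ 3 * e ^ 2 * (k * ϖ * α * β) := by
  have hB := h.avg_B_le
  have hα := h.α_pos
  have hβ := h.β_pos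
  have hτ := h.τ_pos
  have hvar := h.swap.variance_deg
  set c := k * ϖ * α with hcdef
  have hcp : 0 < c := by positivity
  have h1 : 𝔼 s, 𝔼 v, |(𝔼 u, m s u v * a s u) - c * clip ((𝔼 u, m s u v * a s u) / c)|
      ≤ 𝔼 s, 𝔼 v, B s v * |(𝔼 u, t s u v) - c| := by
    refine avg_mono fun s => avg_mono fun v => ?_
    rcases h.B01 s v with h' | h'
    · rw [h.eq_zero_of_B hm a h', h']; simp
    · rw [h', one_mul]
      refine abs_sub_clip_le ((abs_avg_le _).trans (avg_mono fun u => ?_)) hcp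
      rw [abs_mul]
      exact (mul_le_of_le_one_right (abs_nonneg _) ((ha s u).trans (h.A_le_one s u))).trans
        (hm s u v)
  refine h1.trans ?_
  have h2 := avg_cauchy₂ B (fun s v => B s v * |(𝔼 u, t s u v) - c|)
  have hB2 : ∀ s v, B s v ^ 2 = B s v := fun s v => by
    rcases h.B01 s v with h' | h' <;> simp [h']
  have e1 : ∀ s v, B s v * (B s v * |(𝔼 u, t s u v) - c|) = B s v * |(𝔼 u, t s u v) - c| := by
    intro s v; rw [← mul_assoc, ← sq, hB2]
  simp only [mul_pow, sq_abs, hB2, e1] at h2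
  refine le_of_sq_le_sq (h2.trans ?_) (by have := h.e_pos; positivity)
  have h6 : e ^ 4 ≤ 1 := pow_le_one₀ h.e_pos.le (by linarith [h.e_le])
  calc _ ≤ ((1 + e ^ 4) * β) * (4 * e ^ 4 * ((k * ϖ) ^ 2 * β * α ^ 2)) :=
        mul_le_mul hB hvar (avg_nonneg fun s => avg_nonneg fun v =>
          mul_nonneg (h.B_nonneg s v) (sq_nonneg _)) (by positivity)
    _ ≤ ((1 + 1) * β) * (4 * e ^ 4 * ((k * ϖ) ^ 2 * β * α ^ 2)) := by
        have := h.e_pos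
        gcongr
    _ ≤ _ := by
        have h7 : 0 ≤ e ^ 4 * (β ^ 2 * c ^ 2) := by have := h.e_pos; positivity
        have e3 : ((1 + 1) * β) * (4 * e ^ 4 * ((k * ϖ) ^ 2 * β * α ^ 2))
          = 8 * (e ^ 4 * (β ^ 2 * c ^ 2)) := by rw [hcdef]; ring
        have e4 : (3 * e ^ 2 * (c * β)) ^ 2 = 9 * (e ^ 4 * (β ^ 2 * c ^ 2)) := by ring
        rw [e3, e4]; linarith

/-- If the truncated weighted degrees correlate with `ω`, then so does `m` itself, on average over
the rows. -/
theorem avg_row_sq_ge_of_side (h : Fibre A B R t α β ϖ k e ζ) {m : S → U → V → ℝ}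
    (hm : ∀ s u v, |m s u v| ≤ t s u v) {a : S → U → ℝ} (ha : ∀ s u, |a s u| ≤ A s u)
    {ω : S → V → ℝ} (hω : ∀ s v, |ω s v| ≤ 1) {l : ℝ} (hl : 0 ≤ l) (hel : 6 * e ^ 2 ≤ l)
    (hL : l * β ≤ 𝔼 s, 𝔼 v, clip ((𝔼 u, m s u v * a s u) / (k * ϖ * α)) * ω s v) :
    l ^ 2 / 8 * ((k * ϖ) ^ 2 * α * β ^ 2) ≤ 𝔼 s, 𝔼 u, (𝔼 v, m s u v * ω s v) ^ 2 := by
  have herr := h.avg_abs_side_sub_le hm ha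
  have hα := h.α_pos
  have hβ := h.β_pos
  have hτ := h.τ_pos
  have h1 : l / 2 * (k * ϖ * α * β) ≤ 𝔼 s, 𝔼 u, a s u * 𝔼 v, m s u v * ω s v := by
    set c := k * ϖ * α with hcdef
    have hcp : 0 < c := by positivity
    have e1 : 𝔼 s, 𝔼 u, a s u * 𝔼 v, m s u v * ω s v
        = 𝔼 s, 𝔼 v, (𝔼 u, m s u v * a s u) * ω s v := by
      refine avg_congr fun s => ?_
      simp only [Finset.mul_expect, Finset.expect_mul]
      rw [avg_swap]
      exact avg_congr fun v => avg_congr fun u => by ring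
    have h2 : 𝔼 s, 𝔼 v, (c * (clip ((𝔼 u, m s u v * a s u) / c) * ω s v)
          - (𝔼 u, m s u v * a s u) * ω s v)
        ≤ 𝔼 s, 𝔼 v, |(𝔼 u, m s u v * a s u) - c * clip ((𝔼 u, m s u v * a s u) / c)| := by
      refine avg_mono fun s => avg_mono fun v => ?_
      generalize (𝔼 u, m s u v * a s u) = x
      calc _ = (x - c * clip (x / c)) * (- ω s v) := by ring
        _ ≤ |x - c * clip (x / c)| * |(- ω s v)| := by rw [← abs_mul]; exact le_abs_self _
        _ ≤ _ := mul_le_of_le_one_right (abs_nonneg _) (by rw [abs_neg]; exact hω s v)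
    simp only [Finset.expect_sub_distrib, ← Finset.mul_expect] at h2
    rw [e1]
    have h3 := mul_le_mul_of_nonneg_left hL hcp.le
    have h4 := mul_le_mul_of_nonneg_right hel (show 0 ≤ c * β / 2 by positivity)
    linarith
  have h2 := h.avg_sq_ge_of_correlation ha (by positivity) h1
  have e2 : (l / 2) ^ 2 / 2 = l ^ 2 / 8 := by ring
  rwa [e2] at h2

/-- If the Gram kernel of `m` correlates with a bounded kernel `θ`, then the Gram kernel of `θ` is
large in mean square. -/
theorem gram_kernel_sq_ge (h : Fibre A B R t α β ϖ k e ζ) {m : S → U → V → ℝ}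
    (hm : ∀ s u v, |m s u v| ≤ t s u v) {θ : S → V → V → ℝ}
    (hθ : ∀ s v w, |θ s v w| ≤ B s v * B s w) {l : ℝ} (hl : 0 ≤ l)
    (hel : 16 * e ≤ k * l ^ 2)
    (hL : l * ((k * ϖ) ^ 2 * α * β ^ 2)
      ≤ 𝔼 s, 𝔼 v, 𝔼 w, θ s v w * 𝔼 u, m s u v * m s u w) :
    l ^ 4 / 8 * β ^ 4 ≤ 𝔼 s, 𝔼 v, 𝔼 w, (𝔼 x, θ s x v * θ s x w) ^ 2 := by
  have h1 := h.kernel_square_ge hm hθ hl hel hL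
  have hcount := h.count4
  have hα := h.α_pos
  have hβ := h.β_pos
  have hτ := h.τ_pos
  set c := (k * ϖ) ^ 2 * α with hcdef
  have hcp : 0 < c := by positivity
  have e1 : 𝔼 s, 𝔼 u, 𝔼 v, (𝔼 w, m s u w * θ s v w) ^ 2
      = 𝔼 s, 𝔼 v, 𝔼 w, (𝔼 u, m s u v * m s u w) * 𝔼 x, θ s x v * θ s x w := by
    exact avg_congr fun s => (avg_gram_comm (fun u v => m s u v) (fun x v => θ s x v)).symm
  rw [e1] at h1
  have h2 := avg_cauchy₃ (fun s v w => 𝔼 u, m s u v * m s u w)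
    (fun s v w => 𝔼 x, θ s x v * θ s x w)
  have h3 : 𝔼 s, 𝔼 v, 𝔼 w, (𝔼 u, m s u v * m s u w) ^ 2 ≤ 2 * (c ^ 2 * β ^ 2) := by
    have h4 : 𝔼 s, 𝔼 v, 𝔼 w, (𝔼 u, m s u v * m s u w) ^ 2
        ≤ 𝔼 s, 𝔼 v, 𝔼 w, (𝔼 u, t s u v * t s u w) ^ 2 :=
      avg_mono fun s => avg_mono fun v => avg_mono fun w => by
        rw [← sq_abs]
        exact pow_le_pow_left₀ (abs_nonneg _) (h.abs_gram_le hm s v w) 2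
    have h5 : e ^ 4 ≤ 1 := pow_le_one₀ h.e_pos.le (by linarith [h.e_le])
    have h6 : e ^ 4 * (c ^ 2 * β ^ 2) ≤ 1 * (c ^ 2 * β ^ 2) := by gcongr
    have e2 : (1 + e ^ 4) * ((k * ϖ) ^ 4 * α ^ 2 * β ^ 2)
      = c ^ 2 * β ^ 2 + e ^ 4 * (c ^ 2 * β ^ 2) := by rw [hcdef]; ring
    linarith
  have h4 : 0 ≤ 𝔼 s, 𝔼 v, 𝔼 w, (𝔼 x, θ s x v * θ s x w) ^ 2 :=
    avg_nonneg fun _ => avg_nonneg fun _ => avg_nonneg fun _ => sq_nonneg _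
  have h5 := pow_le_pow_left₀ (by positivity) h1 2
  have h6 := mul_le_mul_of_nonneg_right h3 h4
  refine le_of_mul_le_mul_left (a := 2 * (c ^ 2 * β ^ 2)) ?_ (by positivity)
  have e3 : 2 * (c ^ 2 * β ^ 2) * (l ^ 4 / 8 * β ^ 4) = (l ^ 2 / 2 * (c * β ^ 3)) ^ 2 := by ring
  linarith

end Fibre

/-! ### Sparse pseudorandom sets of triangles -/

section TriangleSystem

variable {X Y Z : Type*} [Fintype X] [Fintype Y] [Fintype Z]

/-- The average of the product of `f` over the eight vertices of a box, that is, the eighth power of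
the box norm. Averaging over the pair of vertices in `X` produces the square. -/
noncomputable def cubeAvg (f : X → Y → Z → ℝ) : ℝ :=
  𝔼 z, 𝔼 z', 𝔼 y, 𝔼 y', (𝔼 x, (f x y z * f x y z') * (f x y' z * f x y' z')) ^ 2

/-- A set `T` of triangles in a tripartite graph with parts `X`, `Y`, `Z`, all given by indicator
functions. The three bipartite graphs are cut-uniform of densities `p, q, r`, and `T` has density
about `d` among the triangles with an almost minimal number of octahedra. The error `e ^ 4 / 4` is
relative, the error `ρ` is absolute and much smaller than all densities. -/
structure Triangles (R₁ : X → Y → ℝ) (R₂ : X → Z → ℝ) (R₃ : Y → Z → ℝ) (T : X → Y → Z → ℝ)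
    (p q r d e ρ : ℝ) : Prop where
  R₁01 : ∀ x y, R₁ x y = 0 ∨ R₁ x y = 1
  R₂01 : ∀ x z, R₂ x z = 0 ∨ R₂ x z = 1
  R₃01 : ∀ y z, R₃ y z = 0 ∨ R₃ y z = 1
  T01 : ∀ x y z, T x y z = 0 ∨ T x y z = 1
  T_le₁ : ∀ x y z, T x y z ≤ R₁ x y
  T_le₂ : ∀ x y z, T x y z ≤ R₂ x z
  T_le₃ : ∀ x y z, T x y z ≤ R₃ y z
  p_pos : 0 < p
  p_le : p ≤ 1
  q_pos : 0 < q
  q_le : q ≤ 1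
  r_pos : 0 < r
  r_le : r ≤ 1
  d_pos : 0 < d
  d_le : d ≤ 1
  e_pos : 0 < e
  e_le : e ≤ 1 / 10
  cut₁ : CutUniform R₁ p ρ
  cut₂ : CutUniform R₂ q ρ
  cut₃ : CutUniform R₃ r ρ
  small : ρ ≤ e ^ 4 * (d * p * q * r) ^ 8 / 64
  count8 : cubeAvg T ≤ (1 + e ^ 4 / 4) * (d ^ 8 * (p * q * r) ^ 4)
  count : (1 - e ^ 4 / 4) * (d * p * q * r) ≤ 𝔼 x, 𝔼 y, 𝔼 z, T x y z

end TriangleSystem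

namespace Triangles

variable {X Y Z : Type*} [Fintype X] [Fintype Y] [Fintype Z] [Nonempty X] [Nonempty Y] [Nonempty Z]
  {R₁ : X → Y → ℝ} {R₂ : X → Z → ℝ} {R₃ : Y → Z → ℝ} {T : X → Y → Z → ℝ} {p q r d e ρ : ℝ}

theorem mul_zero_or_one {a b : ℝ} (ha : a = 0 ∨ a = 1) (hb : b = 0 ∨ b = 1) :
    a * b = 0 ∨ a * b = 1 := by
  rcases ha with rfl | rfl <;> rcases hb with rfl | rfl <;> simp

theorem nonneg_of_zero_or_one {a : ℝ} (ha : a = 0 ∨ a = 1) : 0 ≤ a := by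
  rcases ha with rfl | rfl <;> simp

theorem le_one_of_zero_or_one {a : ℝ} (ha : a = 0 ∨ a = 1) : a ≤ 1 := by
  rcases ha with rfl | rfl <;> simp

theorem abs_le_one_of_zero_or_one {a : ℝ} (ha : a = 0 ∨ a = 1) : |a| ≤ 1 := by
  rcases ha with rfl | rfl <;> simp

theorem sq_of_zero_or_one {a : ℝ} (ha : a = 0 ∨ a = 1) : a ^ 2 = a := by
  rcases ha with rfl | rfl <;> simp

theorem mul_le_mul_of_zero_or_one {a b a' b' : ℝ} (ha : a = 0 ∨ a = 1) (hb : b = 0 ∨ b = 1)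
    (h : a ≤ a') (h' : b ≤ b') : a * b ≤ a' * b' :=
  mul_le_mul h h' (nonneg_of_zero_or_one hb) ((nonneg_of_zero_or_one ha).trans h)

theorem nonneg_of_cut (h : Triangles R₁ R₂ R₃ T p q r d e ρ) : 0 ≤ ρ :=
  (abs_nonneg _).trans (h.cut₁ (fun _ => 0) (fun _ => 0) (by simp) (by simp))

theorem small_monomial (h : Triangles R₁ R₂ R₃ T p q r d e ρ) {i j k l : ℕ} (hi : i ≤ 8)
    (hj : j ≤ 8) (hk : k ≤ 8) (hl : l ≤ 8) :
    ρ ≤ e ^ 4 * (d ^ i * p ^ j * q ^ k * r ^ l) / 64 := by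
  refine h.small.trans ?_
  have h1 := pow_le_pow_of_le_one h.d_pos.le h.d_le hi
  have h2 := pow_le_pow_of_le_one h.p_pos.le h.p_le hj
  have h3 := pow_le_pow_of_le_one h.q_pos.le h.q_le hk
  have h4 := pow_le_pow_of_le_one h.r_pos.le h.r_le hl
  have := h.d_pos
  have := h.p_pos
  have := h.q_pos
  have := h.r_pos
  have := h.e_pos
  rw [mul_pow, mul_pow, mul_pow]
  gcongr

/-- A lower bound for the number of pairs of triangles with a common edge in `R`. -/
theorem avg_sq_ge {U V W : Type*} [Fintype U] [Fintype V] [Fintype W] [Nonempty U] [Nonempty V]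
    [Nonempty W] {R : U → V → ℝ} {t : U → V → W → ℝ} {ϖ ρ x c : ℝ}
    (hR : ∀ u v, R u v = 0 ∨ R u v = 1) (ht : ∀ u v w, t u v w = 0 ∨ t u v w = 1)
    (htR : ∀ u v w, t u v w ≤ R u v) (cut : CutUniform R ϖ ρ) (hϖ : 0 < ϖ) (hx : 0 ≤ x)
    (hx1 : x ≤ 1) (hc : 0 ≤ c) (hρ : ρ ≤ x * ϖ / 64)
    (count : (1 - x / 4) * (ϖ * c) ≤ 𝔼 u, 𝔼 v, 𝔼 w, t u v w) :
    (1 - x) * (ϖ * c ^ 2) ≤ 𝔼 u, 𝔼 v, (𝔼 w, t u v w) ^ 2 := by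
  have h1 := avg_cauchy₂ R (fun u v => 𝔼 w, t u v w)
  have e1 : 𝔼 u, 𝔼 v, R u v * 𝔼 w, t u v w = 𝔼 u, 𝔼 v, 𝔼 w, t u v w := by
    refine avg_congr fun u => avg_congr fun v => ?_
    rw [Finset.mul_expect]
    refine avg_congr fun w => ?_
    have h2 := htR u v w
    rcases hR u v with h | h <;> rcases ht u v w with h' | h' <;> rw [h, h'] at h2 ⊢ <;> linarith
  have h2 : 𝔼 u, 𝔼 v, R u v ≤ (1 + x / 64) * ϖ := by
    have := avg_le_of_avg_abs_sub_le cut.avg_abs_deg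
    rw [avg_swap] at this
    linarith
  simp only [fun u v => sq_of_zero_or_one (hR u v), e1] at h1
  have h4 : 0 ≤ 𝔼 u, 𝔼 v, (𝔼 w, t u v w) ^ 2 :=
    avg_nonneg fun _ => avg_nonneg fun _ => sq_nonneg _
  have h5 : 0 ≤ (1 - x / 4) * (ϖ * c) := mul_nonneg (by linarith) (by positivity)
  have h6 := pow_le_pow_left₀ h5 count 2
  have h7 := mul_le_mul_of_nonneg_right h2 h4
  refine le_of_mul_le_mul_left (a := (1 + x / 64) * ϖ) ?_ (by positivity)
  have h8 : (1 + x / 64) * ϖ * ((1 - x) * (ϖ * c ^ 2)) ≤ ((1 - x / 4) * (ϖ * c)) ^ 2 := by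
    have : (1 + x / 64) * (1 - x) ≤ (1 - x / 4) ^ 2 := by nlinarith
    calc _ = (1 + x / 64) * (1 - x) * (ϖ * c) ^ 2 := by ring
      _ ≤ (1 - x / 4) ^ 2 * (ϖ * c) ^ 2 := mul_le_mul_of_nonneg_right this (sq_nonneg _)
      _ = _ := by ring
  linarith

/-- The density of four-cycles in a cut-uniform graph. -/
theorem _root_.Corners.CutUniform.avg_cycle_le {R : Y → Z → ℝ} {r ρ : ℝ}
    (h : CutUniform R r ρ) (hr : 0 ≤ r) (hr1 : r ≤ 1) (h01 : ∀ y z, R y z = 0 ∨ R y z = 1) :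
    𝔼 z, 𝔼 z', 𝔼 y, 𝔼 y', (R y z * R y z') * (R y' z * R y' z') ≤ r ^ 4 + 4 * ρ := by
  have h4 := h.avg_abs_codeg hr hr1 (fun x z => abs_le_one_of_zero_or_one (h01 x z))
  have h5 : 𝔼 z, 𝔼 z', 𝔼 y, 𝔼 y', (R y z * R y z') * (R y' z * R y' z')
      ≤ 𝔼 z, 𝔼 z', (r ^ 4 + 2 * |(𝔼 y, R y z' * R y z) - r ^ 2|) := by
    refine avg_mono fun z => avg_mono fun z' => ?_
    have e3 : 𝔼 y, 𝔼 y', (R y z * R y z') * (R y' z * R y' z') = (𝔼 y, R y z' * R y z) ^ 2 := by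
      rw [avg_sq_eq]
      exact avg_congr fun y => avg_congr fun y' => by ring
    have h6 : 𝔼 y, R y z' * R y z ≤ 1 := avg_le_of_le fun y =>
      le_one_of_zero_or_one (mul_zero_or_one (h01 _ _) (h01 _ _))
    have h7 : 0 ≤ 𝔼 y, R y z' * R y z := avg_nonneg fun y =>
      nonneg_of_zero_or_one (mul_zero_or_one (h01 _ _) (h01 _ _))
    have h8 : r ^ 2 ≤ 1 := pow_le_one₀ hr hr1
    rw [e3]
    generalize 𝔼 y, R y z' * R y z = x at h6 h7
    have h9 : (x + r ^ 2) * (x - r ^ 2) ≤ 2 * |x - r ^ 2| :=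
      (mul_le_mul_of_nonneg_left (le_abs_self _) (by positivity)).trans
        (mul_le_mul_of_nonneg_right (by linarith) (abs_nonneg _))
    linarith
  simp only [Finset.expect_add_distrib, Fintype.expect_const] at h5
  have e1 : 𝔼 z, 𝔼 z', 2 * |(𝔼 y, R y z' * R y z) - r ^ 2|
      = 2 * 𝔼 z, 𝔼 z', |(𝔼 y, R y z' * R y z) - r ^ 2| := by simp only [Finset.mul_expect]
  linarith

/-- Pairs of triangles with a common side in `X × Y`, as bipartite graphs on `X × Y`. -/
theorem fibreXY (h : Triangles R₁ R₂ R₃ T p q r d e ρ) :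
    Fibre (S := Z × Z) (fun s x => R₂ x s.1 * R₂ x s.2) (fun s y => R₃ y s.1 * R₃ y s.2) R₁
      (fun s x y => T x y s.1 * T x y s.2) (q ^ 2) (r ^ 2) p (d ^ 2) e (2 * ρ) where
  A01 s x := mul_zero_or_one (h.R₂01 _ _) (h.R₂01 _ _)
  B01 s y := mul_zero_or_one (h.R₃01 _ _) (h.R₃01 _ _)
  R01 := h.R₁01
  t01 s x y := mul_zero_or_one (h.T01 _ _ _) (h.T01 _ _ _)
  t_le_A s x y := mul_le_mul_of_zero_or_one (h.T01 _ _ _) (h.T01 _ _ _) (h.T_le₂ _ _ _)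
    (h.T_le₂ _ _ _)
  t_le_B s x y := mul_le_mul_of_zero_or_one (h.T01 _ _ _) (h.T01 _ _ _) (h.T_le₃ _ _ _)
    (h.T_le₃ _ _ _)
  t_le_R s x y := (mul_le_of_le_one_right (nonneg_of_zero_or_one (h.T01 _ _ _))
    (le_one_of_zero_or_one (h.T01 _ _ _))).trans (h.T_le₁ _ _ _)
  α_pos := pow_pos h.q_pos 2
  α_le := pow_le_one₀ h.q_pos.le h.q_le
  β_pos := pow_pos h.r_pos 2
  β_le := pow_le_one₀ h.r_pos.le h.r_le
  ϖ_pos := h.p_pos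
  ϖ_le := h.p_le
  k_pos := pow_pos h.d_pos 2
  k_le := pow_le_one₀ h.d_pos.le h.d_le
  e_pos := h.e_pos
  e_le := h.e_le
  cut := h.cut₁.mono (by linarith [h.nonneg_of_cut])
  avgA := by
    have := h.cut₂.avg_abs_codeg h.q_pos.le h.q_le
      (fun x z => abs_le_one_of_zero_or_one (h.R₂01 x z))
    rw [avg_prod]
    exact (avg_swap _).trans_le this
  avgB := by
    have := h.cut₃.avg_abs_codeg h.r_pos.le h.r_le
      (fun x z => abs_le_one_of_zero_or_one (h.R₃01 x z))
    rw [avg_prod]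
    exact (avg_swap _).trans_le this
  small := by
    have := h.small_monomial (i := 8) (j := 4) (k := 8) (l := 8) (by norm_num) (by norm_num)
      (by norm_num) (by norm_num)
    have e1 : e ^ 4 * (d ^ 2 * p * q ^ 2 * r ^ 2) ^ 4 / 16
      = 4 * (e ^ 4 * (d ^ 8 * p ^ 4 * q ^ 8 * r ^ 8) / 64) := by ring
    rw [e1]
    linarith [h.nonneg_of_cut]
  count4 := by
    have h1 := h.count8
    have h2 : 0 ≤ e ^ 4 * (d ^ 8 * (p * q * r) ^ 4) := by
      have := h.p_pos; have := h.q_pos; have := h.r_pos; have := h.d_pos; positivity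
    have e1 : (1 + e ^ 4) * ((d ^ 2 * p) ^ 4 * (q ^ 2) ^ 2 * (r ^ 2) ^ 2)
      = (1 + e ^ 4) * (d ^ 8 * (p * q * r) ^ 4) := by ring
    rw [e1]
    simp only [avg_prod]
    unfold cubeAvg at h1
    linarith
  count := by
    have he := h.e_pos
    have hd := h.d_pos
    have hp := h.p_pos
    have hq := h.q_pos
    have hr := h.r_pos
    have h0 := h.small_monomial (i := 0) (j := 1) (k := 0) (l := 0) (by norm_num)
      (by norm_num) (by norm_num) (by norm_num)
    have h1 := avg_sq_ge (x := e ^ 4) (c := d * q * r) h.R₁01 h.T01 h.T_le₁ h.cut₁ h.p_pos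
      (by positivity) (pow_le_one₀ he.le (by linarith [h.e_le])) (by positivity)
      (by simpa using h0) (le_of_eq_of_le (by ring) h.count)
    convert h1 using 1
    · ring
    · simp only [avg_sq_eq, avg_prod]
      exact (avg_swap₂₂ fun x y z z' => T x y z * T x y z').symm

/-- Pairs of triangles with a common side in `X × Z`, as bipartite graphs on `X × Z`. -/
theorem fibreXZ (h : Triangles R₁ R₂ R₃ T p q r d e ρ) :
    Fibre (S := Y × Y) (fun s x => R₁ x s.1 * R₁ x s.2) (fun s z => R₃ s.1 z * R₃ s.2 z) R₂
      (fun s x z => T x s.1 z * T x s.2 z) (p ^ 2) (r ^ 2) q (d ^ 2) e (2 * ρ) where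
  A01 s x := mul_zero_or_one (h.R₁01 _ _) (h.R₁01 _ _)
  B01 s y := mul_zero_or_one (h.R₃01 _ _) (h.R₃01 _ _)
  R01 := h.R₂01
  t01 s x y := mul_zero_or_one (h.T01 _ _ _) (h.T01 _ _ _)
  t_le_A s x y := mul_le_mul_of_zero_or_one (h.T01 _ _ _) (h.T01 _ _ _) (h.T_le₁ _ _ _)
    (h.T_le₁ _ _ _)
  t_le_B s x y := mul_le_mul_of_zero_or_one (h.T01 _ _ _) (h.T01 _ _ _) (h.T_le₃ _ _ _)
    (h.T_le₃ _ _ _)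
  t_le_R s x y := (mul_le_of_le_one_right (nonneg_of_zero_or_one (h.T01 _ _ _))
    (le_one_of_zero_or_one (h.T01 _ _ _))).trans (h.T_le₂ _ _ _)
  α_pos := pow_pos h.p_pos 2
  α_le := pow_le_one₀ h.p_pos.le h.p_le
  β_pos := pow_pos h.r_pos 2
  β_le := pow_le_one₀ h.r_pos.le h.r_le
  ϖ_pos := h.q_pos
  ϖ_le := h.q_le
  k_pos := pow_pos h.d_pos 2
  k_le := pow_le_one₀ h.d_pos.le h.d_le
  e_pos := h.e_pos
  e_le := h.e_le
  cut := h.cut₂.mono (by linarith [h.nonneg_of_cut])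
  avgA := by
    have := h.cut₁.avg_abs_codeg h.p_pos.le h.p_le
      (fun x z => abs_le_one_of_zero_or_one (h.R₁01 x z))
    rw [avg_prod]
    exact (avg_swap _).trans_le this
  avgB := by
    have := h.cut₃.symm.avg_abs_codeg h.r_pos.le h.r_le
      (fun x z => abs_le_one_of_zero_or_one (h.R₃01 z x))
    rw [avg_prod]
    exact (avg_swap _).trans_le this
  small := by
    have := h.small_monomial (i := 8) (j := 8) (k := 4) (l := 8) (by norm_num) (by norm_num)
      (by norm_num) (by norm_num)
    have e1 : e ^ 4 * (d ^ 2 * q * p ^ 2 * r ^ 2) ^ 4 / 16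
      = 4 * (e ^ 4 * (d ^ 8 * p ^ 8 * q ^ 4 * r ^ 8) / 64) := by ring
    rw [e1]
    linarith [h.nonneg_of_cut]
  count4 := by
    have h1 := h.count8
    have h2 : 0 ≤ e ^ 4 * (d ^ 8 * (p * q * r) ^ 4) := by
      have := h.p_pos; have := h.q_pos; have := h.r_pos; have := h.d_pos; positivity
    have e1 : (1 + e ^ 4) * ((d ^ 2 * q) ^ 4 * (p ^ 2) ^ 2 * (r ^ 2) ^ 2)
      = (1 + e ^ 4) * (d ^ 8 * (p * q * r) ^ 4) := by ring
    have e2 : 𝔼 s : Y × Y, 𝔼 z, 𝔼 z', (𝔼 x, T x s.1 z * T x s.2 z * (T x s.1 z' * T x s.2 z')) ^ 2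
        = cubeAvg T := by
      simp only [avg_prod]
      rw [avg_swap₂₂]
      refine avg_congr fun z => avg_congr fun z' => avg_congr fun y => avg_congr fun y' => ?_
      congr 1
      exact avg_congr fun x => by ring
    rw [e1, e2]
    linarith
  count := by
    have he := h.e_pos
    have hd := h.d_pos
    have hp := h.p_pos
    have hq := h.q_pos
    have hr := h.r_pos
    have h0 := h.small_monomial (i := 0) (j := 0) (k := 1) (l := 0) (by norm_num)
      (by norm_num) (by norm_num) (by norm_num)
    have h1 := avg_sq_ge (t := fun x z y => T x y z) (x := e ^ 4) (c := d * p * r) h.R₂01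
      (fun _ _ _ => h.T01 _ _ _) (fun _ _ _ => h.T_le₂ _ _ _) h.cut₂ h.q_pos
      (by positivity) (pow_le_one₀ he.le (by linarith [h.e_le])) (by positivity)
      (by simpa using h0)
      ((le_of_eq_of_le (by ring) h.count).trans_eq (avg_congr fun x => avg_swap _))
    convert h1 using 1
    · ring
    · simp only [avg_sq_eq, avg_prod]
      exact (avg_swap₂₂ fun x z y y' => T x y z * T x y' z).symm

/-- Triangles through a vertex of `X`, as bipartite graphs on `Z × Y`. -/
theorem fibreZY (h : Triangles R₁ R₂ R₃ T p q r d e ρ) :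
    Fibre (S := X) (fun x z => R₂ x z) (fun x y => R₁ x y) (fun z y => R₃ y z)
      (fun x z y => T x y z) q p r d e (2 * ρ) where
  A01 := h.R₂01
  B01 := h.R₁01
  R01 _ _ := h.R₃01 _ _
  t01 _ _ _ := h.T01 _ _ _
  t_le_A _ _ _ := h.T_le₂ _ _ _
  t_le_B _ _ _ := h.T_le₁ _ _ _
  t_le_R _ _ _ := h.T_le₃ _ _ _
  α_pos := h.q_pos
  α_le := h.q_le
  β_pos := h.p_pos
  β_le := h.p_le
  ϖ_pos := h.r_pos
  ϖ_le := h.r_le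
  k_pos := h.d_pos
  k_le := h.d_le
  e_pos := h.e_pos
  e_le := h.e_le
  cut := h.cut₃.symm.mono (by linarith [h.nonneg_of_cut])
  avgA := h.cut₂.symm.avg_abs_deg.trans (by linarith [h.nonneg_of_cut])
  avgB := h.cut₁.symm.avg_abs_deg.trans (by linarith [h.nonneg_of_cut])
  small := by
    have := h.small_monomial (i := 4) (j := 4) (k := 4) (l := 4) (by norm_num) (by norm_num)
      (by norm_num) (by norm_num)
    have e1 : e ^ 4 * (d * r * q * p) ^ 4 / 16
      = 4 * (e ^ 4 * (d ^ 4 * p ^ 4 * q ^ 4 * r ^ 4) / 64) := by ring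
    rw [e1]
    linarith [h.nonneg_of_cut]
  count4 := by
    have he := h.e_pos
    have hd := h.d_pos
    have hp := h.p_pos
    have hq := h.q_pos
    have hr := h.r_pos
    have h1 := h.count8
    set W : Z → Z → Y → Y → ℝ := fun z z' y y' => (R₃ y z * R₃ y z') * (R₃ y' z * R₃ y' z') with hW
    have hW01 : ∀ z z' y y', W z z' y y' = 0 ∨ W z z' y y' = 1 := fun _ _ _ _ =>
      mul_zero_or_one (mul_zero_or_one (h.R₃01 _ _) (h.R₃01 _ _))
        (mul_zero_or_one (h.R₃01 _ _) (h.R₃01 _ _))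
    have h2 := avg_cauchy₄ W
      (fun z z' y y' => 𝔼 x, (T x y z * T x y z') * (T x y' z * T x y' z'))
    have e1 : 𝔼 z, 𝔼 z', 𝔼 y, 𝔼 y', W z z' y y' *
          𝔼 x, (T x y z * T x y z') * (T x y' z * T x y' z')
        = 𝔼 x, 𝔼 y, 𝔼 y', (𝔼 z, T x y z * T x y' z) ^ 2 := by
      have e2 : ∀ z z' y y', W z z' y y' *
          𝔼 x, (T x y z * T x y z') * (T x y' z * T x y' z')
          = 𝔼 x, (T x y z * T x y' z) * (T x y z' * T x y' z') := by
        intro z z' y y'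
        rw [Finset.mul_expect]
        refine avg_congr fun x => ?_
        have h3 : ∀ y z, R₃ y z * T x y z = T x y z := by
          intro y z
          have := h.T_le₃ x y z
          rcases h.R₃01 y z with h₁ | h₁ <;> rcases h.T01 x y z with h₂ | h₂ <;>
            rw [h₁, h₂] at this ⊢ <;> linarith
        calc _ = (R₃ y z * T x y z) * (R₃ y' z * T x y' z) *
              ((R₃ y z' * T x y z') * (R₃ y' z' * T x y' z')) := by simp only [hW]; ring
          _ = _ := by rw [h3, h3, h3, h3]
      simp only [e2, avg_sq_eq]
      rw [avg_swap₂₃]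
      refine (avg_swap₁₂ _).symm.trans ?_
      rfl
    rw [e1] at h2
    have h3 : 𝔼 z, 𝔼 z', 𝔼 y, 𝔼 y', W z z' y y' ^ 2 ≤ (1 + e ^ 4 / 4) * r ^ 4 := by
      simp only [fun z z' y y' => sq_of_zero_or_one (hW01 z z' y y')]
      have h5 := h.cut₃.avg_cycle_le hr.le h.r_le h.R₃01
      have h6 := h.small_monomial (i := 0) (j := 0) (k := 0) (l := 4) (by norm_num)
        (by norm_num) (by norm_num) (by norm_num)
      simp only [pow_zero, one_mul] at h6
      have h7 : 0 ≤ e ^ 4 * r ^ 4 := by positivity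
      linarith
    have h4 : 𝔼 x, 𝔼 y, 𝔼 y', (𝔼 z, T x y z * T x y' z) ^ 2
        ≤ (1 + e ^ 4 / 4) * ((d * r) ^ 4 * q ^ 2 * p ^ 2) := by
      refine le_of_sq_le_sq (h2.trans ?_) (by positivity)
      refine (mul_le_mul h3 h1 (avg_nonneg fun _ => avg_nonneg fun _ => avg_nonneg fun _ =>
        avg_nonneg fun _ => sq_nonneg _) (by positivity)).trans_eq ?_
      ring
    have h5 : 0 ≤ e ^ 4 * ((d * r) ^ 4 * q ^ 2 * p ^ 2) := by positivity
    linarith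
  count := by
    have h2 : 0 ≤ e ^ 4 * (d * p * q * r) := by
      have := h.p_pos; have := h.q_pos; have := h.r_pos; have := h.d_pos; positivity
    have h1 := h.count
    have e1 : 𝔼 x, 𝔼 z, 𝔼 y, T x y z = 𝔼 x, 𝔼 y, 𝔼 z, T x y z := avg_congr fun x => avg_swap _
    have e2 : (1 - e ^ 4) * (d * r * q * p) = (1 - e ^ 4) * (d * p * q * r) := by ring
    rw [e1, e2]
    linarith

end Triangles

/-- The power of `l` by which `Triangles.exists_correlation` turns a relative box norm `l` into a
correlation. -/
noncomputable def gain (l : ℝ) : ℝ := (((l ^ 8 / 2 ^ 23) ^ 4 / 8) ^ 4 / 512) ^ 2 / 8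

namespace Triangles

variable {X Y Z : Type*} [Fintype X] [Fintype Y] [Fintype Z] [Nonempty X] [Nonempty Y] [Nonempty Z]
  {R₁ : X → Y → ℝ} {R₂ : X → Z → ℝ} {R₃ : Y → Z → ℝ} {T : X → Y → Z → ℝ} {p q r d e ρ : ℝ}

theorem abs_mul_le_mul {a b a' b' : ℝ} (h : |a| ≤ a') (h' : |b| ≤ b') : |a * b| ≤ a' * b' := by
  rw [abs_mul]; exact mul_le_mul h h' (abs_nonneg _) ((abs_nonneg _).trans h)

/-- A function supported on a sparse pseudorandom set of triangles with a large box norm correlates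
with a product of three bounded functions of two variables; the loss is polynomial in `l` and
involves no densities. -/
theorem exists_correlation (h : Triangles R₁ R₂ R₃ T p q r d e ρ) {f : X → Y → Z → ℝ}
    (hf : ∀ x y z, |f x y z| ≤ T x y z) {l κ : ℝ} (hl : 0 < l) (hl1 : l ≤ 1)
    (hκ : κ = gain l) (hel : 64 * e ≤ d ^ 2 * κ ^ 2)
    (hL : l * (d ^ 8 * (p * q * r) ^ 4) ≤ cubeAvg f) :
    ∃ (a : X → Y → ℝ) (b : X → Z → ℝ) (c : Y → Z → ℝ), (∀ x y, |a x y| ≤ 1) ∧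
      (∀ x z, |b x z| ≤ 1) ∧ (∀ y z, |c y z| ≤ 1) ∧
      κ ^ 2 / 32 * (d * p * q * r)
        ≤ 𝔼 x, 𝔼 y, 𝔼 z, f x y z * (a x y * (b x z * c y z)) := by
  obtain ⟨l₅, hl₅⟩ : ∃ x, x = l ^ 8 / 2 ^ 23 := ⟨_, rfl⟩
  obtain ⟨l₆, hl₆⟩ : ∃ x, x = l₅ ^ 4 / 8 := ⟨_, rfl⟩
  obtain ⟨l₇, hl₇⟩ : ∃ x, x = l₆ ^ 4 / 512 := ⟨_, rfl⟩
  rw [gain, ← hl₅, ← hl₆, ← hl₇] at hκ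
  have hd := h.d_pos
  have hd1 := h.d_le
  have hp := h.p_pos
  have hq := h.q_pos
  have hr := h.r_pos
  have he := h.e_pos
  have p₅ : 0 < l₅ := by rw [hl₅]; positivity
  have p₆ : 0 < l₆ := by rw [hl₆]; positivity
  have p₇ : 0 < l₇ := by rw [hl₇]; positivity
  have pκ : 0 < κ := by rw [hκ]; positivity
  have pow_le : ∀ {x : ℝ} {n : ℕ}, 0 < x → x ≤ 1 → 1 ≤ n → x ^ n ≤ x := fun h0 h1 hn =>
    pow_le_of_le_one h0.le h1 (by omega)
  have le₅ : l₅ ≤ l := by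
    have := pow_le hl hl1 (show 1 ≤ 8 by norm_num)
    have h0 : 0 < l ^ 8 := by positivity
    rw [hl₅]; linarith
  have le₆ : l₆ ≤ l₅ := by
    have := pow_le p₅ (le₅.trans hl1) (show 1 ≤ 4 by norm_num)
    rw [hl₆]; linarith
  have le₇ : l₇ ≤ l₆ := by
    have := pow_le p₆ (le₆.trans (le₅.trans hl1)) (show 1 ≤ 4 by norm_num)
    rw [hl₇]; linarith
  have h71 : l₇ ≤ 1 := le₇.trans (le₆.trans (le₅.trans hl1))
  have leκ : κ ≤ l₇ := by
    have := pow_le p₇ h71 (show 1 ≤ 2 by norm_num)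
    rw [hκ]; linarith
  have hκ1 : κ ≤ 1 := leκ.trans h71
  have hel' : ∀ {x}, κ ≤ x → 64 * e ≤ d ^ 2 * x ^ 2 := fun hx => hel.trans (by gcongr)
  have hd2 : d ^ 2 ≤ 1 := pow_le_one₀ hd.le hd1
  have hκ2 : d ^ 2 * κ ^ 2 ≤ κ :=
    (mul_le_of_le_one_left (sq_nonneg _) hd2).trans (pow_le pκ hκ1 (by norm_num))
  -- Fibres over pairs in `Z`: weighted degrees `B` of the vertices in `Y`.
  set m : Z × Z → X → Y → ℝ := fun s x y => f x y s.1 * f x y s.2 with hm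
  have hmt : ∀ s x y, |m s x y| ≤ T x y s.1 * T x y s.2 := fun s x y =>
    abs_mul_le_mul (hf _ _ _) (hf _ _ _)
  obtain ⟨a, ha, h5⟩ := h.fibreXY.exists_side hmt hl hl1
    (hel' (leκ.trans (le₇.trans (le₆.trans le₅)))) (by
      refine le_of_eq_of_le (by ring) (hL.trans_eq ?_)
      unfold cubeAvg
      simp only [avg_prod, hm])
  have hB := h.fibreXY.abs_side_le hmt a
  have hside := fun (ω : Z × Z → Y → ℝ) hω =>
    h.fibreXY.avg_row_sq_ge_of_side hmt ha (ω := ω) hω (l := l₇)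
  set B : Z × Z → Y → ℝ := fun s y =>
    clip ((𝔼 x, m s x y * a s x) / (d ^ 2 * p * q ^ 2)) with hBdef
  rw [← hl₅] at h5
  -- Fibres over pairs in `Y`: the pairwise products of the kernels `B` have large cycle counts.
  have h6 := h.fibreXZ.gram_kernel_sq_ge (m := fun s x z => f x s.1 z * f x s.2 z)
    (θ := fun s z z' => B (z, z') s.1 * B (z, z') s.2) (l := l₅)
    (fun s x z => abs_mul_le_mul (hf _ _ _) (hf _ _ _))
    (fun s z z' => (abs_mul_le_mul (hB (z, z') s.1) (hB (z, z') s.2)).trans_eq (by ring)) p₅.le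
    (by linarith [hel' (leκ.trans (le₇.trans le₆))]) (by
      refine le_of_eq_of_le (by ring) (h5.trans_eq ?_)
      simp only [avg_prod, hm]
      rw [avg_swap₂₂]
      refine avg_congr fun y => avg_congr fun y' => avg_congr fun z => avg_congr fun z' => ?_
      congr 1
      exact avg_congr fun x => by ring)
  rw [← hl₆] at h6
  have hρ : ρ ≤ l₆ ^ 4 * r ^ 8 / 1024 := by
    have h1 := h.small_monomial (i := 0) (j := 0) (k := 0) (l := 8) (by norm_num)
      (by norm_num) (by norm_num) (by norm_num)
    simp only [pow_zero, one_mul] at h1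
    have h2 : 64 * e ≤ l₆ := hel.trans (hκ2.trans (leκ.trans le₇))
    have h3 : e ^ 4 ≤ (l₆ / 64) ^ 4 := pow_le_pow_left₀ he.le (by linarith) 4
    have h4 : e ^ 4 * r ^ 8 ≤ (l₆ / 64) ^ 4 * r ^ 8 := by gcongr
    have h5 : 0 < l₆ ^ 4 * r ^ 8 := by positivity
    have e1 : (l₆ / 64) ^ 4 * r ^ 8 = l₆ ^ 4 * r ^ 8 / 64 ^ 4 := by ring
    rw [e1] at h4
    linarith
  obtain ⟨P, F, G, hP, hF, hG, h7⟩ := exists_common_kernel h.cut₃ hr h.r_le h.R₃01 p₆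
    (le₆.trans (le₅.trans hl1)) hρ (b := fun y z w => B (z, w) y) (fun y z w => hB (z, w) y) (by
      refine le_of_eq_of_le (by ring) (h6.trans_eq ?_)
      rw [avg_prod, avg_swap₂₂, avg_swap₂₂ fun z z' w w' => (𝔼 y, B (z, w) y * B (z, w') y
        * (B (z', w) y * B (z', w') y)) ^ 2]
      refine avg_congr fun w => avg_congr fun w' => ?_
      have e1 := avg_gram_comm (fun y z => B (z, w) y * B (z, w') y)
        (fun y z => B (z, w) y * B (z, w') y)
      simp only [← sq (𝔼 u, B _ u * B _ u * (B _ u * B _ u))] at e1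
      rw [e1]
      refine avg_congr fun y => avg_congr fun y' => ?_
      congr 1
      exact avg_congr fun z => by ring)
  rw [← hl₇] at h7
  -- The common kernel turns the correlation of `B` into one of `f`.
  have h8 := hside (fun s y => P s.1 s.2 * (F y s.1 * G y s.2))
    (fun s y => abs_mul_le_one (hP _ _) (abs_mul_le_one (hF _ _) (hG _ _))) p₇.le (by
      have h1 := hel' leκ
      have h2 : d ^ 2 * l₇ ^ 2 ≤ l₇ :=
        (mul_le_of_le_one_left (sq_nonneg _) hd2).trans (pow_le p₇ h71 (by norm_num))
      nlinarith [h.e_le]) (by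
      refine h7.trans_eq ?_
      rw [avg_prod]
      exact avg_swap₁₂ _)
  rw [← hκ] at h8
  have h9 : κ * (((d * r) ^ 2 * q) ^ 2 * p ^ 2)
      ≤ 𝔼 x, 𝔼 y, 𝔼 y', (𝔼 z, (f x y z * F y z) * (f x y' z * F y' z))
        * 𝔼 z, (f x y z * G y z) * (f x y' z * G y' z) := by
    have e1 : ∀ x, 𝔼 y, 𝔼 y', (𝔼 z, (f x y z * F y z) * (f x y' z * F y' z))
        * (𝔼 z, (f x y z * G y z) * (f x y' z * G y' z))
        = 𝔼 z, 𝔼 z', (𝔼 y, (f x y z * F y z) * (f x y z' * G y z')) ^ 2 := fun x =>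
      avg_gram_comm (fun z y => f x y z * F y z) (fun z y => f x y z * G y z)
    simp only [e1]
    rw [avg_swap₁₂]
    refine le_of_eq_of_le (by ring) (h8.trans ?_)
    rw [avg_prod]
    refine avg_mono fun z => avg_mono fun z' => avg_mono fun x => ?_
    have e2 : 𝔼 y, m (z, z') x y * (P z z' * (F y z * G y z'))
        = P z z' * 𝔼 y, (f x y z * F y z) * (f x y z' * G y z') := by
      rw [Finset.mul_expect]
      exact avg_congr fun y => by simp only [hm]; ring
    rw [e2, mul_pow]
    exact mul_le_of_le_one_left (sq_nonneg _) ((sq_le_one_iff_abs_le_one _).2 (hP _ _))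
  -- Fibres over `X`.
  have hbd : ∀ {g : Y → Z → ℝ}, (∀ y z, |g y z| ≤ 1) → ∀ x z y, |f x y z * g y z| ≤ T x y z :=
    fun hg x z y => (abs_mul_le_mul (hf x y z) (hg y z)).trans_eq (mul_one _)
  obtain ⟨b, c, hb, hc, h10⟩ := h.fibreZY.exists_correlation (m := fun x z y => f x y z * F y z)
    (n := fun x z y => f x y z * G y z) (hbd hF) (hbd hG) pκ hκ1
    (hel.trans (mul_le_mul_of_nonneg_right (pow_le hd hd1 (by norm_num)) (sq_nonneg _))) h9
  refine ⟨c, b, F, fun x y => (hc x y).trans (le_one_of_zero_or_one (h.R₁01 _ _)),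
    fun x z => (hb x z).trans (le_one_of_zero_or_one (h.R₂01 _ _)), hF,
    le_of_eq_of_le (by ring) (h10.trans_eq ?_)⟩
  refine avg_congr fun x => ?_
  rw [avg_swap]
  exact avg_congr fun y => avg_congr fun z => by ring

end Triangles

/-! ### Box averages of three functions of two variables -/

section Cube

variable {X Y Z : Type*} [Fintype X] [Fintype Y] [Fintype Z] [Nonempty X] [Nonempty Y] [Nonempty Z]

open Triangles

/-- The density of triangles in three cut-uniform graphs. -/
theorem abs_avg_triangle_sub_le {R₁ : X → Y → ℝ} {R₂ : X → Z → ℝ} {R₃ : Y → Z → ℝ} {p q r ρ : ℝ}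
    (h₁ : CutUniform R₁ p ρ) (h₂ : CutUniform R₂ q ρ) (h₃ : CutUniform R₃ r ρ)
    (R₁1 : ∀ x y, |R₁ x y| ≤ 1) (R₂1 : ∀ x z, |R₂ x z| ≤ 1) (hp : 0 ≤ p) (hp1 : p ≤ 1)
    (hr : 0 ≤ r) (hr1 : r ≤ 1) :
    |(𝔼 x, 𝔼 y, 𝔼 z, R₁ x y * (R₂ x z * R₃ y z)) - p * q * r| ≤ 3 * ρ := by
  have a1 := h₃.replace (I := X) (φ := fun x y => R₁ x y) (ψ := fun x z => R₂ x z) R₁1 R₂1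
  have a2 := h₁.replace (I := Z) (φ := fun z x => R₂ x z) (ψ := fun _ _ => 1) (fun _ _ => R₂1 _ _)
    (by simp)
  have a3 := h₂ (fun _ => 1) (fun _ => 1) (by simp) (by simp)
  have hρ : 0 ≤ ρ := (abs_nonneg _).trans a3
  simp only [mul_one, Finset.expect_sub_distrib, Fintype.expect_const] at a2 a3
  have e1 : 𝔼 x, 𝔼 y, 𝔼 z, R₃ y z * (R₁ x y * R₂ x z)
      = 𝔼 x, 𝔼 y, 𝔼 z, R₁ x y * (R₂ x z * R₃ y z) :=
    avg_congr fun x => avg_congr fun y => avg_congr fun z => by ring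
  have e2 : 𝔼 z, 𝔼 x, 𝔼 y, R₁ x y * R₂ x z = 𝔼 x, 𝔼 y, 𝔼 z, R₁ x y * R₂ x z := avg_swap₁₂ _
  have e3 : 𝔼 z, 𝔼 x, R₂ x z = 𝔼 x, 𝔼 z, R₂ x z := avg_swap _
  rw [e1] at a1
  rw [e2, e3] at a2
  set E1 := 𝔼 x, 𝔼 y, 𝔼 z, R₁ x y * (R₂ x z * R₃ y z)
  set E2 := 𝔼 x, 𝔼 y, 𝔼 z, R₁ x y * R₂ x z
  set E3 := 𝔼 x, 𝔼 z, R₂ x z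
  have e4 : E1 - p * q * r = (E1 - r * E2) + (r * (E2 - p * E3) + r * p * (E3 - q)) := by ring
  rw [e4]
  have hrp : r * p ≤ 1 := mul_le_one₀ hr1 hp hp1
  refine (abs_add_le _ _).trans ?_
  have b := abs_add_le (r * (E2 - p * E3)) (r * p * (E3 - q))
  rw [abs_mul, abs_mul (r * p), abs_of_nonneg hr, abs_of_nonneg (mul_nonneg hr hp)] at b
  have c1 : r * |E2 - p * E3| ≤ 1 * ρ := mul_le_mul hr1 a2 (abs_nonneg _) zero_le_one
  have c2 : r * p * |E3 - q| ≤ 1 * ρ := mul_le_mul hrp a3 (abs_nonneg _) zero_le_one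
  linarith

/-- The density of octahedra in three cut-uniform graphs. -/
theorem cubeAvg_triangle_le {R₁ : X → Y → ℝ} {R₂ : X → Z → ℝ} {R₃ : Y → Z → ℝ} {p q r ρ : ℝ}
    (h₁ : CutUniform R₁ p ρ) (h₂ : CutUniform R₂ q ρ) (h₃ : CutUniform R₃ r ρ)
    (R₁01 : ∀ x y, R₁ x y = 0 ∨ R₁ x y = 1) (R₂01 : ∀ x z, R₂ x z = 0 ∨ R₂ x z = 1)
    (R₃01 : ∀ y z, R₃ y z = 0 ∨ R₃ y z = 1) (hp : 0 ≤ p) (hp1 : p ≤ 1) (hq : 0 ≤ q)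
    (hq1 : q ≤ 1) (hr : 0 ≤ r) (hr1 : r ≤ 1) :
    cubeAvg (fun x y z => R₁ x y * (R₂ x z * R₃ y z)) ≤ (p * q * r) ^ 4 + 12 * ρ := by
  have R₁1 : ∀ x y, |R₁ x y| ≤ 1 := fun x y => abs_le_one_of_zero_or_one (R₁01 x y)
  have R₂1 : ∀ x y, |R₂ x y| ≤ 1 := fun x y => abs_le_one_of_zero_or_one (R₂01 x y)
  have hρ : 0 ≤ ρ := (abs_nonneg _).trans (h₁ (fun _ => 0) (fun _ => 0) (by simp) (by simp))
  have hp2 : p ^ 2 ≤ 1 := pow_le_one₀ hp hp1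
  have hq2 : q ^ 2 ≤ 1 := pow_le_one₀ hq hq1
  set φ : Z → Z → Y → Y → ℝ := fun z z' y y' =>
    𝔼 x, R₂ x z * (R₂ x z' * (R₁ x y' * R₁ x y)) with hφ
  -- The edges at `x` are replaced by their densities one after the other.
  have hdev : 𝔼 z, 𝔼 z', 𝔼 y, 𝔼 y', |φ z z' y y' - p ^ 2 * q ^ 2| ≤ 4 * ρ := by
    have a1 := h₂.avg_abs_le (J := Z × Y × Y)
      (Ψ := fun j x => R₂ x j.1 * (R₁ x j.2.2 * R₁ x j.2.1))
      (fun j x => abs_mul_le_one (R₂1 _ _) (abs_mul_le_one (R₁1 _ _) (R₁1 _ _)))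
    have a2 := h₂.avg_abs_le (J := Y × Y)
      (Ψ := fun j x => R₁ x j.2 * R₁ x j.1) (fun j x => abs_mul_le_one (R₁1 _ _) (R₁1 _ _))
    have a3 := h₁.avg_abs_codeg hp hp1 R₁1
    simp only [avg_prod] at a1 a2
    have b1 : 𝔼 z', 𝔼 y, 𝔼 y', 𝔼 z, |φ z z' y y' - p ^ 2 * q ^ 2|
        ≤ 𝔼 z', 𝔼 y, 𝔼 y', 𝔼 z, (|φ z z' y y' - q * 𝔼 x, R₂ x z' * (R₁ x y' * R₁ x y)|
          + (q * |(𝔼 x, R₂ x z' * (R₁ x y' * R₁ x y)) - q * 𝔼 x, R₁ x y' * R₁ x y|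
          + q ^ 2 * |(𝔼 x, R₁ x y' * R₁ x y) - p ^ 2|)) := by
      refine avg_mono fun z' => avg_mono fun y => avg_mono fun y' => avg_mono fun z => ?_
      generalize φ z z' y y' = u
      generalize 𝔼 x, R₂ x z' * (R₁ x y' * R₁ x y) = v
      generalize 𝔼 x, R₁ x y' * R₁ x y = w
      have e : u - p ^ 2 * q ^ 2 = (u - q * v) + (q * (v - q * w) + q ^ 2 * (w - p ^ 2)) := by ring
      rw [e]
      refine (abs_add_le _ _).trans (add_le_add_right ((abs_add_le _ _).trans_eq ?_) _)
      rw [abs_mul, abs_mul, abs_of_nonneg hq, abs_of_nonneg (sq_nonneg q)]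
    simp only [Finset.expect_add_distrib, ← Finset.mul_expect, Fintype.expect_const] at b1
    have e1 : 𝔼 z, 𝔼 z', 𝔼 y, 𝔼 y', |φ z z' y y' - p ^ 2 * q ^ 2|
        = 𝔼 z', 𝔼 y, 𝔼 y', 𝔼 z, |φ z z' y y' - p ^ 2 * q ^ 2| := by
      rw [avg_swap]; exact avg_congr fun z' => avg_swap₁₂ _
    have e2 : 𝔼 z', 𝔼 y, 𝔼 y', |(𝔼 x, R₂ x z' * (R₁ x y' * R₁ x y)) - q * 𝔼 x, R₁ x y' * R₁ x y|
        = 𝔼 y, 𝔼 y', 𝔼 z', |(𝔼 x, R₂ x z' * (R₁ x y' * R₁ x y)) - q * 𝔼 x, R₁ x y' * R₁ x y| :=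
      avg_swap₁₂ _
    rw [← e2] at a2
    rw [e1]
    have c2 := mul_le_mul hq1 a2 (avg_nonneg fun _ => avg_nonneg fun _ => avg_nonneg fun _ =>
      abs_nonneg _) zero_le_one
    have c3 := mul_le_mul hq2 a3 (avg_nonneg fun _ => avg_nonneg fun _ => abs_nonneg _) zero_le_one
    linarith
  have hW := h₃.avg_cycle_le hr hr1 R₃01
  have h1 : cubeAvg (fun x y z => R₁ x y * (R₂ x z * R₃ y z))
      ≤ 𝔼 z, 𝔼 z', 𝔼 y, 𝔼 y', ((p ^ 2 * q ^ 2) ^ 2 * ((R₃ y z * R₃ y z') * (R₃ y' z * R₃ y' z'))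
        + 2 * |φ z z' y y' - p ^ 2 * q ^ 2|) := by
    refine avg_mono fun z => avg_mono fun z' => avg_mono fun y => avg_mono fun y' => ?_
    set W := (R₃ y z * R₃ y z') * (R₃ y' z * R₃ y' z') with hW
    have hW01 : W = 0 ∨ W = 1 := mul_zero_or_one (mul_zero_or_one (R₃01 _ _) (R₃01 _ _))
      (mul_zero_or_one (R₃01 _ _) (R₃01 _ _))
    have e1 : 𝔼 x, R₁ x y * (R₂ x z * R₃ y z) * (R₁ x y * (R₂ x z' * R₃ y z'))
        * (R₁ x y' * (R₂ x z * R₃ y' z) * (R₁ x y' * (R₂ x z' * R₃ y' z')))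
        = W * φ z z' y y' := by
      simp only [hφ, Finset.mul_expect]
      refine avg_congr fun x => ?_
      have e2 : ∀ x y, R₁ x y = R₁ x y * R₁ x y := fun x y => by
        rcases R₁01 x y with h | h <;> simp [h]
      have e3 : ∀ x y, R₂ x y = R₂ x y * R₂ x y := fun x y => by
        rcases R₂01 x y with h | h <;> simp [h]
      calc _ = W * ((R₂ x z * R₂ x z) * ((R₂ x z' * R₂ x z') * ((R₁ x y' * R₁ x y')
            * (R₁ x y * R₁ x y)))) := by rw [hW]; ring
        _ = _ := by rw [← e2, ← e2, ← e3, ← e3]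
    rw [e1, mul_pow, sq_of_zero_or_one hW01]
    have h7 : 0 ≤ φ z z' y y' := avg_nonneg fun x => nonneg_of_zero_or_one
      (mul_zero_or_one (R₂01 _ _) (mul_zero_or_one (R₂01 _ _)
        (mul_zero_or_one (R₁01 _ _) (R₁01 _ _))))
    have h8 : φ z z' y y' ≤ 1 := avg_le_of_le fun x => le_one_of_zero_or_one
      (mul_zero_or_one (R₂01 _ _) (mul_zero_or_one (R₂01 _ _)
        (mul_zero_or_one (R₁01 _ _) (R₁01 _ _))))
    generalize φ z z' y y' = u at h7 h8
    have hpq : p ^ 2 * q ^ 2 ≤ 1 := mul_le_one₀ hp2 (sq_nonneg _) hq2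
    have hpq0 : 0 ≤ p ^ 2 * q ^ 2 := by positivity
    generalize p ^ 2 * q ^ 2 = c at hpq hpq0
    have h9 : (u + c) * (u - c) ≤ 2 * |u - c| :=
      (mul_le_mul_of_nonneg_left (le_abs_self _) (by linarith)).trans
        (mul_le_mul_of_nonneg_right (by linarith) (abs_nonneg _))
    rcases hW01 with h | h <;> rw [h]
    · have := abs_nonneg (u - c); linarith
    · linarith
  simp only [Finset.expect_add_distrib] at h1
  have e1 : 𝔼 z, 𝔼 z', 𝔼 y, 𝔼 y', 2 * |φ z z' y y' - p ^ 2 * q ^ 2|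
      = 2 * 𝔼 z, 𝔼 z', 𝔼 y, 𝔼 y', |φ z z' y y' - p ^ 2 * q ^ 2| := by
    simp only [Finset.mul_expect]
  have e2 : 𝔼 z, 𝔼 z', 𝔼 y, 𝔼 y', (p ^ 2 * q ^ 2) ^ 2 *
        ((R₃ y z * R₃ y z') * (R₃ y' z * R₃ y' z'))
      = (p ^ 2 * q ^ 2) ^ 2 * 𝔼 z, 𝔼 z', 𝔼 y, 𝔼 y', (R₃ y z * R₃ y z') * (R₃ y' z * R₃ y' z') := by
    simp only [Finset.mul_expect]
  rw [e1, e2] at h1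
  have h2 : (p ^ 2 * q ^ 2) ^ 2 * (𝔼 z, 𝔼 z', 𝔼 y, 𝔼 y', (R₃ y z * R₃ y z') * (R₃ y' z * R₃ y' z'))
      ≤ (p ^ 2 * q ^ 2) ^ 2 * (r ^ 4 + 4 * ρ) := mul_le_mul_of_nonneg_left hW (sq_nonneg _)
  have h3 : (p ^ 2 * q ^ 2) ^ 2 * ρ ≤ 1 * ρ :=
    mul_le_mul_of_nonneg_right (pow_le_one₀ (by positivity) (mul_le_one₀ hp2 (sq_nonneg _) hq2)) hρ
  have e : (p * q * r) ^ 4 = (p ^ 2 * q ^ 2) ^ 2 * r ^ 4 := by ring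
  rw [e]
  linarith

/-- A set of triangles has at least about as many octahedra as a random set of the same density. -/
theorem cubeAvg_ge {R₁ : X → Y → ℝ} {R₂ : X → Z → ℝ} {R₃ : Y → Z → ℝ} {T : X → Y → Z → ℝ}
    (R₁01 : ∀ x y, R₁ x y = 0 ∨ R₁ x y = 1) (R₂01 : ∀ x z, R₂ x z = 0 ∨ R₂ x z = 1)
    (R₃01 : ∀ y z, R₃ y z = 0 ∨ R₃ y z = 1) (T01 : ∀ x y z, T x y z = 0 ∨ T x y z = 1)
    (T₁ : ∀ x y z, T x y z ≤ R₁ x y) (T₂ : ∀ x y z, T x y z ≤ R₂ x z)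
    (T₃ : ∀ x y z, T x y z ≤ R₃ y z) :
    (𝔼 x, 𝔼 y, 𝔼 z, T x y z) ^ 8 ≤ (𝔼 x, 𝔼 y, R₁ x y) ^ 4
      * (𝔼 z, 𝔼 z', 𝔼 x, R₂ x z * R₂ x z') ^ 2
      * (𝔼 z, 𝔼 z', 𝔼 y, 𝔼 y', (R₃ y z * R₃ y z') * (R₃ y' z * R₃ y' z')) * cubeAvg T := by
  have T0 : ∀ x y z, 0 ≤ T x y z := fun x y z => nonneg_of_zero_or_one (T01 x y z)
  have absorb : ∀ a b : ℝ, (a = 0 ∨ a = 1) → (b = 0 ∨ b = 1) → b ≤ a → a * b = b := by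
    rintro a b (rfl | rfl) (rfl | rfl) h <;> first | (norm_num; done) | (norm_num at h)
  have A₁ : ∀ x y z, R₁ x y * T x y z = T x y z := fun x y z =>
    absorb _ _ (R₁01 x y) (T01 x y z) (T₁ x y z)
  have A₂ : ∀ x y z, R₂ x z * T x y z = T x y z := fun x y z =>
    absorb _ _ (R₂01 x z) (T01 x y z) (T₂ x y z)
  have A₃ : ∀ x y z, R₃ y z * T x y z = T x y z := fun x y z =>
    absorb _ _ (R₃01 y z) (T01 x y z) (T₃ x y z)
  have W01 : ∀ z z' y y', (R₃ y z * R₃ y z') * (R₃ y' z * R₃ y' z') = 0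
      ∨ (R₃ y z * R₃ y z') * (R₃ y' z * R₃ y' z') = 1 := fun z z' y y' =>
    mul_zero_or_one (mul_zero_or_one (R₃01 _ _) (R₃01 _ _))
      (mul_zero_or_one (R₃01 _ _) (R₃01 _ _))
  have S₁ : ∀ x y, R₁ x y ^ 2 = R₁ x y := fun x y => sq_of_zero_or_one (R₁01 x y)
  have S₂ : ∀ z z' x, (R₂ x z * R₂ x z') ^ 2 = R₂ x z * R₂ x z' := fun z z' x =>
    sq_of_zero_or_one (mul_zero_or_one (R₂01 _ _) (R₂01 _ _))
  have S₃ : ∀ z z' y y', ((R₃ y z * R₃ y z') * (R₃ y' z * R₃ y' z')) ^ 2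
      = (R₃ y z * R₃ y z') * (R₃ y' z * R₃ y' z') := fun z z' y y' =>
    sq_of_zero_or_one (W01 z z' y y')
  have B₂ : ∀ z z' x y, R₂ x z * R₂ x z' * (T x y z * T x y z') = T x y z * T x y z' := by
    intro z z' x y
    rw [mul_mul_mul_comm, A₂, A₂]
  have B₃ : ∀ z z' y y' x, (R₃ y z * R₃ y z') * (R₃ y' z * R₃ y' z') *
      ((T x y z * T x y z') * (T x y' z * T x y' z'))
      = (T x y z * T x y z') * (T x y' z * T x y' z') := by
    intro z z' y y' x
    rw [mul_mul_mul_comm, mul_mul_mul_comm (R₃ y z), mul_mul_mul_comm (R₃ y' z), A₃, A₃, A₃, A₃]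
  set G := 𝔼 z, 𝔼 z', 𝔼 x, 𝔼 y, T x y z * T x y z' with hG
  set M := 𝔼 z, 𝔼 z', 𝔼 y, 𝔼 y', 𝔼 x, (T x y z * T x y z') * (T x y' z * T x y' z') with hM
  set W := 𝔼 z, 𝔼 z', 𝔼 y, 𝔼 y', (R₃ y z * R₃ y z') * (R₃ y' z * R₃ y' z') with hW
  set N₁ := 𝔼 x, 𝔼 y, R₁ x y with hN₁
  set N₂ := 𝔼 z, 𝔼 z', 𝔼 x, R₂ x z * R₂ x z' with hN₂
  -- Each vertex is doubled by a Cauchy–Schwarz inequality whose weight is a graph containing `T`.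
  have h1 : (𝔼 x, 𝔼 y, 𝔼 z, T x y z) ^ 2 ≤ N₁ * G := by
    have a := avg_cauchy₂ R₁ (fun x y => 𝔼 z, T x y z)
    have e : ∀ x y, R₁ x y * 𝔼 z, T x y z = 𝔼 z, T x y z := fun x y => by
      rw [Finset.mul_expect]; exact avg_congr fun z => A₁ x y z
    simp only [e, S₁] at a
    refine a.trans_eq ?_
    congr 1
    simp only [avg_sq_eq, hG]
    exact avg_swap₂₂ fun x y z z' => T x y z * T x y z'
  have h2 : G ^ 2 ≤ N₂ * M := by
    have a := avg_cauchy₃ (fun z z' x => R₂ x z * R₂ x z') (fun z z' x => 𝔼 y, T x y z * T x y z')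
    have e : ∀ z z' x, R₂ x z * R₂ x z' * (𝔼 y, T x y z * T x y z')
        = 𝔼 y, T x y z * T x y z' := fun z z' x => by
      rw [Finset.mul_expect]; exact avg_congr fun y => B₂ z z' x y
    simp only [e, S₂] at a
    refine a.trans_eq ?_
    congr 1
    simp only [avg_sq_eq, hM]
    exact avg_congr fun z => avg_congr fun z' =>
      avg_swap₁₂ fun x y y' => T x y z * T x y z' * (T x y' z * T x y' z')
  have h3 : M ^ 2 ≤ W * cubeAvg T := by
    have a := avg_cauchy₄ (fun z z' y y' => (R₃ y z * R₃ y z') * (R₃ y' z * R₃ y' z'))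
      (fun z z' y y' => 𝔼 x, (T x y z * T x y z') * (T x y' z * T x y' z'))
    have e : ∀ z z' y y', (R₃ y z * R₃ y z') * (R₃ y' z * R₃ y' z') *
        (𝔼 x, (T x y z * T x y z') * (T x y' z * T x y' z'))
        = 𝔼 x, (T x y z * T x y z') * (T x y' z * T x y' z') := fun z z' y y' => by
      rw [Finset.mul_expect]; exact avg_congr fun x => B₃ z z' y y' x
    simp only [e, S₃] at a
    exact a
  have hE0 : 0 ≤ 𝔼 x, 𝔼 y, 𝔼 z, T x y z :=
    avg_nonneg fun _ => avg_nonneg fun _ => avg_nonneg fun _ => T0 _ _ _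
  have hN₁0 : 0 ≤ N₁ := avg_nonneg fun _ => avg_nonneg fun _ => nonneg_of_zero_or_one (R₁01 _ _)
  have hN₂0 : 0 ≤ N₂ := avg_nonneg fun _ => avg_nonneg fun _ => avg_nonneg fun _ =>
    nonneg_of_zero_or_one (mul_zero_or_one (R₂01 _ _) (R₂01 _ _))
  have i1 := pow_le_pow_left₀ (sq_nonneg _) h1 4
  have i2 := pow_le_pow_left₀ (sq_nonneg _) h2 2
  calc _ = ((𝔼 x, 𝔼 y, 𝔼 z, T x y z) ^ 2) ^ 4 := by ring
    _ ≤ (N₁ * G) ^ 4 := i1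
    _ = N₁ ^ 4 * (G ^ 2) ^ 2 := by ring
    _ ≤ N₁ ^ 4 * (N₂ * M) ^ 2 := mul_le_mul_of_nonneg_left i2 (by positivity)
    _ = N₁ ^ 4 * N₂ ^ 2 * M ^ 2 := by ring
    _ ≤ N₁ ^ 4 * N₂ ^ 2 * (W * cubeAvg T) := mul_le_mul_of_nonneg_left h3 (by positivity)
    _ = _ := by ring

end Cube

/-! ### The Gowers–Cauchy–Schwarz inequality with one exceptional vertex -/

section Gowers

variable {X Y Z : Type*} [Fintype X] [Fintype Y] [Fintype Z]

theorem avg_swap₂₄ {ι κ μ ν ξ ο : Type*} [Fintype ι] [Fintype κ] [Fintype μ] [Fintype ν]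
    [Fintype ξ] [Fintype ο] (F : ι → κ → μ → ν → ξ → ο → ℝ) :
    𝔼 i, 𝔼 j, 𝔼 k, 𝔼 l, 𝔼 n, 𝔼 o, F i j k l n o
      = 𝔼 k, 𝔼 l, 𝔼 n, 𝔼 o, 𝔼 i, 𝔼 j, F i j k l n o := by
  simpa only [avg_prod] using
    avg_swap (fun (x : ι × κ) (y : μ × ν × ξ × ο) => F x.1 x.2 y.1 y.2.1 y.2.2.1 y.2.2.2)

theorem cubeAvg_eq_row (f : X → Y → Z → ℝ) :
    cubeAvg f = 𝔼 z, 𝔼 z', 𝔼 x, 𝔼 x', (𝔼 y, (f x y z * f x' y z) * (f x y z' * f x' y z')) ^ 2 := by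
  unfold cubeAvg
  simp only [avg_sq_eq]
  refine avg_congr fun z => avg_congr fun z' => ?_
  rw [avg_swap₂₂]
  exact avg_congr fun x => avg_congr fun x' => avg_congr fun y => avg_congr fun y' => by ring

theorem cubeAvg_eq_column (f : X → Y → Z → ℝ) :
    cubeAvg f = 𝔼 x, 𝔼 x', 𝔼 y, 𝔼 y', (𝔼 z, (f x y z * f x' y z) * (f x y' z * f x' y' z)) ^ 2 := by
  rw [cubeAvg_eq_row]
  simp only [avg_sq_eq]
  rw [avg_swap₂₄]
  exact avg_congr fun x => avg_congr fun x' => avg_congr fun y => avg_congr fun y' =>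
    avg_congr fun z => avg_congr fun z' => by ring

theorem cubeAvg_nonneg (f : X → Y → Z → ℝ) : 0 ≤ cubeAvg f :=
  avg_nonneg fun _ => avg_nonneg fun _ => avg_nonneg fun _ => avg_nonneg fun _ => sq_nonneg _

/-- The average over boxes of the product of `g` at one vertex and `f` at the others. -/
noncomputable def cubeInner (g f : X → Y → Z → ℝ) : ℝ :=
  𝔼 z, 𝔼 z', 𝔼 y, 𝔼 y', (𝔼 x, (g x y z * f x y z') * (f x y' z * f x y' z'))
    * 𝔼 x, (f x y z * f x y z') * (f x y' z * f x y' z')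

theorem cubeInner_self (f : X → Y → Z → ℝ) : cubeInner f f = cubeAvg f := by
  simp only [cubeInner, cubeAvg, sq]

theorem cubeInner_add_smul (g k f : X → Y → Z → ℝ) (d : ℝ) :
    cubeInner (fun x y z => g x y z + d * k x y z) f = cubeInner g f + d * cubeInner k f := by
  simp only [cubeInner, Finset.mul_expect, ← Finset.expect_add_distrib, Finset.expect_mul]
  refine avg_congr fun z => avg_congr fun z' => avg_congr fun y => avg_congr fun y' =>
    avg_congr fun x => avg_congr fun x' => by ring

/-- The Gowers–Cauchy–Schwarz inequality for a box with `g` at one vertex and `f` at the others. -/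
theorem cubeInner_pow_le (g f : X → Y → Z → ℝ) :
    cubeInner g f ^ 8 ≤ cubeAvg g * cubeAvg f ^ 7 := by
  set N := cubeAvg f with hN
  have hN0 : 0 ≤ N := cubeAvg_nonneg f
  set Q₁ := 𝔼 z, 𝔼 z', 𝔼 y, 𝔼 y', (𝔼 x, (g x y z * f x y z') * (f x y' z * f x y' z')) ^ 2 with hQ₁
  set Q₂ := 𝔼 z, 𝔼 z', 𝔼 x, 𝔼 x', (𝔼 y, (g x y z * g x' y z) * (f x y z' * f x' y z')) ^ 2 with hQ₂
  have h1 : cubeInner g f ^ 2 ≤ Q₁ * N :=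
    avg_cauchy₄ (fun z z' y y' => 𝔼 x, (g x y z * f x y z') * (f x y' z * f x y' z'))
      (fun z z' y y' => 𝔼 x, (f x y z * f x y z') * (f x y' z * f x y' z'))
  have h2 : Q₁ ^ 2 ≤ Q₂ * N := by
    have e : Q₁ = 𝔼 z, 𝔼 z', 𝔼 x, 𝔼 x', (𝔼 y, (g x y z * g x' y z) * (f x y z' * f x' y z'))
        * 𝔼 y, (f x y z * f x' y z) * (f x y z' * f x' y z') := by
      simp only [hQ₁, avg_sq_eq]
      refine avg_congr fun z => avg_congr fun z' => ?_
      rw [avg_swap₂₂]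
      refine avg_congr fun x => avg_congr fun x' => ?_
      rw [Finset.expect_mul_expect]
      exact avg_congr fun y => avg_congr fun y' => by ring
    rw [e, hN, cubeAvg_eq_row f]
    exact avg_cauchy₄ _ _
  have h3 : Q₂ ^ 2 ≤ cubeAvg g * N := by
    have e : Q₂ = 𝔼 x, 𝔼 x', 𝔼 y, 𝔼 y', (𝔼 z, (g x y z * g x' y z) * (g x y' z * g x' y' z))
        * 𝔼 z, (f x y z * f x' y z) * (f x y' z * f x' y' z) := by
      simp only [hQ₂, avg_sq_eq]
      rw [avg_swap₂₄]
      refine avg_congr fun x => avg_congr fun x' => avg_congr fun y => avg_congr fun y' => ?_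
      rw [Finset.expect_mul_expect]
      exact avg_congr fun z => avg_congr fun z' => by ring
    rw [e, hN, cubeAvg_eq_column f, cubeAvg_eq_column g]
    exact avg_cauchy₄ _ _
  have i1 := pow_le_pow_left₀ (sq_nonneg _) h1 4
  have i2 := pow_le_pow_left₀ (sq_nonneg _) h2 2
  calc cubeInner g f ^ 8 = (cubeInner g f ^ 2) ^ 4 := by ring
    _ ≤ (Q₁ * N) ^ 4 := i1
    _ = (Q₁ ^ 2) ^ 2 * N ^ 4 := by ring
    _ ≤ (Q₂ * N) ^ 2 * N ^ 4 := mul_le_mul_of_nonneg_right i2 (by positivity)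
    _ = Q₂ ^ 2 * N ^ 6 := by ring
    _ ≤ (cubeAvg g * N) * N ^ 6 := mul_le_mul_of_nonneg_right h3 (by positivity)
    _ = _ := by ring

/-- A form of the triangle inequality for the box norm. -/
theorem cubeAvg_le_of_sub {f k : X → Y → Z → ℝ} {d ε : ℝ} (hd : 0 ≤ d) (hε : 0 ≤ ε)
    (h : cubeAvg (fun x y z => f x y z - d * k x y z) ≤ ε ^ 8 * cubeAvg k) :
    cubeAvg f ≤ (d + ε) ^ 8 * cubeAvg k := by
  obtain ⟨n, hn0, hn⟩ : ∃ n : ℝ, 0 ≤ n ∧ n ^ 8 = cubeAvg f :=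
    ⟨cubeAvg f ^ ((8 : ℕ) : ℝ)⁻¹, Real.rpow_nonneg (cubeAvg_nonneg f) _,
      Real.rpow_inv_natCast_pow (cubeAvg_nonneg f) (by norm_num)⟩
  obtain ⟨m, hm0, hm⟩ : ∃ n : ℝ, 0 ≤ n ∧ n ^ 8 = cubeAvg k :=
    ⟨cubeAvg k ^ ((8 : ℕ) : ℝ)⁻¹, Real.rpow_nonneg (cubeAvg_nonneg k) _,
      Real.rpow_inv_natCast_pow (cubeAvg_nonneg k) (by norm_num)⟩
  have h1 : cubeAvg f = cubeInner (fun x y z => f x y z - d * k x y z) f + d * cubeInner k f := by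
    rw [← cubeInner_add_smul, ← cubeInner_self]
    congr 1
    funext x y z
    ring
  have h2 : cubeInner (fun x y z => f x y z - d * k x y z) f ≤ ε * m * n ^ 7 := by
    refine le_of_pow_le_pow_left₀ (n := 8) (by norm_num) (by positivity) ?_
    refine (cubeInner_pow_le _ _).trans ((mul_le_mul_of_nonneg_right h
      (pow_nonneg (cubeAvg_nonneg f) 7)).trans_eq ?_)
    rw [← hm, ← hn]; ring
  have h3 : cubeInner k f ≤ m * n ^ 7 := by
    refine le_of_pow_le_pow_left₀ (n := 8) (by norm_num) (by positivity) ?_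
    refine (cubeInner_pow_le _ _).trans_eq ?_
    rw [← hm, ← hn]; ring
  have h4 : n ^ 7 * n ≤ n ^ 7 * ((d + ε) * m) := by
    have := mul_le_mul_of_nonneg_left h3 hd
    have e : n ^ 7 * n = cubeAvg f := by rw [← hn]; ring
    rw [e, h1]
    linarith
  rw [← hn, ← hm, ← mul_pow]
  rcases hn0.eq_or_lt with h0 | h0
  · rw [← h0, zero_pow (by norm_num)]; positivity
  · exact pow_le_pow_left₀ hn0 (le_of_mul_le_mul_left h4 (by positivity)) 8

end Gowers

/-! ### Correlation in the sparse and in the dense regime -/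

section Gain

open Triangles

theorem gain_pos {l : ℝ} (hl : 0 < l) : 0 < gain l := by unfold gain; positivity

theorem gain_mono {l m : ℝ} (hl : 0 ≤ l) (h : l ≤ m) : gain l ≤ gain m := by
  unfold gain; gcongr

theorem gain_le_one {l : ℝ} (hl : 0 ≤ l) (h : l ≤ 1) : gain l ≤ 1 := by
  refine (gain_mono hl h).trans ?_
  norm_num [gain]

/-- The relative density of `T` in the set of triangles below which `T` itself is treated as the
pseudorandom set. -/
noncomputable def densityThreshold (t : ℝ) : ℝ := gain (t ^ 8 / 2) ^ 8 / 64 ^ 7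

/-- The gain available in both regimes. -/
noncomputable def uniformGain (t : ℝ) : ℝ := gain (t ^ 8 * densityThreshold t ^ 8 / 2)

/-- The density of `T` below which the errors in the pseudorandomness of the three graphs are
negligible. -/
noncomputable def sparseThreshold (t : ℝ) : ℝ := uniformGain t ^ 8 / 64 ^ 7

variable {t : ℝ}

theorem densityThreshold_pos (ht : 0 < t) : 0 < densityThreshold t := by
  have := gain_pos (show 0 < t ^ 8 / 2 by positivity)
  unfold densityThreshold; positivity

theorem densityThreshold_le_one (ht : 0 < t) (ht1 : t ≤ 1) : densityThreshold t ≤ 1 := by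
  have h8 : t ^ 8 ≤ 1 := pow_le_one₀ ht.le ht1
  have h1 : gain (t ^ 8 / 2) ^ 8 ≤ 1 := pow_le_one₀ (gain_pos (by positivity)).le
    (gain_le_one (by positivity) (by linarith))
  unfold densityThreshold
  linarith

theorem uniformGain_pos (ht : 0 < t) : 0 < uniformGain t := by
  have := densityThreshold_pos ht
  exact gain_pos (by positivity)

theorem uniformGain_le (ht : 0 < t) (ht1 : t ≤ 1) : uniformGain t ≤ gain (t ^ 8 / 2) := by
  have h1 := densityThreshold_pos ht
  have h2 : densityThreshold t ^ 8 ≤ 1 := pow_le_one₀ h1.le (densityThreshold_le_one ht ht1)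
  refine gain_mono (by positivity) ?_
  have := mul_le_of_le_one_right (show 0 ≤ t ^ 8 by positivity) h2
  linarith

theorem uniformGain_le_one (ht : 0 < t) (ht1 : t ≤ 1) : uniformGain t ≤ 1 := by
  have h8 : t ^ 8 ≤ 1 := pow_le_one₀ ht.le ht1
  exact (uniformGain_le ht ht1).trans (gain_le_one (by positivity) (by linarith))

theorem sparseThreshold_pos (ht : 0 < t) : 0 < sparseThreshold t := by
  have := uniformGain_pos ht
  unfold sparseThreshold; positivity

theorem sparseThreshold_le_one (ht : 0 < t) (ht1 : t ≤ 1) : sparseThreshold t ≤ 1 := by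
  have h1 : uniformGain t ^ 8 ≤ 1 := pow_le_one₀ (uniformGain_pos ht).le (uniformGain_le_one ht ht1)
  unfold sparseThreshold
  linarith

end Gain

section Regimes

open Triangles

variable {X Y Z : Type*} [Fintype X] [Fintype Y] [Fintype Z] [Nonempty X] [Nonempty Y] [Nonempty Z]
  {R₁ : X → Y → ℝ} {R₂ : X → Z → ℝ} {R₃ : Y → Z → ℝ} {T f : X → Y → Z → ℝ} {p q r d ρ : ℝ}

theorem le_mul_of_zero_or_one {t a b : ℝ} (ht : t = 0 ∨ t = 1) (h : t ≤ a) (h' : t ≤ b) :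
    t ≤ a * b := by
  refine le_of_eq_of_le ?_ (mul_le_mul_of_zero_or_one ht ht h h')
  rcases ht with rfl | rfl <;> norm_num

theorem one_add_pow_eight_le {u : ℝ} (u0 : 0 ≤ u) (u1 : u ≤ 1) : (1 + u) ^ 8 ≤ 1 + 255 * u := by
  have v : ∀ k, 1 ≤ k → u ^ k ≤ u := fun k hk => pow_le_of_le_one u0 u1 (by omega)
  have e1 : (1 + u) ^ 8 = 1 + 8 * u + 28 * u ^ 2 + 56 * u ^ 3 + 70 * u ^ 4 + 56 * u ^ 5
    + 28 * u ^ 6 + 8 * u ^ 7 + u ^ 8 := by ring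
  rw [e1]
  linarith [v 2 (by norm_num), v 3 (by norm_num), v 4 (by norm_num), v 5 (by norm_num),
    v 6 (by norm_num), v 7 (by norm_num), v 8 (by norm_num)]

/-- A set of triangles of three cut-uniform graphs has at least about the expected number of
octahedra. -/
theorem cubeAvg_ge_of_cut (R₁01 : ∀ x y, R₁ x y = 0 ∨ R₁ x y = 1)
    (R₂01 : ∀ x z, R₂ x z = 0 ∨ R₂ x z = 1) (R₃01 : ∀ y z, R₃ y z = 0 ∨ R₃ y z = 1)
    (T01 : ∀ x y z, T x y z = 0 ∨ T x y z = 1) (T₁ : ∀ x y z, T x y z ≤ R₁ x y)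
    (T₂ : ∀ x y z, T x y z ≤ R₂ x z) (T₃ : ∀ x y z, T x y z ≤ R₃ y z)
    (h₁ : CutUniform R₁ p ρ) (h₂ : CutUniform R₂ q ρ) (h₃ : CutUniform R₃ r ρ)
    (hp : 0 < p) (hq : 0 < q) (hr : 0 < r) (hd : 0 < d) (hq1 : q ≤ 1) (hr1 : r ≤ 1)
    (hρ₁ : ρ ≤ p / 64) (hρ₂ : ρ ≤ q ^ 2 / 128) (hρ₃ : ρ ≤ r ^ 4 / 256)
    (hT : (1 - 1 / 64) * (d * p * q * r) ≤ 𝔼 x, 𝔼 y, 𝔼 z, T x y z) :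
    d ^ 8 * (p * q * r) ^ 4 / 2 ≤ cubeAvg T := by
  have h := cubeAvg_ge R₁01 R₂01 R₃01 T01 T₁ T₂ T₃
  have b1 : 𝔼 x, 𝔼 y, R₁ x y ≤ (1 + 1 / 64) * p := by
    have := avg_le_of_avg_abs_sub_le h₁.avg_abs_deg
    rw [avg_swap] at this
    linarith
  have b2 : 𝔼 z, 𝔼 z', 𝔼 x, R₂ x z * R₂ x z' ≤ (1 + 1 / 64) * q ^ 2 := by
    have a := h₂.avg_abs_codeg hq.le hq1 (fun x z => abs_le_one_of_zero_or_one (R₂01 x z))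
    have := avg_le_of_avg_abs_sub_le (f := fun s : Z × Z => 𝔼 x, R₂ x s.2 * R₂ x s.1)
      (c := q ^ 2) (d := 2 * ρ) (by simpa only [avg_prod] using a)
    rw [avg_prod, avg_swap] at this
    linarith
  have b3 := h₃.avg_cycle_le hr.le hr1 R₃01
  have b3' : 𝔼 z, 𝔼 z', 𝔼 y, 𝔼 y', (R₃ y z * R₃ y z') * (R₃ y' z * R₃ y' z')
      ≤ (1 + 1 / 64) * r ^ 4 := by linarith
  have n1 : 0 ≤ 𝔼 x, 𝔼 y, R₁ x y :=
    avg_nonneg fun _ => avg_nonneg fun _ => nonneg_of_zero_or_one (R₁01 _ _)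
  have n2 : 0 ≤ 𝔼 z, 𝔼 z', 𝔼 x, R₂ x z * R₂ x z' :=
    avg_nonneg fun _ => avg_nonneg fun _ => avg_nonneg fun _ =>
      nonneg_of_zero_or_one (mul_zero_or_one (R₂01 _ _) (R₂01 _ _))
  have n3 : 0 ≤ 𝔼 z, 𝔼 z', 𝔼 y, 𝔼 y', (R₃ y z * R₃ y z') * (R₃ y' z * R₃ y' z') :=
    avg_nonneg fun _ => avg_nonneg fun _ => avg_nonneg fun _ => avg_nonneg fun _ =>
      nonneg_of_zero_or_one (mul_zero_or_one (mul_zero_or_one (R₃01 _ _) (R₃01 _ _))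
        (mul_zero_or_one (R₃01 _ _) (R₃01 _ _)))
  have n4 : 0 ≤ cubeAvg T := cubeAvg_nonneg T
  set Q := p * q * r with hQ
  have hQ0 : 0 < Q := by positivity
  have h1 : ((1 - 1 / 64) * (d * p * q * r)) ^ 8
      ≤ ((1 + 1 / 64) * p) ^ 4 * ((1 + 1 / 64) * q ^ 2) ^ 2 * ((1 + 1 / 64) * r ^ 4)
        * cubeAvg T := by
    refine (pow_le_pow_left₀ (mul_nonneg (by norm_num) (by positivity)) hT 8).trans (h.trans ?_)
    gcongr
  have e1 : ((1 - 1 / 64) * (d * p * q * r)) ^ 8 = Q ^ 4 * ((1 - 1 / 64) ^ 8 * (d ^ 8 * Q ^ 4)) := by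
    rw [hQ]; ring
  have e2 : ((1 + 1 / 64) * p) ^ 4 * ((1 + 1 / 64) * q ^ 2) ^ 2 * ((1 + 1 / 64) * r ^ 4)
        * cubeAvg T = Q ^ 4 * ((1 + 1 / 64) ^ 7 * cubeAvg T) := by rw [hQ]; ring
  rw [e1, e2] at h1
  have h2 := le_of_mul_le_mul_left h1 (by positivity)
  have h3 : 0 < d ^ 8 * Q ^ 4 := by positivity
  norm_num at h2
  linarith

/-- If `T` occupies a set of triangles of three cut-uniform graphs in a uniform way, then relative
box norms are controlled by correlations, whatever the density of `T`. If `T` has small density in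
the set of triangles, the error `d ^ 64` is small compared with `d`, and the result for
pseudorandom sets of triangles applies to `T`; otherwise it applies to the set of all triangles. -/
theorem exists_correlation_of_sparse (R₁01 : ∀ x y, R₁ x y = 0 ∨ R₁ x y = 1)
    (R₂01 : ∀ x z, R₂ x z = 0 ∨ R₂ x z = 1) (R₃01 : ∀ y z, R₃ y z = 0 ∨ R₃ y z = 1)
    (T01 : ∀ x y z, T x y z = 0 ∨ T x y z = 1) (T₁ : ∀ x y z, T x y z ≤ R₁ x y)
    (T₂ : ∀ x y z, T x y z ≤ R₂ x z) (T₃ : ∀ x y z, T x y z ≤ R₃ y z)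
    (hf : ∀ x y z, |f x y z| ≤ T x y z)
    (h₁ : CutUniform R₁ p ρ) (h₂ : CutUniform R₂ q ρ) (h₃ : CutUniform R₃ r ρ)
    (hp1 : p ≤ 1) (hq1 : q ≤ 1) (hr1 : r ≤ 1) (hd1 : d ≤ 1) {P t : ℝ} (hP : 0 < P)
    (hPp : P ≤ p) (hPq : P ≤ q) (hPr : P ≤ r) (hPd : P ≤ d) (ht : 0 < t) (ht1 : t ≤ 1)
    (hPt : P ≤ sparseThreshold t) (hρ : ρ ≤ P ^ 64)
    (hT : 𝔼 x, 𝔼 y, 𝔼 z, T x y z = d * 𝔼 x, 𝔼 y, 𝔼 z, R₁ x y * (R₂ x z * R₃ y z))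
    (hcube : cubeAvg T
      ≤ (d + d ^ 64) ^ 8 * cubeAvg (fun x y z => R₁ x y * (R₂ x z * R₃ y z)))
    (hL : t ^ 8 * cubeAvg T ≤ cubeAvg f) :
    ∃ (a : X → Y → ℝ) (b : X → Z → ℝ) (c : Y → Z → ℝ), (∀ x y, |a x y| ≤ 1) ∧
      (∀ x z, |b x z| ≤ 1) ∧ (∀ y z, |c y z| ≤ 1) ∧
      uniformGain t ^ 2 / 64 * (𝔼 x, 𝔼 y, 𝔼 z, T x y z)
        ≤ 𝔼 x, 𝔼 y, 𝔼 z, f x y z * (a x y * (b x z * c y z)) := by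
  set K : X → Y → Z → ℝ := fun x y z => R₁ x y * (R₂ x z * R₃ y z) with hK
  have hp : 0 < p := hP.trans_le hPp
  have hq : 0 < q := hP.trans_le hPq
  have hr : 0 < r := hP.trans_le hPr
  have hd : 0 < d := hP.trans_le hPd
  have hP1 : P ≤ 1 := hPp.trans hp1
  obtain ⟨κ₁, hκ₁⟩ : ∃ x, x = gain (t ^ 8 / 2) := ⟨_, rfl⟩
  obtain ⟨κ₀, hκ₀⟩ : ∃ x, x = uniformGain t := ⟨_, rfl⟩
  have hκ₀p : 0 < κ₀ := hκ₀ ▸ uniformGain_pos ht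
  have hκ₀1 : κ₀ ≤ 1 := hκ₀ ▸ uniformGain_le_one ht ht1
  have hκ₁₀ : κ₀ ≤ κ₁ := by rw [hκ₀, hκ₁]; exact uniformGain_le ht ht1
  have hκ₁p : 0 < κ₁ := hκ₀p.trans_le hκ₁₀
  have ht8 : t ^ 8 ≤ 1 := pow_le_one₀ ht.le ht1
  have hκ₁1 : κ₁ ≤ 1 := by rw [hκ₁]; exact gain_le_one (by positivity) (by linarith)
  rw [sparseThreshold, ← hκ₀] at hPt
  rw [← hκ₀]
  have hρ0 : 0 ≤ ρ := (abs_nonneg _).trans (h₁ (fun _ => 0) (fun _ => 0) (by simp) (by simp))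
  -- All errors are bounded through `ρ ≤ P ^ 40 * κ₀ ^ 8 / 64 ^ 7`.
  have hρ' : ρ ≤ P ^ 40 * (κ₀ ^ 8 / 64 ^ 7) := by
    refine hρ.trans ?_
    have h24 : P ^ 24 ≤ P := pow_le_of_le_one hP.le hP1 (by norm_num)
    calc P ^ 64 = P ^ 40 * P ^ 24 := by ring
      _ ≤ _ := by gcongr; exact h24.trans hPt
  have hpqr : P ^ 3 ≤ p * q * r := by
    calc P ^ 3 = P * P * P := by ring
      _ ≤ _ := by gcongr
  have hPk : ∀ {k}, k ≤ 40 → P ^ 40 ≤ P ^ k := fun hk => pow_le_pow_of_le_one hP.le hP1 hk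
  have hκ8 : κ₀ ^ 8 / 64 ^ 7 ≤ 1 / 64 ^ 3 := by
    have := pow_le_one₀ (n := 8) hκ₀p.le hκ₀1; linarith
  have hρk : ∀ {k} {x : ℝ}, k ≤ 40 → P ^ k ≤ x → ρ ≤ x / 64 ^ 3 := by
    intro k x hk hx
    refine hρ'.trans ?_
    calc P ^ 40 * (κ₀ ^ 8 / 64 ^ 7) ≤ x * (1 / 64 ^ 3) := by
          have h1 := (hPk hk).trans hx
          have h0 : 0 ≤ x := le_trans (by positivity) h1
          gcongr
      _ = _ := by ring
  have hρQ := hρk (k := 3) (by norm_num) hpqr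
  have hKd := abs_le.1 (abs_avg_triangle_sub_le h₁ h₂ h₃
    (fun x y => abs_le_one_of_zero_or_one (R₁01 x y))
    (fun x y => abs_le_one_of_zero_or_one (R₂01 x y)) hp.le hp1 hr.le hr1)
  set EK := 𝔼 x, 𝔼 y, 𝔼 z, R₁ x y * (R₂ x z * R₃ y z) with hEK
  have hTlow : (1 - 1 / 64) * (d * p * q * r) ≤ 𝔼 x, 𝔼 y, 𝔼 z, T x y z := by
    have e1 : (1 - 1 / 64) * (d * p * q * r) = d * ((1 - 1 / 64) * (p * q * r)) := by ring
    rw [hT, e1]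
    exact mul_le_mul_of_nonneg_left (by linarith) hd.le
  have hTup : 𝔼 x, 𝔼 y, 𝔼 z, T x y z ≤ 2 * (d * p * q * r) := by
    have e1 : 2 * (d * p * q * r) = d * (2 * (p * q * r)) := by ring
    have h0 : 0 < p * q * r := by positivity
    rw [hT, e1]
    exact mul_le_mul_of_nonneg_left (by linarith) hd.le
  have hcubeT : d ^ 8 * (p * q * r) ^ 4 / 2 ≤ cubeAvg T := by
    have a1 := hρk (k := 1) (by norm_num) (by rwa [pow_one] : P ^ 1 ≤ p)
    have a2 := hρk (k := 2) (by norm_num) (pow_le_pow_left₀ hP.le hPq 2)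
    have a3 := hρk (k := 4) (by norm_num) (pow_le_pow_left₀ hP.le hPr 4)
    have b2 : 0 < q ^ 2 := by positivity
    have b3 : 0 < r ^ 4 := by positivity
    exact cubeAvg_ge_of_cut R₁01 R₂01 R₃01 T01 T₁ T₂ T₃ h₁ h₂ h₃ hp hq hr hd hq1 hr1
      (by linarith) (by linarith) (by linarith) hTlow
  have hcubeK := cubeAvg_triangle_le h₁ h₂ h₃ R₁01 R₂01 R₃01 hp.le hp1 hq.le hq1 hr.le hr1
  have hR : ∀ {a b : ℝ}, (a = 0 ∨ a = 1) → (b = 0 ∨ b = 1) → a * b ≤ a ∧ a * b ≤ b := by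
    rintro a b (rfl | rfl) (rfl | rfl) <;> norm_num
  set Q := p * q * r with hQ
  have hQ0 : 0 < Q := by positivity
  have hQ1 : Q ≤ 1 := mul_le_one₀ (mul_le_one₀ hp1 hq.le hq1) hr.le hr1
  rcases le_total d (densityThreshold t) with hdt | hdt
  · -- The sparse regime.
    rw [densityThreshold, ← hκ₁] at hdt
    set e := d ^ 2 * κ₁ ^ 2 / 64 with he
    have he0 : 0 < e := by positivity
    have he4 : e ^ 4 = d ^ 8 * κ₁ ^ 8 / 64 ^ 4 := by rw [he]; ring
    have hsm : ρ ≤ e ^ 4 * (d * p * q * r) ^ 8 / 64 := by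
      have h4 : P ^ 4 ≤ d * p * q * r := by
        calc P ^ 4 = P * P ^ 3 := by ring
          _ ≤ d * Q := by gcongr
          _ = _ := by rw [hQ]; ring
      refine hρ'.trans ?_
      calc P ^ 40 * (κ₀ ^ 8 / 64 ^ 7) = P ^ 8 * κ₀ ^ 8 / 64 ^ 7 * (P ^ 4) ^ 8 := by ring
        _ ≤ d ^ 8 * κ₁ ^ 8 / 64 ^ 5 * (d * p * q * r) ^ 8 := by
            gcongr <;> norm_num
        _ = _ := by rw [he4]; ring
    have hsm4 : ρ ≤ e ^ 4 * Q ^ 4 / 64 := by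
      refine hsm.trans ?_
      have e1 : d * p * q * r = d * Q := by rw [hQ]; ring
      have e2 : (d * Q) ^ 8 ≤ Q ^ 4 := by
        calc (d * Q) ^ 8 ≤ (1 * Q) ^ 8 := by gcongr
          _ = Q ^ 8 := by rw [one_mul]
          _ ≤ Q ^ 4 := pow_le_pow_of_le_one hQ0.le hQ1 (by norm_num)
      rw [e1]; gcongr
    have hsm1 : ρ ≤ e ^ 4 * Q / 64 := by
      refine hsm4.trans ?_
      have e2 : Q ^ 4 ≤ Q := pow_le_of_le_one hQ0.le hQ1 (by norm_num)
      gcongr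
    have hd2 : d ^ 2 ≤ 1 := pow_le_one₀ hd.le hd1
    have hκ2 : κ₁ ^ 2 ≤ 1 := pow_le_one₀ hκ₁p.le hκ₁1
    have hdκ : d ^ 2 * κ₁ ^ 2 ≤ 1 := mul_le_one₀ hd2 (sq_nonneg _) hκ2
    have he1 : e ≤ 1 / 10 := by rw [he]; linarith
    have he41 : e ^ 4 ≤ 1 := pow_le_one₀ he0.le (by linarith)
    have hu : d ^ 63 ≤ e ^ 4 / 64 ^ 3 := by
      calc d ^ 63 = d ^ 8 * d ^ 55 := by ring
        _ ≤ d ^ 8 * (κ₁ ^ 8 / 64 ^ 7) := by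
            gcongr
            exact (pow_le_of_le_one hd.le hd1 (by norm_num)).trans hdt
        _ = _ := by rw [he4]; ring
    have hpow : (1 + d ^ 63) ^ 8 ≤ 1 + e ^ 4 / 32 := by
      refine (one_add_pow_eight_le (by positivity) (pow_le_one₀ hd.le hd1)).trans ?_
      have he4p : 0 < e ^ 4 := by positivity
      linarith only [hu, he4p]
    have htri : Triangles R₁ R₂ R₃ T p q r d e ρ :=
      { R₁01, R₂01, R₃01, T01
        T_le₁ := T₁
        T_le₂ := T₂
        T_le₃ := T₃
        p_pos := hp
        p_le := hp1
        q_pos := hq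
        q_le := hq1
        r_pos := hr
        r_le := hr1
        d_pos := hd
        d_le := hd1
        e_pos := he0
        e_le := he1
        cut₁ := h₁
        cut₂ := h₂
        cut₃ := h₃
        small := hsm
        count8 := by
          have e1 : (d + d ^ 64) ^ 8 = d ^ 8 * (1 + d ^ 63) ^ 8 := by ring
          have e2 : Q ^ 4 + 12 * ρ ≤ (1 + 3 / 16 * e ^ 4) * Q ^ 4 := by
            linarith only [hsm4]
          have e3 : (1 + e ^ 4 / 32) * (1 + 3 / 16 * e ^ 4) ≤ 1 + e ^ 4 / 4 := by
            have he4p : 0 ≤ e ^ 4 := by positivity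
            nlinarith only [mul_le_mul_of_nonneg_left he41 he4p, he4p]
          refine hcube.trans ((mul_le_mul_of_nonneg_left (hcubeK.trans e2) (by positivity)).trans ?_)
          rw [e1]
          calc _ ≤ d ^ 8 * (1 + e ^ 4 / 32) * ((1 + 3 / 16 * e ^ 4) * Q ^ 4) := by gcongr
            _ = ((1 + e ^ 4 / 32) * (1 + 3 / 16 * e ^ 4)) * (d ^ 8 * Q ^ 4) := by ring
            _ ≤ _ := by gcongr
        count := by
          have e1 : (1 - e ^ 4 / 4) * (d * p * q * r) = d * ((1 - e ^ 4 / 4) * Q) := by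
            rw [hQ]; ring
          rw [hT, e1]
          have : 0 ≤ e ^ 4 * Q := by positivity
          exact mul_le_mul_of_nonneg_left (by linarith) hd.le }
    obtain ⟨a, b, c, ha, hb, hc, h⟩ := htri.exists_correlation hf (l := t ^ 8 / 2) (by positivity)
      (by linarith) hκ₁ (by rw [he]; linarith) (by
        refine le_trans ?_ hL
        have := mul_le_mul_of_nonneg_left hcubeT (show 0 ≤ t ^ 8 by positivity)
        linarith)
    refine ⟨a, b, c, ha, hb, hc, le_trans ?_ h⟩
    have hT0 : 0 ≤ 𝔼 x, 𝔼 y, 𝔼 z, T x y z := avg_nonneg fun x => avg_nonneg fun y =>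
      avg_nonneg fun z => nonneg_of_zero_or_one (T01 x y z)
    calc _ ≤ κ₁ ^ 2 / 64 * (2 * (d * p * q * r)) := by gcongr
      _ = _ := by ring
  · -- The dense regime.
    set e := κ₀ ^ 2 / 64 with he
    have he0 : 0 < e := by positivity
    have he4 : e ^ 4 = κ₀ ^ 8 / 64 ^ 4 := by rw [he]; ring
    have hsm : ρ ≤ e ^ 4 * Q ^ 8 / 64 := by
      refine hρ'.trans ?_
      calc P ^ 40 * (κ₀ ^ 8 / 64 ^ 7) ≤ P ^ 24 * (κ₀ ^ 8 / 64 ^ 7) := by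
            have := hPk (k := 24) (by norm_num)
            gcongr
        _ = κ₀ ^ 8 / 64 ^ 7 * (P ^ 3) ^ 8 := by ring
        _ ≤ κ₀ ^ 8 / 64 ^ 5 * Q ^ 8 := by
            gcongr <;> norm_num
        _ = _ := by rw [he4]; ring
    have hsm4 : ρ ≤ e ^ 4 * Q ^ 4 / 64 := by
      refine hsm.trans ?_
      have e2 : Q ^ 8 ≤ Q ^ 4 := pow_le_pow_of_le_one hQ0.le hQ1 (by norm_num)
      gcongr
    have hsm1 : ρ ≤ e ^ 4 * Q / 64 := by
      refine hsm4.trans ?_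
      have e2 : Q ^ 4 ≤ Q := pow_le_of_le_one hQ0.le hQ1 (by norm_num)
      gcongr
    have hκ2 : κ₀ ^ 2 ≤ 1 := pow_le_one₀ hκ₀p.le hκ₀1
    have hT0 : ∀ x y z, T x y z ≤ K x y z := fun x y z =>
      le_mul_of_zero_or_one (T01 x y z) (T₁ x y z)
        (le_mul_of_zero_or_one (T01 x y z) (T₂ x y z) (T₃ x y z))
    have hdpos := densityThreshold_pos ht
    have htri : Triangles R₁ R₂ R₃ K p q r 1 e ρ :=
      { R₁01, R₂01, R₃01
        T01 := fun x y z => mul_zero_or_one (R₁01 _ _) (mul_zero_or_one (R₂01 _ _) (R₃01 _ _))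
        T_le₁ := fun x y z => (hR (R₁01 _ _) (mul_zero_or_one (R₂01 _ _) (R₃01 _ _))).1
        T_le₂ := fun x y z => (hR (R₁01 _ _) (mul_zero_or_one (R₂01 _ _) (R₃01 _ _))).2.trans
          (hR (R₂01 _ _) (R₃01 _ _)).1
        T_le₃ := fun x y z => (hR (R₁01 _ _) (mul_zero_or_one (R₂01 _ _) (R₃01 _ _))).2.trans
          (hR (R₂01 _ _) (R₃01 _ _)).2
        p_pos := hp
        p_le := hp1
        q_pos := hq
        q_le := hq1
        r_pos := hr
        r_le := hr1
        d_pos := one_pos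
        d_le := le_rfl
        e_pos := he0
        e_le := by rw [he]; linarith
        cut₁ := h₁
        cut₂ := h₂
        cut₃ := h₃
        small := by rwa [one_mul]
        count8 := by
          rw [one_pow, one_mul]
          linarith
        count := by
          have : 0 ≤ e ^ 4 * Q := by positivity
          rw [one_mul]
          linarith }
    obtain ⟨a, b, c, ha, hb, hc, h⟩ := htri.exists_correlation
      (fun x y z => (hf x y z).trans (hT0 x y z)) (l := t ^ 8 * densityThreshold t ^ 8 / 2)
      (by positivity) (by
        have := pow_le_one₀ (n := 8) hdpos.le (densityThreshold_le_one ht ht1)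
        have := mul_le_one₀ ht8 (by positivity) this
        linarith) hκ₀ (by rw [he]; linarith) (by
        refine le_trans ?_ hL
        have a1 := mul_le_mul_of_nonneg_left hcubeT (show 0 ≤ t ^ 8 by positivity)
        have a2 : densityThreshold t ^ 8 ≤ d ^ 8 := pow_le_pow_left₀ hdpos.le hdt 8
        refine le_trans ?_ a1
        calc _ = t ^ 8 * (densityThreshold t ^ 8 * Q ^ 4 / 2) := by ring
          _ ≤ _ := by gcongr)
    refine ⟨a, b, c, ha, hb, hc, le_trans ?_ h⟩
    have hdQ : d * p * q * r ≤ 1 * p * q * r := by gcongr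
    calc _ ≤ κ₀ ^ 2 / 64 * (2 * (1 * p * q * r)) := by gcongr; linarith
      _ = _ := by ring

/-- The box norm of an arbitrary bounded function on a product set is controlled by correlations. -/
theorem exists_correlation_of_dense (hf : ∀ x y z, |f x y z| ≤ 1) {l : ℝ} (hl : 0 < l)
    (hl1 : l ≤ 1) (hL : l ≤ cubeAvg f) :
    ∃ (a : X → Y → ℝ) (b : X → Z → ℝ) (c : Y → Z → ℝ), (∀ x y, |a x y| ≤ 1) ∧
      (∀ x z, |b x z| ≤ 1) ∧ (∀ y z, |c y z| ≤ 1) ∧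
      gain l ^ 2 / 32 ≤ 𝔼 x, 𝔼 y, 𝔼 z, f x y z * (a x y * (b x z * c y z)) := by
  have hg := gain_pos hl
  have hg1 := gain_le_one hl.le hl1
  have hg2 : gain l ^ 2 ≤ 1 := pow_le_one₀ hg.le hg1
  have htri : Triangles (fun (_ : X) (_ : Y) => (1 : ℝ)) (fun (_ : X) (_ : Z) => 1)
      (fun (_ : Y) (_ : Z) => 1) (fun _ _ _ => 1) 1 1 1 1 (gain l ^ 2 / 64) 0 :=
    { R₁01 := fun _ _ => Or.inr rfl
      R₂01 := fun _ _ => Or.inr rfl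
      R₃01 := fun _ _ => Or.inr rfl
      T01 := fun _ _ _ => Or.inr rfl
      T_le₁ := fun _ _ _ => le_rfl
      T_le₂ := fun _ _ _ => le_rfl
      T_le₃ := fun _ _ _ => le_rfl
      p_pos := one_pos
      p_le := le_rfl
      q_pos := one_pos
      q_le := le_rfl
      r_pos := one_pos
      r_le := le_rfl
      d_pos := one_pos
      d_le := le_rfl
      e_pos := by positivity
      e_le := by linarith
      cut₁ := by simp [CutUniform]
      cut₂ := by simp [CutUniform]
      cut₃ := by simp [CutUniform]
      small := by positivity
      count8 := by
        have : 0 ≤ (gain l ^ 2 / 64) ^ 4 / 4 := by positivity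
        simp only [cubeAvg, mul_one, one_pow, Fintype.expect_const]
        linarith
      count := by
        have : 0 ≤ (gain l ^ 2 / 64) ^ 4 / 4 := by positivity
        simp only [mul_one, Fintype.expect_const]
        linarith }
  obtain ⟨a, b, c, ha, hb, hc, h⟩ := htri.exists_correlation hf hl hl1 rfl (by linarith)
    (by simpa using hL)
  exact ⟨a, b, c, ha, hb, hc, by simpa using h⟩

end Regimes

/-! ### Passing to subsets -/

section Subsets

variable {V W : Type*} [Fintype V] [Fintype W]

theorem expect_coe (S : Finset V) (f : V → ℝ) : 𝔼 x ∈ S, f x = 𝔼 x : S, f x := by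
  rw [Finset.expect_eq_sum_div_card, Fintype.expect_eq_sum_div_card, Fintype.card_coe,
    Finset.sum_coe_sort]

theorem avg_eq_avg_coe (S : Finset V) {f : V → ℝ} (hf : ∀ x, x ∉ S → f x = 0) :
    𝔼 x, f x = (S.card / Fintype.card V : ℝ) * 𝔼 x : S, f x := by
  rw [Fintype.expect_eq_sum_div_card, Fintype.expect_eq_sum_div_card, Fintype.card_coe,
    Finset.sum_coe_sort S f,
    ← Finset.sum_subset (Finset.subset_univ S) (fun x _ hx => hf x hx)]
  rcases S.eq_empty_or_nonempty with rfl | h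
  · simp
  · have : (S.card : ℝ) ≠ 0 := by exact_mod_cast h.card_pos.ne'
    field_simp

theorem avg_ind [DecidableEq V] (A : Finset V) : 𝔼 x, ind A x = A.card / Fintype.card V := by
  rw [Fintype.expect_eq_sum_div_card]
  simp [ind]

variable {S₁ S₂ S₃ : Finset V} {g : V → V → V → ℝ}

theorem avg_triple_eq_coe (h₁ : ∀ x y z, x ∉ S₁ → g x y z = 0) (h₂ : ∀ x y z, y ∉ S₂ → g x y z = 0)
    (h₃ : ∀ x y z, z ∉ S₃ → g x y z = 0) :
    𝔼 x, 𝔼 y, 𝔼 z, g x y z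
      = ((S₁.card / Fintype.card V) * (S₂.card / Fintype.card V) * (S₃.card / Fintype.card V) : ℝ)
        * 𝔼 x : S₁, 𝔼 y : S₂, 𝔼 z : S₃, g x y z := by
  rw [avg_eq_avg_coe S₁ fun x hx => by simp only [h₁ x _ _ hx, Finset.expect_const_zero]]
  have e2 : ∀ x, 𝔼 y, 𝔼 z, g x y z = (S₂.card / Fintype.card V : ℝ) * 𝔼 y : S₂, 𝔼 z, g x y z :=
    fun x => avg_eq_avg_coe S₂ fun y hy => by simp only [h₂ x y _ hy, Finset.expect_const_zero]
  have e3 : ∀ x y, 𝔼 z, g x y z = (S₃.card / Fintype.card V : ℝ) * 𝔼 z : S₃, g x y z :=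
    fun x y => avg_eq_avg_coe S₃ fun z hz => h₃ x y z hz
  simp only [e2]
  simp only [e3, ← Finset.mul_expect]
  ring

theorem avg_quadruple_eq_coe {S S' : Finset V} {F : V → V → V → V → ℝ}
    (h₁ : ∀ i j k l, i ∉ S → F i j k l = 0) (h₂ : ∀ i j k l, j ∉ S → F i j k l = 0)
    (h₃ : ∀ i j k l, k ∉ S' → F i j k l = 0) (h₄ : ∀ i j k l, l ∉ S' → F i j k l = 0) :
    𝔼 i, 𝔼 j, 𝔼 k, 𝔼 l, F i j k l
      = ((S.card / Fintype.card V) ^ 2 * (S'.card / Fintype.card V) ^ 2 : ℝ)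
        * 𝔼 i : S, 𝔼 j : S, 𝔼 k : S', 𝔼 l : S', F i j k l := by
  rw [avg_eq_avg_coe S fun i hi => by simp only [h₁ i _ _ _ hi, Finset.expect_const_zero]]
  have e2 : ∀ i, 𝔼 j, 𝔼 k, 𝔼 l, F i j k l
      = (S.card / Fintype.card V : ℝ) * 𝔼 j : S, 𝔼 k, 𝔼 l, F i j k l :=
    fun i => avg_eq_avg_coe S fun j hj => by simp only [h₂ i j _ _ hj, Finset.expect_const_zero]
  have e3 : ∀ i j, 𝔼 k, 𝔼 l, F i j k l
      = (S'.card / Fintype.card V : ℝ) * 𝔼 k : S', 𝔼 l, F i j k l :=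
    fun i j => avg_eq_avg_coe S' fun k hk => by
      simp only [h₃ i j k _ hk, Finset.expect_const_zero]
  have e4 : ∀ i j k, 𝔼 l, F i j k l = (S'.card / Fintype.card V : ℝ) * 𝔼 l : S', F i j k l :=
    fun i j k => avg_eq_avg_coe S' fun l hl => h₄ i j k l hl
  simp only [e2]
  simp only [e3]
  simp only [e4, ← Finset.mul_expect]
  ring

theorem cubeAvg_eq_coe (h₁ : ∀ x y z, x ∉ S₁ → g x y z = 0) (h₂ : ∀ x y z, y ∉ S₂ → g x y z = 0)
    (h₃ : ∀ x y z, z ∉ S₃ → g x y z = 0) :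
    cubeAvg g
      = ((S₁.card / Fintype.card V) * (S₂.card / Fintype.card V) * (S₃.card / Fintype.card V) : ℝ)
        ^ 2 * cubeAvg (fun (x : S₁) (y : S₂) (z : S₃) => g x y z) := by
  unfold cubeAvg
  rw [avg_quadruple_eq_coe (S := S₃) (S' := S₂) (fun z z' y y' hz => by simp [h₃ _ _ z hz])
    (fun z z' y y' hz => by simp [h₃ _ _ z' hz]) (fun z z' y y' hy => by simp [h₂ _ y _ hy])
    (fun z z' y y' hy => by simp [h₂ _ y' _ hy]), mul_pow, mul_pow]
  have e1 : ∀ z z' y y', 𝔼 x, g x y z * g x y z' * (g x y' z * g x y' z')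
      = (S₁.card / Fintype.card V : ℝ)
        * 𝔼 x : S₁, g x y z * g x y z' * (g x y' z * g x y' z') := fun z z' y y' =>
    avg_eq_avg_coe S₁ fun x hx => by simp [h₁ x _ _ hx]
  have e2 : 𝔼 z : S₃, 𝔼 z' : S₃, 𝔼 y : S₂, 𝔼 y' : S₂,
        (𝔼 x, g x y z * g x y z' * (g x y' z * g x y' z')) ^ 2
      = (S₁.card / Fintype.card V : ℝ) ^ 2 * 𝔼 z : S₃, 𝔼 z' : S₃, 𝔼 y : S₂, 𝔼 y' : S₂,
        (𝔼 x : S₁, g x y z * g x y z' * (g x y' z * g x y' z')) ^ 2 := by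
    rw [Finset.mul_expect]
    refine avg_congr fun z => ?_
    rw [Finset.mul_expect]
    refine avg_congr fun z' => ?_
    rw [Finset.mul_expect]
    refine avg_congr fun y => ?_
    rw [Finset.mul_expect]
    refine avg_congr fun y' => ?_
    rw [e1, mul_pow]
  rw [e2]
  ring

/-- A function with a small box norm has small averages against products of bounded functions of
one variable. -/
theorem abs_avg_le_of_boxNorm₂ {S : Finset V} {S' : Finset W} {g : V → W → ℝ} {ρ : ℝ}
    (h : boxNorm₂ S S' g ≤ ρ) {φ : S → ℝ} {ψ : S' → ℝ} (hφ : ∀ u, |φ u| ≤ 1)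
    (hψ : ∀ v, |ψ v| ≤ 1) : |𝔼 u : S, 𝔼 v : S', g u v * (φ u * ψ v)| ≤ ρ := by
  set m : S → S' → ℝ := fun u v => g u v with hm
  set B := 𝔼 v, 𝔼 w, (𝔼 u, m u v * m u w) ^ 2 with hB
  have eB : boxNorm₂ S S' g = B ^ (1 / 4 : ℝ) := by
    unfold boxNorm₂
    congr 1
    rw [hB]
    simp only [avg_sq_eq]
    rw [avg_swap₂₂, expect_coe]
    refine avg_congr fun x => ?_
    rw [expect_coe]
    refine avg_congr fun x' => ?_
    rw [expect_coe]
    refine avg_congr fun y => ?_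
    rw [expect_coe]
    refine avg_congr fun y' => ?_
    simp only [hm]
    ring
  have hB0 : 0 ≤ B := avg_nonneg fun _ => avg_nonneg fun _ => sq_nonneg _
  have hφ2 : ∀ u, φ u ^ 2 ≤ 1 := fun u => (sq_le_one_iff_abs_le_one _).2 (hφ u)
  have hψ2 : ∀ u, ψ u ^ 2 ≤ 1 := fun u => (sq_le_one_iff_abs_le_one _).2 (hψ u)
  rw [eB] at h
  have hρ0 : 0 ≤ ρ := (Real.rpow_nonneg hB0 _).trans h
  have hBρ : B ≤ ρ ^ 4 := by
    have := pow_le_pow_left₀ (Real.rpow_nonneg hB0 _) h 4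
    rwa [one_div, show (4 : ℝ) = ((4 : ℕ) : ℝ) by norm_num,
      Real.rpow_inv_natCast_pow hB0 (by norm_num)] at this
  rcases isEmpty_or_nonempty S with hS | hS
  · simpa using hρ0
  rcases isEmpty_or_nonempty S' with hS' | hS'
  · simpa using hρ0
  set Q := 𝔼 u, 𝔼 v, m u v * (φ u * ψ v) with hQ
  set G := 𝔼 u, (𝔼 v, m u v * ψ v) ^ 2 with hG
  have hG0 : 0 ≤ G := avg_nonneg fun _ => sq_nonneg _
  have h1 : Q ^ 2 ≤ G := by
    have a := avg_cauchy φ (fun u => 𝔼 v, m u v * ψ v)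
    have e : 𝔼 u, φ u * 𝔼 v, m u v * ψ v = Q := by
      simp only [hQ, Finset.mul_expect]
      exact avg_congr fun u => avg_congr fun v => by ring
    rw [e] at a
    exact a.trans (mul_le_of_le_one_left hG0 (avg_le_of_le hφ2))
  have h2 : G ^ 2 ≤ B := by
    have a := avg_cauchy₂ (fun v w => ψ v * ψ w) (fun v w => 𝔼 u, m u v * m u w)
    have e : 𝔼 v, 𝔼 w, ψ v * ψ w * 𝔼 u, m u v * m u w = G := by
      rw [hG, avg_row_sq]
      simp only [Finset.mul_expect]
      exact avg_congr fun v => avg_congr fun w => avg_congr fun u => by ring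
    rw [e] at a
    refine a.trans (mul_le_of_le_one_left hB0 (avg_le_of_le fun v => avg_le_of_le fun w => ?_))
    rw [mul_pow]
    exact mul_le_one₀ (hψ2 v) (sq_nonneg _) (hψ2 w)
  refine le_of_pow_le_pow_left₀ (n := 4) (by norm_num) hρ0 ?_
  have i1 := pow_le_pow_left₀ (sq_nonneg _) h1 2
  calc |Q| ^ 4 = (Q ^ 2) ^ 2 := by rw [show |Q| ^ 4 = (|Q| ^ 2) ^ 2 by ring, sq_abs]
    _ ≤ G ^ 2 := i1
    _ ≤ ρ ^ 4 := h2.trans hBρ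

theorem boxNorm₃_univ (g : V → V → V → ℝ) : boxNorm₃ univ univ univ g = cubeAvg g ^ (1 / 8 : ℝ) := by
  unfold boxNorm₃
  congr 1
  rw [cubeAvg_eq_column]
  simp only [avg_sq_eq]
  exact avg_congr fun x => avg_congr fun x' => avg_congr fun y => avg_congr fun y' =>
    avg_congr fun z => avg_congr fun z' => by ring

end Subsets

section Transfer

open Triangles

variable {V : Type*} [Fintype V] [DecidableEq V] [Nonempty V]

/-- The gain available whatever the density of `T`. -/
noncomputable def totalGain (t : ℝ) : ℝ :=
  uniformGain t ^ 2 / 64 * (gain (t ^ 8 * sparseThreshold t ^ 8) ^ 2 / 32)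

theorem ind_zero_or_one {α : Type*} [DecidableEq α] (A : Finset α) (x : α) :
    ind A x = 0 ∨ ind A x = 1 := by
  unfold ind; split_ifs <;> simp

theorem prob_le_one {α : Type*} [DecidableEq α] (A B : Finset α) : prob A B ≤ 1 := by
  unfold prob
  exact div_le_one_of_le₀ (by exact_mod_cast Finset.card_le_card Finset.inter_subset_right)
    (by positivity)

theorem avg_ind_prod (R : Finset (V × V)) :
    𝔼 x, 𝔼 y, ind R (x, y) = R.card / (Fintype.card V * Fintype.card V) := by
  rw [← avg_prod (fun s : V × V => ind R s), avg_ind, Fintype.card_prod]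
  push_cast
  rfl

theorem avg_ind_le_prob {S S' : Finset V} {R : Finset (V × V)} (hR : R ⊆ S ×ˢ S') :
    𝔼 x, 𝔼 y, ind R (x, y) ≤ prob R (S ×ˢ S') := by
  rw [avg_ind_prod, prob, Finset.inter_eq_left.2 hR, Finset.card_product]
  rcases (S ×ˢ S').eq_empty_or_nonempty with h | h
  · rw [h] at hR
    rw [Finset.subset_empty.1 hR]; simp
  · have h1 : 0 < S.card * S'.card := by rw [← Finset.card_product]; exact h.card_pos
    have h2 : (S.card : ℝ) ≤ Fintype.card V := by exact_mod_cast Finset.card_le_univ S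
    have h3 : (S'.card : ℝ) ≤ Fintype.card V := by exact_mod_cast Finset.card_le_univ S'
    have h4 : (0 : ℝ) < S.card * S'.card := by exact_mod_cast h1
    push_cast
    gcongr

/-- Extension by zero of a function on a product of two subsets. -/
noncomputable def extend {S S' : Finset V} (a : S → S' → ℝ) (x y : V) : ℝ :=
  if h : x ∈ S ∧ y ∈ S' then a ⟨x, h.1⟩ ⟨y, h.2⟩ else 0

theorem extend_coe {S S' : Finset V} (a : S → S' → ℝ) (x : S) (y : S') :
    extend a x y = a x y := by
  simp [extend]

theorem abs_extend_le {S S' : Finset V} {a : S → S' → ℝ} (ha : ∀ x y, |a x y| ≤ 1) (x y : V) :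
    |extend a x y| ≤ 1 := by
  unfold extend
  split_ifs
  · exact ha _ _
  · simp

theorem avg_pow_le_cubeAvg {T : V → V → V → ℝ} (T01 : ∀ x y z, T x y z = 0 ∨ T x y z = 1) :
    (𝔼 x, 𝔼 y, 𝔼 z, T x y z) ^ 8 ≤ cubeAvg T := by
  have Tle : ∀ x y z, T x y z ≤ 1 := fun x y z => le_one_of_zero_or_one (T01 x y z)
  have := cubeAvg_ge (R₁ := fun _ _ => 1) (R₂ := fun _ _ => 1) (R₃ := fun _ _ => 1)
    (fun _ _ => Or.inr rfl) (fun _ _ => Or.inr rfl) (fun _ _ => Or.inr rfl) T01 Tle Tle Tle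
  simpa using this

variable {S₁ S₂ S₃ : Finset V} {R₁ R₂ R₃ : Finset (V × V)} {T f : V → V → V → ℝ} {P t d : ℝ}

/-- Relative box norms are controlled by correlations, for a set `T` satisfying the pseudorandomness
conditions that admissibility imposes in one coordinate system. -/
theorem exists_correlation_of_admissible (hR₁ : R₁ ⊆ S₁ ×ˢ S₂) (hR₂ : R₂ ⊆ S₁ ×ˢ S₃)
    (hR₃ : R₃ ⊆ S₂ ×ˢ S₃) (T01 : ∀ x y z, T x y z = 0 ∨ T x y z = 1)
    (T₁ : ∀ x y z, T x y z ≤ ind R₁ (x, y)) (T₂ : ∀ x y z, T x y z ≤ ind R₂ (x, z))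
    (T₃ : ∀ x y z, T x y z ≤ ind R₃ (y, z)) (hf : ∀ x y z, |f x y z| ≤ T x y z)
    (hTP : 𝔼 x, 𝔼 y, 𝔼 z, T x y z = P) (hP : 0 < P) (ht : 0 < t) (ht1 : t ≤ 1) (hd0 : 0 ≤ d)
    (hd1 : d ≤ 1)
    (hT : 𝔼 x, 𝔼 y, 𝔼 z, T x y z
      = d * 𝔼 x, 𝔼 y, 𝔼 z, ind R₁ (x, y) * (ind R₂ (x, z) * ind R₃ (y, z)))
    (hcube : cubeAvg (fun x y z => T x y z - d * (ind R₁ (x, y) * (ind R₂ (x, z) * ind R₃ (y, z))))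
      ≤ (d ^ 64) ^ 8 * cubeAvg (fun x y z => ind R₁ (x, y) * (ind R₂ (x, z) * ind R₃ (y, z))))
    (h₁ : boxNorm₂ S₁ S₂ (fun x y => ind R₁ (x, y) - prob R₁ (S₁ ×ˢ S₂)) ≤ P ^ 64)
    (h₂ : boxNorm₂ S₁ S₃ (fun x y => ind R₂ (x, y) - prob R₂ (S₁ ×ˢ S₃)) ≤ P ^ 64)
    (h₃ : boxNorm₂ S₂ S₃ (fun x y => ind R₃ (x, y) - prob R₃ (S₂ ×ˢ S₃)) ≤ P ^ 64)
    (hL : t ^ 8 * cubeAvg T ≤ cubeAvg f) :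
    ∃ a b c : V → V → ℝ, (∀ x y, |a x y| ≤ 1) ∧ (∀ x z, |b x z| ≤ 1) ∧ (∀ y z, |c y z| ≤ 1) ∧
      totalGain t * P ≤ 𝔼 x, 𝔼 y, 𝔼 z, f x y z * (a x y * (b x z * c y z)) := by
  have T0 : ∀ x y z, 0 ≤ T x y z := fun x y z => nonneg_of_zero_or_one (T01 x y z)
  have Tle : ∀ x y z, T x y z ≤ 1 := fun x y z => le_one_of_zero_or_one (T01 x y z)
  have hP1 : P ≤ 1 := hTP ▸ avg_le_of_le fun x => avg_le_of_le fun y => avg_le_of_le fun z =>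
    Tle x y z
  have hs := sparseThreshold_pos ht
  have hs1 := sparseThreshold_le_one ht ht1
  have hu := uniformGain_pos ht
  have hu1 := uniformGain_le_one ht ht1
  have hl : 0 < t ^ 8 * sparseThreshold t ^ 8 := by positivity
  have hl1 : t ^ 8 * sparseThreshold t ^ 8 ≤ 1 :=
    mul_le_one₀ (pow_le_one₀ ht.le ht1) (by positivity) (pow_le_one₀ hs.le hs1)
  have hg := gain_pos hl
  have hg1 := gain_le_one hl.le hl1
  have hu2 : uniformGain t ^ 2 ≤ 1 := pow_le_one₀ hu.le hu1
  have hg2 : gain (t ^ 8 * sparseThreshold t ^ 8) ^ 2 ≤ 1 := pow_le_one₀ hg.le hg1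
  rcases le_total (sparseThreshold t) P with hPs | hPs
  · -- The set `T` is dense in the whole space, and the structure of the graphs is irrelevant.
    have hcT : P ^ 8 ≤ cubeAvg T := hTP ▸ avg_pow_le_cubeAvg T01
    obtain ⟨a, b, c, ha, hb, hc, h⟩ := exists_correlation_of_dense
      (fun x y z => (hf x y z).trans (Tle x y z)) hl hl1 (by
        refine le_trans ?_ hL
        have : sparseThreshold t ^ 8 ≤ P ^ 8 := pow_le_pow_left₀ hs.le hPs 8
        gcongr
        exact this.trans hcT)
    refine ⟨a, b, c, ha, hb, hc, le_trans ?_ h⟩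
    unfold totalGain
    have e1 : uniformGain t ^ 2 / 64 * (gain (t ^ 8 * sparseThreshold t ^ 8) ^ 2 / 32)
        ≤ 1 * (gain (t ^ 8 * sparseThreshold t ^ 8) ^ 2 / 32) := by gcongr; linarith
    calc _ ≤ 1 * (gain (t ^ 8 * sparseThreshold t ^ 8) ^ 2 / 32) * 1 := by gcongr
      _ = _ := by ring
  · -- Everything is restricted to `S₁ × S₂ × S₃`, where the graphs are uniform; box averages and
    -- densities scale by powers of the density `σ` of this box.
    have R₁m : ∀ x y, (x ∉ S₁ ∨ y ∉ S₂) → ind R₁ (x, y) = 0 := by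
      intro x y h
      refine if_neg fun hm => ?_
      have := Finset.mem_product.1 (hR₁ hm)
      tauto
    have R₂m : ∀ x z, (x ∉ S₁ ∨ z ∉ S₃) → ind R₂ (x, z) = 0 := by
      intro x z h
      refine if_neg fun hm => ?_
      have := Finset.mem_product.1 (hR₂ hm)
      tauto
    have R₃m : ∀ y z, (y ∉ S₂ ∨ z ∉ S₃) → ind R₃ (y, z) = 0 := by
      intro y z h
      refine if_neg fun hm => ?_
      have := Finset.mem_product.1 (hR₃ hm)
      tauto
    have Tm₁ : ∀ x y z, x ∉ S₁ → T x y z = 0 := fun x y z h =>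
      le_antisymm ((T₁ x y z).trans_eq (R₁m x y (Or.inl h))) (T0 x y z)
    have Tm₂ : ∀ x y z, y ∉ S₂ → T x y z = 0 := fun x y z h =>
      le_antisymm ((T₁ x y z).trans_eq (R₁m x y (Or.inr h))) (T0 x y z)
    have Tm₃ : ∀ x y z, z ∉ S₃ → T x y z = 0 := fun x y z h =>
      le_antisymm ((T₂ x y z).trans_eq (R₂m x z (Or.inr h))) (T0 x y z)
    have fm : ∀ x y z, T x y z = 0 → f x y z = 0 := fun x y z h =>
      abs_nonpos_iff.1 ((hf x y z).trans_eq h)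
    set K : V → V → V → ℝ := fun x y z => ind R₁ (x, y) * (ind R₂ (x, z) * ind R₃ (y, z)) with hK
    have Km₁ : ∀ x y z, x ∉ S₁ → K x y z = 0 := fun x y z h => by
      rw [hK]; dsimp only; rw [R₁m x y (Or.inl h), zero_mul]
    have Km₂ : ∀ x y z, y ∉ S₂ → K x y z = 0 := fun x y z h => by
      rw [hK]; dsimp only; rw [R₁m x y (Or.inr h), zero_mul]
    have Km₃ : ∀ x y z, z ∉ S₃ → K x y z = 0 := fun x y z h => by
      rw [hK]; dsimp only; rw [R₂m x z (Or.inr h), zero_mul, mul_zero]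
    have K01 : ∀ x y z, K x y z = 0 ∨ K x y z = 1 := fun x y z =>
      mul_zero_or_one (ind_zero_or_one _ _)
        (mul_zero_or_one (ind_zero_or_one _ _) (ind_zero_or_one _ _))
    obtain ⟨σ, hσ⟩ : ∃ σ : ℝ, σ = (S₁.card / Fintype.card V) * (S₂.card / Fintype.card V)
      * (S₃.card / Fintype.card V) := ⟨_, rfl⟩
    have eT := avg_triple_eq_coe Tm₁ Tm₂ Tm₃
    have eK := avg_triple_eq_coe Km₁ Km₂ Km₃
    have cT := cubeAvg_eq_coe Tm₁ Tm₂ Tm₃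
    have cK := cubeAvg_eq_coe Km₁ Km₂ Km₃
    have cf := cubeAvg_eq_coe (fun x y z h => fm x y z (Tm₁ x y z h))
      (fun x y z h => fm x y z (Tm₂ x y z h)) (fun x y z h => fm x y z (Tm₃ x y z h))
    rw [← hσ] at eT eK cT cK cf
    have hσ0 : 0 < σ := by
      refine lt_of_le_of_ne (by rw [hσ]; positivity) fun h => ?_
      rw [← h, zero_mul, hTP] at eT
      exact hP.ne' eT
    have hσ2 : 0 < σ ^ 2 := pow_pos hσ0 2
    have n₁ : Nonempty S₁ := by
      rw [Finset.nonempty_coe_sort, Finset.nonempty_iff_ne_empty]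
      intro h
      rw [hσ, h, Finset.card_empty] at hσ0
      norm_num at hσ0
    have n₂ : Nonempty S₂ := by
      rw [Finset.nonempty_coe_sort, Finset.nonempty_iff_ne_empty]
      intro h
      rw [hσ, h, Finset.card_empty] at hσ0
      norm_num at hσ0
    have n₃ : Nonempty S₃ := by
      rw [Finset.nonempty_coe_sort, Finset.nonempty_iff_ne_empty]
      intro h
      rw [hσ, h, Finset.card_empty] at hσ0
      norm_num at hσ0
    have hcube' := cubeAvg_le_of_sub hd0 (pow_nonneg hd0 64) hcube
    have P₁ : P ≤ prob R₁ (S₁ ×ˢ S₂) := hTP ▸ (avg_mono fun x => avg_mono fun y =>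
      avg_le_of_le fun z => T₁ x y z).trans (avg_ind_le_prob hR₁)
    have P₂ : P ≤ prob R₂ (S₁ ×ˢ S₃) := hTP ▸ (avg_mono fun x => avg_le_of_le fun y =>
      avg_mono fun z => T₂ x y z).trans (avg_ind_le_prob hR₂)
    have P₃ : P ≤ prob R₃ (S₂ ×ˢ S₃) := hTP ▸ (avg_le_of_le fun x => avg_mono fun y =>
      avg_mono fun z => T₃ x y z).trans (avg_ind_le_prob hR₃)
    have Pd : P ≤ d := by
      rw [← hTP, hT]
      exact mul_le_of_le_one_right hd0 (avg_le_of_le fun x => avg_le_of_le fun y =>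
        avg_le_of_le fun z => le_one_of_zero_or_one (K01 x y z))
    obtain ⟨a, b, c, ha, hb, hc, h⟩ := exists_correlation_of_sparse
      (R₁ := fun (x : S₁) (y : S₂) => ind R₁ (x, y)) (R₂ := fun (x : S₁) (z : S₃) => ind R₂ (x, z))
      (R₃ := fun (y : S₂) (z : S₃) => ind R₃ (y, z)) (T := fun x y z => T x y z)
      (f := fun x y z => f x y z) (ρ := P ^ 64) (d := d)
      (fun _ _ => ind_zero_or_one _ _) (fun _ _ => ind_zero_or_one _ _)
      (fun _ _ => ind_zero_or_one _ _) (fun _ _ _ => T01 _ _ _) (fun _ _ _ => T₁ _ _ _)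
      (fun _ _ _ => T₂ _ _ _) (fun _ _ _ => T₃ _ _ _) (fun _ _ _ => hf _ _ _)
      (fun φ ψ hφ hψ => abs_avg_le_of_boxNorm₂ h₁ hφ hψ)
      (fun φ ψ hφ hψ => abs_avg_le_of_boxNorm₂ h₂ hφ hψ)
      (fun φ ψ hφ hψ => abs_avg_le_of_boxNorm₂ h₃ hφ hψ)
      (prob_le_one _ _) (prob_le_one _ _) (prob_le_one _ _) hd1 hP P₁ P₂ P₃ Pd ht ht1 hPs le_rfl
      (by
        rw [eT, eK] at hT
        refine mul_left_cancel₀ hσ0.ne' (hT.trans ?_)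
        ring)
      (by
        rw [cT, cK] at hcube'
        refine le_of_mul_le_mul_left (hcube'.trans_eq ?_) hσ2
        ring)
      (by
        rw [cT, cf] at hL
        refine le_of_mul_le_mul_left (le_trans (le_of_eq ?_) hL) hσ2
        ring)
    refine ⟨extend a, extend b, extend c, abs_extend_le ha, abs_extend_le hb, abs_extend_le hc, ?_⟩
    rw [avg_triple_eq_coe (S₁ := S₁) (S₂ := S₂) (S₃ := S₃)
      (fun x y z h => by rw [fm x y z (Tm₁ x y z h), zero_mul])
      (fun x y z h => by rw [fm x y z (Tm₂ x y z h), zero_mul])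
      (fun x y z h => by rw [fm x y z (Tm₃ x y z h), zero_mul]), ← hσ]
    simp only [extend_coe]
    refine le_trans ?_ (mul_le_mul_of_nonneg_left h hσ0.le)
    have e1 : totalGain t ≤ uniformGain t ^ 2 / 64 * 1 := by
      unfold totalGain; gcongr; linarith
    have e2 : σ * (uniformGain t ^ 2 / 64 * 𝔼 x : S₁, 𝔼 y : S₂, 𝔼 z : S₃, T x y z)
        = uniformGain t ^ 2 / 64 * 1 * P := by rw [← hTP, eT]; ring
    rw [e2]
    exact mul_le_mul_of_nonneg_right e1 hP.le

end Transfer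

/-! ### From functions to sets -/

section Cells

variable {X Y Z : Type*} [Fintype X] [Fintype Y] [Fintype Z]

theorem exists_unit_sign_avg_ge (G a : X → Y → ℝ) (ha : ∀ x y, |a x y| ≤ 1) :
    ∃ σ : X → Y → ℝ, (∀ x y, σ x y = 1 ∨ σ x y = -1) ∧
      𝔼 x, 𝔼 y, a x y * G x y ≤ 𝔼 x, 𝔼 y, σ x y * G x y := by
  obtain ⟨σ, h1, h2⟩ := exists_unit_sign fun s : X × Y => G s.1 s.2
  refine ⟨fun x y => σ (x, y), fun x y => h1 (x, y), avg_mono fun x => avg_mono fun y => ?_⟩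
  refine le_trans ?_ (h2 (x, y)).le
  refine (le_abs_self _).trans ?_
  rw [abs_mul]
  exact mul_le_of_le_one_left (abs_nonneg _) (ha x y)

/-- A function of average zero that correlates with a product of three bounded functions also
correlates positively with a product of three indicator functions. The correlation is multilinear,
so that the bounded functions may be taken with values `±1`, and `(1 + a * b * c) / 2` is then the
sum of the indicators of four of the eight cells. -/
theorem exists_cell {f : X → Y → Z → ℝ} (h0 : 𝔼 x, 𝔼 y, 𝔼 z, f x y z = 0) {a : X → Y → ℝ}
    {b : X → Z → ℝ} {c : Y → Z → ℝ} (ha : ∀ x y, |a x y| ≤ 1) (hb : ∀ x z, |b x z| ≤ 1)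
    (hc : ∀ y z, |c y z| ≤ 1) {η : ℝ}
    (h : η ≤ 𝔼 x, 𝔼 y, 𝔼 z, f x y z * (a x y * (b x z * c y z))) :
    ∃ (α : X → Y → ℝ) (β : X → Z → ℝ) (γ : Y → Z → ℝ), (∀ x y, α x y = 0 ∨ α x y = 1) ∧
      (∀ x z, β x z = 0 ∨ β x z = 1) ∧ (∀ y z, γ y z = 0 ∨ γ y z = 1) ∧
      η / 8 ≤ 𝔼 x, 𝔼 y, 𝔼 z, f x y z * (α x y * (β x z * γ y z)) := by
  obtain ⟨a', ha', h1⟩ := exists_unit_sign_avg_ge (fun x y => 𝔼 z, f x y z * (b x z * c y z)) a ha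
  obtain ⟨b', hb', h2⟩ := exists_unit_sign_avg_ge (fun x z => 𝔼 y, f x y z * (a' x y * c y z)) b hb
  obtain ⟨c', hc', h3⟩ := exists_unit_sign_avg_ge (fun y z => 𝔼 x, f x y z * (a' x y * b' x z)) c hc
  have E1 : ∀ a : X → Y → ℝ, 𝔼 x, 𝔼 y, a x y * 𝔼 z, f x y z * (b x z * c y z)
      = 𝔼 x, 𝔼 y, 𝔼 z, f x y z * (a x y * (b x z * c y z)) := by
    intro a
    simp only [Finset.mul_expect]
    exact avg_congr fun x => avg_congr fun y => avg_congr fun z => by ring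
  have E2 : ∀ b : X → Z → ℝ, 𝔼 x, 𝔼 z, b x z * 𝔼 y, f x y z * (a' x y * c y z)
      = 𝔼 x, 𝔼 y, 𝔼 z, f x y z * (a' x y * (b x z * c y z)) := by
    intro b
    simp only [Finset.mul_expect]
    refine avg_congr fun x => ?_
    rw [avg_swap]
    exact avg_congr fun y => avg_congr fun z => by ring
  have E3 : ∀ c : Y → Z → ℝ, 𝔼 y, 𝔼 z, c y z * 𝔼 x, f x y z * (a' x y * b' x z)
      = 𝔼 x, 𝔼 y, 𝔼 z, f x y z * (a' x y * (b' x z * c y z)) := by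
    intro c
    simp only [Finset.mul_expect]
    rw [avg_swap₁₂ fun x y z => f x y z * (a' x y * (b' x z * c y z))]
    exact avg_congr fun y => avg_congr fun z => avg_congr fun x => by ring
  rw [E1, E1] at h1
  rw [E2, E2] at h2
  rw [E3, E3] at h3
  have h4 := h.trans (h1.trans (h2.trans h3))
  have h01 : ∀ {u : ℝ}, (u = 1 ∨ u = -1) → ((1 + u) / 2 = 0 ∨ (1 + u) / 2 = 1) := by
    rintro u (rfl | rfl) <;> norm_num
  have h01' : ∀ {u : ℝ}, (u = 1 ∨ u = -1) → ((1 - u) / 2 = 0 ∨ (1 - u) / 2 = 1) := by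
    rintro u (rfl | rfl) <;> norm_num
  set v₁ := 𝔼 x, 𝔼 y, 𝔼 z, f x y z * ((1 + a' x y) / 2 * ((1 + b' x z) / 2 * ((1 + c' y z) / 2)))
    with hv₁
  set v₂ := 𝔼 x, 𝔼 y, 𝔼 z, f x y z * ((1 + a' x y) / 2 * ((1 - b' x z) / 2 * ((1 - c' y z) / 2)))
    with hv₂
  set v₃ := 𝔼 x, 𝔼 y, 𝔼 z, f x y z * ((1 - a' x y) / 2 * ((1 + b' x z) / 2 * ((1 - c' y z) / 2)))
    with hv₃
  set v₄ := 𝔼 x, 𝔼 y, 𝔼 z, f x y z * ((1 - a' x y) / 2 * ((1 - b' x z) / 2 * ((1 + c' y z) / 2)))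
    with hv₄
  -- The four products sum to `(1 + a' b' c') / 2`.
  have h5 : 2 * (v₁ + (v₂ + (v₃ + v₄))) = (𝔼 x, 𝔼 y, 𝔼 z, f x y z)
      + 𝔼 x, 𝔼 y, 𝔼 z, f x y z * (a' x y * (b' x z * c' y z)) := by
    simp only [hv₁, hv₂, hv₃, hv₄, ← Finset.expect_add_distrib, Finset.mul_expect]
    exact avg_congr fun x => avg_congr fun y => avg_congr fun z => by ring
  by_contra hcon
  have k₁ : v₁ < η / 8 := lt_of_not_ge fun hh => hcon
    ⟨_, _, _, fun x y => h01 (ha' x y), fun x z => h01 (hb' x z), fun y z => h01 (hc' y z), hh⟩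
  have k₂ : v₂ < η / 8 := lt_of_not_ge fun hh => hcon
    ⟨_, _, _, fun x y => h01 (ha' x y), fun x z => h01' (hb' x z), fun y z => h01' (hc' y z), hh⟩
  have k₃ : v₃ < η / 8 := lt_of_not_ge fun hh => hcon
    ⟨_, _, _, fun x y => h01' (ha' x y), fun x z => h01 (hb' x z), fun y z => h01' (hc' y z), hh⟩
  have k₄ : v₄ < η / 8 := lt_of_not_ge fun hh => hcon
    ⟨_, _, _, fun x y => h01' (ha' x y), fun x z => h01' (hb' x z), fun y z => h01 (hc' y z), hh⟩
  rw [h0] at h5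
  linarith

end Cells

/-! ### Monomial bounds -/

section Monomials

/-- A function of the form `c * x ^ k` with `c > 0`. -/
def IsMonomial (F : ℝ → ℝ) : Prop := ∃ c : ℝ, 0 < c ∧ ∃ k : ℕ, ∀ x, F x = c * x ^ k

theorem IsMonomial.pow {F : ℝ → ℝ} (h : IsMonomial F) (n : ℕ) : IsMonomial fun x => F x ^ n := by
  obtain ⟨c, hc, k, h⟩ := h
  exact ⟨c ^ n, pow_pos hc n, k * n, fun x => by dsimp only; rw [h, mul_pow, pow_mul]⟩

theorem IsMonomial.mul {F G : ℝ → ℝ} (hF : IsMonomial F) (hG : IsMonomial G) :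
    IsMonomial fun x => F x * G x := by
  obtain ⟨c, hc, k, h⟩ := hF
  obtain ⟨c', hc', k', h'⟩ := hG
  exact ⟨c * c', mul_pos hc hc', k + k', fun x => by dsimp only; rw [h, h', pow_add]; ring⟩

theorem IsMonomial.div {F : ℝ → ℝ} (h : IsMonomial F) {u : ℝ} (hu : 0 < u) :
    IsMonomial fun x => F x / u := by
  obtain ⟨c, hc, k, h⟩ := h
  exact ⟨c / u, div_pos hc hu, k, fun x => by dsimp only; rw [h]; ring⟩

theorem IsMonomial.gain {F : ℝ → ℝ} (h : IsMonomial F) :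
    IsMonomial fun x => Corners.gain (F x) := by
  unfold Corners.gain
  have h1 := ((h.pow 8).div (u := 2 ^ 23) (by norm_num)).pow 4
  have h2 := (h1.div (u := 8) (by norm_num)).pow 4
  have h3 := (h2.div (u := 512) (by norm_num)).pow 2
  exact h3.div (by norm_num)

theorem IsMonomial.totalGain {F : ℝ → ℝ} (h : IsMonomial F) :
    IsMonomial fun x => Corners.totalGain (F x) := by
  have h1 : IsMonomial fun x => densityThreshold (F x) := by
    unfold densityThreshold
    exact (((h.pow 8).div (u := 2) (by norm_num)).gain.pow 8).div (by norm_num)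
  have h2 : IsMonomial fun x => uniformGain (F x) := by
    unfold uniformGain
    exact (((h.pow 8).mul (h1.pow 8)).div (u := 2) (by norm_num)).gain
  have h3 : IsMonomial fun x => sparseThreshold (F x) := by
    unfold sparseThreshold
    exact (h2.pow 8).div (by norm_num)
  have h4 := ((h.pow 8).mul (h3.pow 8)).gain.pow 2
  unfold Corners.totalGain
  exact ((h2.pow 2).div (u := 64) (by norm_num)).mul (h4.div (u := 32) (by norm_num))

/-- A monomial lower bound `c * x ^ k` that does not exceed `1 - x` can be replaced by a pure power
of `x`: the condition keeps `x` away from `1`. -/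
theorem exists_pow_le {c : ℝ} (hc : 0 < c) (k : ℕ) :
    ∃ m : ℕ, 2 ≤ m ∧ ∀ x : ℝ, 0 < x → x < 1 → c * x ^ k ≤ 1 - x → x ^ m ≤ c * x ^ k := by
  set θ : ℝ := max (1 / 2) (1 - c / 2 ^ k) with hθ
  have hθ0 : 0 ≤ θ := le_trans (by norm_num) (le_max_left _ _)
  have hθ1 : θ < 1 := max_lt (by norm_num) (by
    have : 0 < c / 2 ^ k := by positivity
    linarith)
  obtain ⟨n, hn⟩ := exists_pow_lt_of_lt_one hc hθ1
  refine ⟨k + (n + 2), by omega, fun x hx hx1 h => ?_⟩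
  have hxθ : x ≤ θ := by
    rcases le_total x (1 / 2) with h' | h'
    · exact h'.trans (le_max_left _ _)
    · refine le_trans ?_ (le_max_right _ _)
      have : c / 2 ^ k ≤ c * x ^ k := by
        rw [div_eq_mul_inv, ← inv_pow]
        gcongr
        linarith
      linarith
  rw [pow_add, mul_comm]
  refine mul_le_mul_of_nonneg_right ?_ (by positivity)
  calc x ^ (n + 2) ≤ x ^ n := pow_le_pow_of_le_one hx.le hx1.le (by omega)
    _ ≤ θ ^ n := pow_le_pow_left₀ hx.le hxθ n
    _ ≤ c := hn.le

end Monomials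

/-! ### Coordinates -/

section Coordinates

variable {V : Type*} [AddCommGroup V] [Fintype V] [DecidableEq V]

theorem bijective_ofCoords (l : Fin 4) :
    Function.Bijective fun s : V × V × V => ofCoords l s.1 s.2.1 s.2.2 := by
  refine (Finite.injective_iff_bijective).1 fun s s' h => ?_
  replace h : ofCoords l s.1 s.2.1 s.2.2 = ofCoords l s'.1 s'.2.1 s'.2.2 := h
  have e : ∀ i : Fin 3, ![s.1, s.2.1, s.2.2] i = ![s'.1, s'.2.1, s'.2.2] i := fun i => by
    rw [← coord_ofCoords l i, ← coord_ofCoords l i, h]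
  have e0 := e 0
  have e1 := e 1
  have e2 := e 2
  simp only [Matrix.cons_val] at e0 e1 e2
  exact Prod.ext e0 (Prod.ext e1 e2)

theorem avg_ofCoords (l : Fin 4) (F : V × V × V → ℝ) :
    𝔼 x, 𝔼 y, 𝔼 z, F (ofCoords l x y z) = 𝔼 s, F s := by
  have h := Fintype.expect_bijective _ (bijective_ofCoords (V := V) l)
    (fun s => F (ofCoords l s.1 s.2.1 s.2.2)) F (fun _ => rfl)
  simp only [avg_prod] at h ⊢
  exact h

theorem coord_ofCoords_zero (l : Fin 4) (x y z : V) :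
    coord (l.succAbove 0) (ofCoords l x y z) = x := coord_ofCoords l 0 x y z

theorem coord_ofCoords_one (l : Fin 4) (x y z : V) :
    coord (l.succAbove 1) (ofCoords l x y z) = y := coord_ofCoords l 1 x y z

theorem coord_ofCoords_two (l : Fin 4) (x y z : V) :
    coord (l.succAbove 2) (ofCoords l x y z) = z := coord_ofCoords l 2 x y z

theorem succAbove_lt (l : Fin 4) {i j : Fin 3} (h : i < j) : l.succAbove i < l.succAbove j :=
  Fin.strictMono_succAbove l h

/-- A point lies in the face opposite to `l` if it satisfies the three conditions that do not
involve the coordinate `l`. -/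
theorem mem_face_iff (t : TSystem V) (l : Fin 4) (s : V × V × V) :
    s ∈ t.face l ↔
      (coord (l.succAbove 0) s, coord (l.succAbove 1) s) ∈ t.R (l.succAbove 0) (l.succAbove 1) ∧
      (coord (l.succAbove 0) s, coord (l.succAbove 2) s) ∈ t.R (l.succAbove 0) (l.succAbove 2) ∧
      (coord (l.succAbove 1) s, coord (l.succAbove 2) s) ∈ t.R (l.succAbove 1) (l.succAbove 2) := by
  simp only [TSystem.face, overline, Finset.mem_filter, Finset.mem_univ, true_and]
  constructor
  · intro h
    exact ⟨h _ _ (succAbove_lt l (by decide)) (Fin.succAbove_ne l _) (Fin.succAbove_ne l _),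
      h _ _ (succAbove_lt l (by decide)) (Fin.succAbove_ne l _) (Fin.succAbove_ne l _),
      h _ _ (succAbove_lt l (by decide)) (Fin.succAbove_ne l _) (Fin.succAbove_ne l _)⟩
  · rintro ⟨h1, h2, h3⟩ j k hjk hj hk
    obtain ⟨i, rfl⟩ := Fin.exists_succAbove_eq hj
    obtain ⟨i', rfl⟩ := Fin.exists_succAbove_eq hk
    rw [(Fin.strictMono_succAbove l).lt_iff_lt] at hjk
    fin_cases i <;> fin_cases i' <;> first | exact absurd hjk (by decide) | assumption

theorem ind_face_ofCoords (t : TSystem V) (l : Fin 4) (x y z : V) :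
    ind (t.face l) (ofCoords l x y z)
      = ind (t.R (l.succAbove 0) (l.succAbove 1)) (x, y)
        * (ind (t.R (l.succAbove 0) (l.succAbove 2)) (x, z)
          * ind (t.R (l.succAbove 1) (l.succAbove 2)) (y, z)) := by
  have h := mem_face_iff t l (ofCoords l x y z)
  rw [coord_ofCoords_zero, coord_ofCoords_one, coord_ofCoords_two] at h
  unfold ind
  by_cases h1 : (x, y) ∈ t.R (l.succAbove 0) (l.succAbove 1) <;>
    by_cases h2 : (x, z) ∈ t.R (l.succAbove 0) (l.succAbove 2) <;>
    by_cases h3 : (y, z) ∈ t.R (l.succAbove 1) (l.succAbove 2) <;> simp [h, h1, h2, h3]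

theorem boxNorm_pow (l : Fin 4) (g : V × V × V → ℝ) :
    boxNorm l g ^ 8 = cubeAvg fun x y z => g (ofCoords l x y z) := by
  unfold boxNorm
  rw [boxNorm₃_univ, one_div, show (8 : ℝ) = ((8 : ℕ) : ℝ) by norm_num,
    Real.rpow_inv_natCast_pow (cubeAvg_nonneg _) (by norm_num)]

theorem boxNorm_nonneg (l : Fin 4) (g : V × V × V → ℝ) : 0 ≤ boxNorm l g := by
  unfold boxNorm
  rw [boxNorm₃_univ]
  exact Real.rpow_nonneg (cubeAvg_nonneg _) _

theorem TSystem.T_subset_face (t : TSystem V) (l : Fin 4) : t.T ⊆ t.face l := by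
  intro s hs
  simp only [TSystem.face, Finset.mem_filter, Finset.mem_univ, true_and]
  exact fun j k hjk _ _ => t.T_subset j k hjk hs

end Coordinates

/-! ### The density increment -/

section Increment

variable {V : Type*} [AddCommGroup V] [Fintype V] [DecidableEq V]

theorem avg_ind_ofCoords (l : Fin 4) (A : Finset (V × V × V)) :
    𝔼 x, 𝔼 y, 𝔼 z, ind A (ofCoords l x y z) = prob A univ := by
  rw [avg_ofCoords l (ind A), avg_ind, prob, Finset.inter_univ, Finset.card_univ]

/-- The bounds in the definition of admissibility are at most the power `x ^ 64` of the density. -/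
theorem mul_rpow_mul_rpow_le_pow {C κ ε x : ℝ} (hC : 64 ≤ C) (hκ1 : κ ≤ 1) (hε : 0 < ε)
    (hε1 : ε < 1) (hx : 0 ≤ x) (hx1 : x ≤ 1) : κ * ε ^ C * x ^ C ≤ x ^ 64 := by
  have h1 : ε ^ C ≤ 1 := Real.rpow_le_one hε.le hε1.le (by linarith)
  have h2 : x ^ C ≤ x ^ 64 := by
    rw [← Real.rpow_natCast]
    exact Real.rpow_le_rpow_of_exponent_ge' hx hx1 (by norm_num) (by exact_mod_cast hC)
  have h3 : 0 ≤ ε ^ C := Real.rpow_nonneg hε.le _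
  exact (mul_le_of_le_one_left (Real.rpow_nonneg hx _) (mul_le_one₀ hκ1 h3 h1)).trans h2

theorem prob_nonneg {α : Type*} [DecidableEq α] (A B : Finset α) : 0 ≤ prob A B := by
  unfold prob; positivity

theorem exists_ind_eq {α : V → V → ℝ} (h : ∀ x y, α x y = 0 ∨ α x y = 1) :
    ∃ Q : Finset (V × V), ∀ x y, ind Q (x, y) = α x y := by
  classical
  refine ⟨univ.filter fun s => α s.1 s.2 = 1, fun x y => ?_⟩
  unfold ind
  rcases h x y with h | h <;> simp [h]

/-- In an admissible system, a function of average zero with a large relative box norm has a large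
average over the part of `T` cut out by three sets of pairs. -/
theorem TSystem.Admissible.exists_correlation {t : TSystem V} {C κ ε : ℝ}
    (h : t.Admissible C κ ε) (hC : 64 ≤ C) (hκ1 : κ ≤ 1) (hne : t.T.Nonempty)
    {f : V × V × V → ℝ} (hf : ∀ s, |f s| ≤ ind t.T s) (hf0 : 𝔼 s, f s = 0) {τ : ℝ} (hτ : 0 < τ)
    (hτ1 : τ ≤ 1) {l : Fin 4} (hL : τ * boxNorm l (ind t.T) ≤ boxNorm l f) :
    ∃ Q₁ Q₂ Q₃ : Finset (V × V), totalGain τ / 8 * prob t.T univ ≤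
      𝔼 x, 𝔼 y, 𝔼 z, f (ofCoords l x y z) * (ind Q₁ (x, y) * (ind Q₂ (x, z) * ind Q₃ (y, z))) := by
  obtain ⟨hε, hε1, hface, hR, -⟩ := h
  have hP : 0 < prob t.T univ := by
    rw [prob, Finset.inter_univ]
    have h1 := hne.card_pos
    have h2 : 0 < (univ : Finset (V × V × V)).card := h1.trans_le (Finset.card_le_univ _)
    positivity
  have hF : ∀ x y z, ind t.T (ofCoords l x y z) ≤ ind (t.face l) (ofCoords l x y z) := by
    intro x y z
    unfold ind
    split_ifs with h1 h2
    · exact le_rfl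
    · exact absurd (t.T_subset_face l h1) h2
    · exact zero_le_one
    · exact le_rfl
  have hF' := fun x y z => ind_face_ofCoords t l x y z
  have R01 : ∀ {j k} (s : V × V), 0 ≤ ind (t.R j k) s ∧ ind (t.R j k) s ≤ 1 := by
    intro j k s
    rcases ind_zero_or_one (t.R j k) s with h | h <;> rw [h] <;> norm_num
  have hbox : ∀ {j k : Fin 4}, j < k → boxNorm₂ (t.S j) (t.S k)
        (fun x y => ind (t.R j k) (x, y) - prob (t.R j k) (t.S j ×ˢ t.S k))
      ≤ prob t.T univ ^ 64 := fun hjk => (hR _ _ hjk).trans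
    (mul_rpow_mul_rpow_le_pow hC hκ1 hε hε1 hP.le (prob_le_one _ _))
  have hfc : (t.face l).Nonempty := hne.mono (t.T_subset_face l)
  -- The box norm of the face is positive, so that the quotient in the hypothesis is a true quotient.
  have hPF : 0 < boxNorm l (ind (t.face l)) := by
    refine lt_of_le_of_ne (boxNorm_nonneg _ _) fun h0 => ?_
    have h1 := boxNorm_pow l (ind (t.face l))
    rw [← h0] at h1
    have h2 := avg_pow_le_cubeAvg (T := fun x y z => ind (t.face l) (ofCoords l x y z))
      fun x y z => ind_zero_or_one _ _
    have h3 : prob t.T univ ≤ 𝔼 x, 𝔼 y, 𝔼 z, ind (t.face l) (ofCoords l x y z) := by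
      rw [← avg_ind_ofCoords l]
      exact avg_mono fun x => avg_mono fun y => avg_mono fun z => hF x y z
    have h4 := pow_pos (hP.trans_le h3) 8
    norm_num at h1
    linarith
  have h01 := succAbove_lt l (show (0 : Fin 3) < 1 by decide)
  have h02 := succAbove_lt l (show (0 : Fin 3) < 2 by decide)
  have h12 := succAbove_lt l (show (1 : Fin 3) < 2 by decide)
  obtain ⟨a, b, c, ha, hb, hc, hcor⟩ := exists_correlation_of_admissible
    (f := fun x y z => f (ofCoords l x y z)) (d := prob t.T (t.face l))
    (t.R_subset _ _ h01) (t.R_subset _ _ h02) (t.R_subset _ _ h12)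
    (T := fun x y z => ind t.T (ofCoords l x y z)) (fun x y z => ind_zero_or_one _ _)
    (fun x y z => (hF x y z).trans (by
      rw [hF']
      exact mul_le_of_le_one_right (R01 _).1
        (mul_le_one₀ (R01 _).2 (R01 _).1 (R01 _).2)))
    (fun x y z => (hF x y z).trans (by
      rw [hF']
      exact (mul_le_of_le_one_left (mul_nonneg (R01 _).1 (R01 _).1) (R01 _).2).trans
        (mul_le_of_le_one_right (R01 _).1 (R01 _).2)))
    (fun x y z => (hF x y z).trans (by
      rw [hF']
      exact (mul_le_of_le_one_left (mul_nonneg (R01 _).1 (R01 _).1) (R01 _).2).trans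
        (mul_le_of_le_one_left (R01 _).1 (R01 _).2)))
    (fun x y z => hf _) (avg_ind_ofCoords l t.T) hP hτ hτ1 (prob_nonneg _ _) (prob_le_one _ _)
    (by
      simp only [← hF']
      rw [avg_ind_ofCoords, avg_ind_ofCoords, prob, prob, prob,
        Finset.inter_eq_left.2 (t.T_subset_face l), Finset.inter_univ, Finset.inter_univ]
      have : ((t.face l).card : ℝ) ≠ 0 := by exact_mod_cast hfc.card_pos.ne'
      field_simp)
    (by
      have h1 := (div_le_iff₀ hPF).1 ((hface l).trans
        (mul_rpow_mul_rpow_le_pow hC hκ1 hε hε1 (prob_nonneg _ _) (prob_le_one _ _)))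
      have h2 := pow_le_pow_left₀ (boxNorm_nonneg _ _) h1 8
      rw [mul_pow, boxNorm_pow, boxNorm_pow] at h2
      simpa only [hF'] using h2)
    (hbox h01) (hbox h02) (hbox h12)
    (by
      have h2 := pow_le_pow_left₀ (mul_nonneg hτ.le (boxNorm_nonneg _ _)) hL 8
      rwa [mul_pow, boxNorm_pow, boxNorm_pow] at h2)
  obtain ⟨α, β, γ, hα, hβ, hγ, hcell⟩ := exists_cell
    ((avg_ofCoords l f).trans hf0) ha hb hc hcor
  obtain ⟨Q₁, h₁⟩ := exists_ind_eq hα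
  obtain ⟨Q₂, h₂⟩ := exists_ind_eq hβ
  obtain ⟨Q₃, h₃⟩ := exists_ind_eq hγ
  refine ⟨Q₁, Q₂, Q₃, ?_⟩
  simp only [h₁, h₂, h₃]
  rwa [div_mul_eq_mul_div]

/-- The system obtained from `t` by intersecting the three sets of pairs that do not involve the
coordinate `l` with given sets; these are indexed by the positions of the remaining coordinates. -/
def TSystem.refine (t : TSystem V) (l : Fin 4) (Q : Fin 3 → Fin 3 → Finset (V × V)) :
    TSystem V where
  S := t.S
  R j k := (t.R j k).filter fun s => ∀ i i', j = l.succAbove i → k = l.succAbove i' → s ∈ Q i i'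
  T := t.T.filter fun s => ∀ i i', i < i' →
    (coord (l.succAbove i) s, coord (l.succAbove i') s) ∈ Q i i'
  R_subset j k hjk := (Finset.filter_subset _ _).trans (t.R_subset j k hjk)
  T_subset j k hjk := by
    intro s hs
    rw [Finset.mem_filter] at hs
    have h := t.T_subset j k hjk hs.1
    simp only [overline, Finset.mem_filter, Finset.mem_univ, true_and] at h ⊢
    refine ⟨h, ?_⟩
    rintro i i' rfl rfl
    exact hs.2 i i' ((Fin.strictMono_succAbove l).lt_iff_lt.1 hjk)

/-- The new `T` is cut out of the old one by its face alone: the conditions involving the coordinate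
`l` have not changed. -/
theorem TSystem.refine_T (t : TSystem V) (l : Fin 4) (Q : Fin 3 → Fin 3 → Finset (V × V)) :
    (t.refine l Q).T = t.T ∩ (t.refine l Q).face l := by
  refine Finset.Subset.antisymm (Finset.subset_inter (Finset.filter_subset _ _)
    (TSystem.T_subset_face _ l)) fun s hs => ?_
  rw [Finset.mem_inter] at hs
  refine Finset.mem_filter.2 ⟨hs.1, fun i i' hi => ?_⟩
  have h := (Finset.mem_filter.1 hs.2).2 _ _ (succAbove_lt l hi) (Fin.succAbove_ne l _)
    (Fin.succAbove_ne l _)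
  exact (Finset.mem_filter.1 (Finset.mem_filter.1 h).2).2 i i' rfl rfl

theorem TSystem.ind_refine_ofCoords (t : TSystem V) (l : Fin 4)
    (Q : Fin 3 → Fin 3 → Finset (V × V)) (x y z : V) :
    ind (t.refine l Q).T (ofCoords l x y z) = ind t.T (ofCoords l x y z)
      * (ind (Q 0 1) (x, y) * (ind (Q 0 2) (x, z) * ind (Q 1 2) (y, z))) := by
  have h : ofCoords l x y z ∈ (t.refine l Q).T ↔ ofCoords l x y z ∈ t.T ∧
      (x, y) ∈ Q 0 1 ∧ (x, z) ∈ Q 0 2 ∧ (y, z) ∈ Q 1 2 := by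
    refine Finset.mem_filter.trans (and_congr_right fun _ => ?_)
    simp only [coord_ofCoords]
    constructor
    · exact fun h => ⟨h 0 1 (by decide), h 0 2 (by decide), h 1 2 (by decide)⟩
    · rintro ⟨h1, h2, h3⟩ i i' hi
      fin_cases i <;> fin_cases i' <;> first | exact absurd hi (by decide) | assumption
  unfold ind
  by_cases h0 : ofCoords l x y z ∈ t.T <;> by_cases h1 : (x, y) ∈ Q 0 1 <;>
    by_cases h2 : (x, z) ∈ Q 0 2 <;> by_cases h3 : (y, z) ∈ Q 1 2 <;> simp [h, h0, h1, h2, h3]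

/-- A large relative box norm of the balanced function `A - δ * T` gives a density increment, whose
size is bounded below in terms of the box norm alone. -/
theorem CornerSystem.exists_increment (a : CornerSystem V) {C κ : ℝ}
    (h : a.toTSystem.Admissible C κ a.density) (hC : 64 ≤ C) (hκ1 : κ ≤ 1) {τ : ℝ}
    (hτ : 0 < τ) (hτ1 : τ ≤ 1) {l : Fin 4} (hL : τ * boxNorm l (ind a.T)
      ≤ boxNorm l fun s => ind a.A s - a.density * ind a.T s) :
    ∃ Q : Fin 3 → Fin 3 → Finset (V × V), totalGain τ / 8 ≤ 1 - a.density ∧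
      totalGain τ / 8 ≤ prob (a.refine l Q).T a.T ∧
      a.density + totalGain τ / 8 ≤ prob a.A (a.refine l Q).T := by
  have hδ : 0 < a.density := h.1
  have hδ1 : a.density < 1 := h.2.1
  have hne : a.T.Nonempty := by
    rw [Finset.nonempty_iff_ne_empty]
    intro h0
    rw [CornerSystem.density, prob, h0, Finset.card_empty] at hδ
    norm_num at hδ
  have hTc : (0 : ℝ) < a.T.card := by exact_mod_cast hne.card_pos
  have hA : (a.A.card : ℝ) = a.density * a.T.card := by
    rw [CornerSystem.density, prob, Finset.inter_eq_left.2 a.A_subset, div_mul_cancel₀ _ hTc.ne']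
  obtain ⟨Q₁, Q₂, Q₃, hQ⟩ := h.exists_correlation hC hκ1 hne
    (f := fun s => ind a.A s - a.density * ind a.T s) (fun s => by
      have := @a.A_subset s
      unfold ind
      split_ifs with h1 h2 h2
      · rw [abs_le]; constructor <;> linarith
      · exact absurd (this h1) h2
      · rw [abs_le]; constructor <;> linarith
      · simp)
    (by
      rw [Finset.expect_sub_distrib, ← Finset.mul_expect, avg_ind, avg_ind, hA]
      ring) hτ hτ1 hL
  set Q : Fin 3 → Fin 3 → Finset (V × V) := ![![∅, Q₁, Q₂], ![∅, ∅, Q₃], ![∅, ∅, ∅]] with hQdef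
  set T' := (a.refine l Q).T with hT'
  have hT'T : T' ⊆ a.T := Finset.filter_subset _ _
  have e : 𝔼 x, 𝔼 y, 𝔼 z, (ind a.A (ofCoords l x y z) - a.density * ind a.T (ofCoords l x y z))
      * (ind Q₁ (x, y) * (ind Q₂ (x, z) * ind Q₃ (y, z)))
      = prob (a.A ∩ T') univ - a.density * prob T' univ := by
    rw [← avg_ind_ofCoords l, ← avg_ind_ofCoords l]
    simp only [Finset.mul_expect, ← Finset.expect_sub_distrib]
    refine avg_congr fun x => avg_congr fun y => avg_congr fun z => ?_
    have e1 : ind T' (ofCoords l x y z) = ind a.T (ofCoords l x y z)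
        * (ind Q₁ (x, y) * (ind Q₂ (x, z) * ind Q₃ (y, z))) := a.ind_refine_ofCoords l Q x y z
    have e2 : ind a.A (ofCoords l x y z) = ind a.A (ofCoords l x y z)
        * ind a.T (ofCoords l x y z) := by
      have := @a.A_subset (ofCoords l x y z)
      unfold ind
      split_ifs <;> simp_all
    have e3 : ind (a.A ∩ T') (ofCoords l x y z) = ind a.A (ofCoords l x y z)
        * ind T' (ofCoords l x y z) := by
      unfold ind
      split_ifs <;> simp_all
    rw [e3, e1, sub_mul]
    nth_rewrite 1 [e2]
    ring
  rw [e] at hQ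
  set η := totalGain τ / 8 with hη
  have hη0 : 0 < η := by
    have h1 := uniformGain_pos hτ
    have h2 := sparseThreshold_pos hτ
    have h3 := gain_pos (show 0 < τ ^ 8 * sparseThreshold τ ^ 8 by positivity)
    rw [hη, totalGain]
    positivity
  have hN : (0 : ℝ) < (univ : Finset (V × V × V)).card := by
    exact_mod_cast hne.card_pos.trans_le (Finset.card_le_univ _)
  -- Clearing the common denominator, the number of points of the whole space.
  have key : η * a.T.card ≤ (a.A ∩ T').card - a.density * T'.card := by
    simp only [prob, Finset.inter_univ] at hQ
    rw [← mul_div_assoc, ← mul_div_assoc, ← sub_div] at hQ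
    exact (div_le_div_iff_of_pos_right hN).1 hQ
  have c1 : ((a.A ∩ T').card : ℝ) ≤ T'.card := by
    exact_mod_cast Finset.card_le_card Finset.inter_subset_right
  have c2 : (T'.card : ℝ) ≤ a.T.card := by exact_mod_cast Finset.card_le_card hT'T
  have c3 : 0 < (T'.card : ℝ) := by
    have := mul_pos hη0 hTc
    refine lt_of_le_of_ne (Nat.cast_nonneg _) fun h0 => ?_
    rw [← h0] at key c1
    linarith
  refine ⟨Q, ?_, ?_, ?_⟩
  · have : η * a.T.card ≤ (1 - a.density) * a.T.card := by nlinarith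
    exact le_of_mul_le_mul_right this hTc
  · rw [← hT', prob, Finset.inter_eq_left.2 hT'T, le_div_iff₀ hTc]
    nlinarith
  · rw [← hT', prob, le_div_iff₀ c3]
    nlinarith

end Increment

end Corners

theorem mainTheorem3 :
    ∃ C₀ : ℝ, 64 ≤ C₀ ∧ ∀ C : ℝ, C₀ ≤ C →
      ∃ κ₀ : ℝ, 0 < κ₀ ∧ κ₀ < 1 ∧ ∀ κadm : ℝ, 0 < κadm → κadm ≤ κ₀ →
        ∀ κ : ℝ, 0 < κ → ∃ κ' : ℝ, 0 < κ' ∧ κ' < 1 ∧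
          ∀ (n : ℕ) (H : Submodule (ZMod 5) (Fin n → ZMod 5)) [Fintype H]
            (a : Corners.CornerSystem H),
            a.toTSystem.Admissible C κadm a.density →
            ¬ a.UniformEnough κ →
            ∃ (t' : Corners.TSystem H) (l : Fin 4),
              (∀ i, t'.S i ⊆ a.S i) ∧
              (∀ j k, j < k → t'.R j k ⊆ a.R j k) ∧
              t'.T = a.T ∩ t'.face l ∧
              a.density ^ (1 / κ') ≤ Corners.prob t'.T a.T ∧
              a.density + a.density ^ (1 / κ') ≤ Corners.prob a.A t'.T := by
  refine ⟨64, le_rfl, fun C hC => ⟨1 / 2, by norm_num, by norm_num, fun κadm hadm hadm1 κ hκ => ?_⟩⟩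
  -- The gain is a monomial in `a.density`; replacing `κ` by `min κ 1` keeps its argument below `1`.
  have hk0 : 0 < min κ 1 := lt_min hκ one_pos
  have hmono : Corners.IsMonomial fun x : ℝ => min κ 1 * x ^ 4 := ⟨_, hk0, 4, fun _ => rfl⟩
  obtain ⟨c, hc, k, hF⟩ := hmono.totalGain.div (u := 8) (by norm_num)
  obtain ⟨m, hm, hpow⟩ := Corners.exists_pow_le hc k
  have hm' : (2 : ℝ) ≤ m := by exact_mod_cast hm
  -- The exponent `1 / κ'` is the integer `m`.
  refine ⟨1 / m, by positivity, by rw [div_lt_one (by linarith)]; linarith, ?_⟩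
  intro n H _ a hadmiss hnot
  have hδ : 0 < a.density := hadmiss.1
  have hδ1 : a.density < 1 := hadmiss.2.1
  obtain ⟨l, hl⟩ := not_forall.1 hnot
  rw [not_le] at hl
  -- A vanishing denominator would make the quotient `0`, which satisfies the uniformity condition.
  have hT0 : 0 < Corners.boxNorm l (Corners.ind a.T) := by
    refine lt_of_le_of_ne (Corners.boxNorm_nonneg _ _) fun h0 => ?_
    rw [← h0, div_zero] at hl
    have : 0 < κ * a.density ^ 4 := by positivity
    linarith
  have hτ1 : min κ 1 * a.density ^ 4 ≤ 1 :=
    mul_le_one₀ (min_le_right _ _) (by positivity) (pow_le_one₀ hδ.le hδ1.le)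
  obtain ⟨Q, h1, h2, h3⟩ := a.exists_increment hadmiss hC (hadm1.trans (by norm_num))
    (τ := min κ 1 * a.density ^ 4) (by positivity) hτ1 (l := l) (by
      refine le_trans ?_ ((lt_div_iff₀ hT0).1 hl).le
      gcongr
      exact min_le_left _ _)
  have hF' : Corners.totalGain (min κ 1 * a.density ^ 4) / 8 = c * a.density ^ k := hF _
  rw [hF'] at h1 h2 h3
  have hη := hpow _ hδ hδ1 h1
  rw [one_div_one_div, Real.rpow_natCast]
  exact ⟨a.refine l Q, l, fun _ => subset_rfl, fun _ _ _ => Finset.filter_subset _ _,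
    a.refine_T l Q, hη.trans h2, by linarith⟩
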